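/- Conventions. Let $X$ be a complex manifold of dimension $n$, $1\le p\le n-1$, $k=n-p$, $\sigma_p=i^{p^2}2^{-p}$. A real $(p,p)$-form $\Omega$ is \emph{transverse} if at every point, for all linearly independent $(1,0)$-covectors $\psi_1,\dots,\psi_k$, the $(n,n)$-form $\Omega\wedge\sigma_k\,\psi_1\wedge\dots\wedge\psi_k\wedge\overline{\psi_1\wedge\dots\wedge\psi_k}$ is strictly positive, i.e. equal to $c\,\sigma_n\,\chi_1\wedge\dots\wedge\chi_n\wedge\overline{\chi_1\wedge\dots\wedge\chi_n}$ with $c>0$ and $\chi_1,\dots,\chi_n$ a basis of the $(1,0)$-covectors. All forms are smooth. $X$ is - $p$K if it has a transverse $(p,p)$-form $\Omega$ with $d\Omega=0$; - $p$WK if it has a transverse $(p,p)$-form $\Omega$ with $\partial\Omega=\partial\bar\partial\alpha$ for some form $\alpha$; - $p$S if it has a real $2p$-form $\Psi$ with $d\Psi=0$ whose $(p,p)$-component is transverse; - $p$PL if it has a transverse $(p,p)$-form $\Omega$ with $\partial\bar\partial\Omega=0$ (such $\Omega$ is called a $p$PL form; SKT means 1PL). Let $G$ be $\mathbb C^4$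 with the group law $$z*a=\bigl(z_1+a_1,\;z_2+a_2,\;z_3+a_3-a_1z_2+\bar a_1z_1+\bar a_2z_2,\;z_4+a_4-a_1z_2\bigr).$$ **Theorem.** $G$ is a simply connected nilpotent Lie group whose right translations are holomorphic, and the $(1,0)$-forms $$\varphi_1=dz_1,\quad \varphi_2=dz_2,\quad \varphi_3=dz_3+z_1dz_2-\bar z_1dz_1-\bar z_2dz_2,\quad \varphi_4=dz_4+z_1dz_2$$ are invariant under all right translations. $G$ has lattices (discrete cocompact subgroups). For every lattice $\Gamma$, the quotient $M=G/\Gamma$, with the complex structure for which $G\to M$ is a local biholomorphism, is a compact connected Hausdorff complex manifold (a complex nilmanifold of dimension 4); the forms $\varphi_j$ descend to smooth $(1,0)$-forms on $M$, linearly independent at every point, with $$d\varphi_1=d\varphi_2=0,\quad \partial\varphi_3=\partial\varphi_4=\varphi_1\wedge\varphi_2,\quad \bar\partial\varphi_3=\varphi_1\wedge\bar\varphi_1+\varphi_2\wedge\bar\varphi_2,\quad \bar\partial\varphi_4=0,$$ and: 1. $\omega=\sigma_1\sum_{j=1}^4\varphi_j\wedge\bar\varphi_j$ is a 1PL form on $M$;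 so $M$ is 1PL (SKT). 2. $M$ is not 2PL. 3. $M$ is 3PL. 4. For $p=1,2,3$, $M$ is not $p$S, not $p$WK and not $p$K. Hence there is no index $q$ such that, for $s\in\{1,2,3\}$, $M$ is $s$PL if and only if $s\ge q$; that is, $M$ is not "$s$-Kähler from a certain index on". -/

import Mathlib

open scoped Manifold ContDiff

noncomputable section

/-! ### Complex valued exterior forms on a complex vector space -/

section LinearAlgebra

variable {V : Type*} [AddCommGroup V] [Module ℂ V] [TopologicalSpace V]

/-- The wedge product of complex valued real-alternating forms (sum over shuffles, i.e. the
convention for which `(α ∧ β)(v, w) = α v * β w - α w * β v` in degrees `1`, `1`). -/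
def wedge {k l : ℕ} (α : V [⋀^Fin k]→L[ℝ] ℂ) (β : V [⋀^Fin l]→L[ℝ] ℂ) :
    V [⋀^Fin (k + l)]→L[ℝ] ℂ where
  toMultilinearMap := (((LinearMap.mul' ℝ ℂ).compAlternatingMap
    (α.toAlternatingMap.domCoprod β.toAlternatingMap)).domDomCongr finSumFinEquiv).toMultilinearMap
  map_eq_zero_of_eq' := (((LinearMap.mul' ℝ ℂ).compAlternatingMap
    (α.toAlternatingMap.domCoprod β.toAlternatingMap)).domDomCongr finSumFinEquiv).map_eq_zero_of_eq'
  cont := by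
    change Continuous fun v : Fin (k + l) → V => LinearMap.mul' ℝ ℂ
      (α.toAlternatingMap.domCoprod β.toAlternatingMap (v ∘ finSumFinEquiv))
    simp only [AlternatingMap.domCoprod_apply, _root_.sum_apply, map_sum]
    refine continuous_finsetSum _ fun s _ => ?_
    induction s using Quotient.inductionOn' with
    | h s =>
      simp only [AlternatingMap.domCoprod.summand_mk'', _root_.smul_apply,
        MultilinearMap.domDomCongr_apply, MultilinearMap.domCoprod_apply]
      have h1 : Continuous fun v : Fin (k + l) → V =>
          α fun i => v (finSumFinEquiv (s (Sum.inl i))) :=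
        α.cont.comp (continuous_pi fun i => continuous_apply _)
      have h2 : Continuous fun v : Fin (k + l) → V =>
          β fun i => v (finSumFinEquiv (s (Sum.inr i))) :=
        β.cont.comp (continuous_pi fun i => continuous_apply _)
      have h3 : Continuous fun v : Fin (k + l) → V =>
          (Equiv.Perm.sign s) • ((α fun i => v (finSumFinEquiv (s (Sum.inl i)))) *
            (β fun i => v (finSumFinEquiv (s (Sum.inr i))))) := (h1.mul h2).const_smul _
      refine h3.congr fun v => ?_
      rcases Int.units_eq_one_or (Equiv.Perm.sign s) with h | h <;> simp [h]

/-- The conjugate form. -/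
def conjForm {k : ℕ} (α : V [⋀^Fin k]→L[ℝ] ℂ) : V [⋀^Fin k]→L[ℝ] ℂ :=
  (Complex.conjCLE : ℂ →L[ℝ] ℂ).compContinuousAlternatingMap α

/-- The `1`-form given by a real-linear functional. -/
def oneForm (χ : V →L[ℝ] ℂ) : V [⋀^Fin 1]→L[ℝ] ℂ :=
  ContinuousAlternatingMap.ofSubsingleton ℝ V ℂ (0 : Fin 1) χ

/-- The simple form `χ₁ ∧ ⋯ ∧ χₖ`. -/
def simpleForm : {k : ℕ} → (Fin k → (V →L[ℝ] ℂ)) → V [⋀^Fin k]→L[ℝ] ℂ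
  | 0, _ => ContinuousAlternatingMap.constOfIsEmpty ℝ V (Fin 0) (1 : ℂ)
  | _ + 1, χ => wedge (simpleForm (Fin.init χ)) (oneForm (χ (Fin.last _)))

/-- The constant `σₚ = i^(p²) 2^(-p)`. -/
def sigmaConst (p : ℕ) : ℂ := Complex.I ^ (p ^ 2) / 2 ^ p

variable [IsTopologicalAddGroup V] [ContinuousSMul ℂ V]

/-- The form `σₖ χ_I ∧ conj χ_I`, where `χ_I = χ₁ ∧ ⋯ ∧ χₖ` for complex linear functionals `χⱼ`,
i.e. for covectors of type `(1,0)`. -/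
def simplePositive {k : ℕ} (χ : Fin k → (V →L[ℂ] ℂ)) : V [⋀^Fin (k + k)]→L[ℝ] ℂ :=
  sigmaConst k • wedge (simpleForm fun i => (χ i).restrictScalars ℝ)
    (conjForm (simpleForm fun i => (χ i).restrictScalars ℝ))

/-- A form `τ` of top degree on `V`, `dim V = n`, is strictly positive if `τ = c dv` with `c > 0`,
where `dv = σₙ χ₁ ∧ ⋯ ∧ χₙ ∧ conj (χ₁ ∧ ⋯ ∧ χₙ)` for a basis `χ` of the space of `(1,0)`-covectors.
(The casts only identify the degree `m` of `τ` with `n + n`.) -/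
def IsStrictlyPositiveTop {m : ℕ} (τ : V [⋀^Fin m]→L[ℝ] ℂ) : Prop :=
  ∃ h : Module.finrank ℂ V + Module.finrank ℂ V = m,
    ∃ χ : Fin (Module.finrank ℂ V) → (V →L[ℂ] ℂ), LinearIndependent ℂ χ ∧
      ∃ c : ℝ, 0 < c ∧ ∀ v : Fin m → V, τ v = (c : ℂ) * simplePositive χ (fun i => v (Fin.cast h i))

/-- `α` has type `(p,q)`: it is homogeneous of bidegree `(p,q)` under complex scalars. For a form of
degree `p + q` this says exactly that `α` is a combination of the forms
`dz_I ∧ conj dz_J`, `|I| = p`, `|J| = q`. -/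
def HasType {k : ℕ} (p q : ℕ) (α : V [⋀^Fin k]→L[ℝ] ℂ) : Prop :=
  ∀ (c : ℂ) (v : Fin k → V), α (fun i => c • v i) = c ^ p * (starRingEnd ℂ c) ^ q * α v

/-- `α` is a real form. -/
def IsRealForm {k : ℕ} (α : V [⋀^Fin k]→L[ℝ] ℂ) : Prop := conjForm α = α

/-- Transverse (strictly weakly positive) real `(p,p)`-forms: `α ∧ σₖ χ_I ∧ conj χ_I` is a strictly
positive form of top degree, for all linearly independent `(1,0)`-covectors `χ₁, …, χₖ`, `k = n - p`. -/
def IsTransverseAt (p : ℕ) (α : V [⋀^Fin (p + p)]→L[ℝ] ℂ) : Prop :=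
  HasType p p α ∧ IsRealForm α ∧
    ∀ k : ℕ, p + k = Module.finrank ℂ V →
      ∀ χ : Fin k → (V →L[ℂ] ℂ), LinearIndependent ℂ χ →
        IsStrictlyPositiveTop (wedge α (simplePositive χ))

end LinearAlgebra

/-! ### The operators `d`, `∂`, `∂̄` in a complex vector space -/

section Flat

variable {E : Type*} [NormedAddCommGroup E] [NormedSpace ℂ E]

/-- Multiplication by `i`, as a real linear map. -/
def mulI (E : Type*) [NormedAddCommGroup E] [NormedSpace ℂ E] : E →L[ℝ] E :=
  (Complex.I • ContinuousLinearMap.id ℂ E).restrictScalars ℝ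

/-- `∂` in coordinates, `∂α = ∑ⱼ dzⱼ ∧ ∂α/∂zⱼ`: the exterior derivative in which the differential of
the coefficients is replaced by its complex linear part. -/
def flatDel {k : ℕ} (α : E → E [⋀^Fin k]→L[ℝ] ℂ) (y : E) : E [⋀^Fin (k + 1)]→L[ℝ] ℂ :=
  .alternatizeUncurryFin
    ((1 / 2 : ℂ) • (fderiv ℝ α y - Complex.I • (fderiv ℝ α y).comp (mulI E)))

/-- `∂̄` in coordinates, `∂̄α = ∑ⱼ dz̄ⱼ ∧ ∂α/∂z̄ⱼ`: the exterior derivative in which the differential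
of the coefficients is replaced by its complex antilinear part. -/
def flatDelbar {k : ℕ} (α : E → E [⋀^Fin k]→L[ℝ] ℂ) (y : E) : E [⋀^Fin (k + 1)]→L[ℝ] ℂ :=
  .alternatizeUncurryFin
    ((1 / 2 : ℂ) • (fderiv ℝ α y + Complex.I • (fderiv ℝ α y).comp (mulI E)))

end Flat

/-! ### Differential forms on complex manifolds -/

section Manifold

variable (E : Type*) [NormedAddCommGroup E] [NormedSpace ℂ E]

/-- Complex valued differential `k`-forms (not necessarily smooth) on a complex manifold `M`
modelled on `E`. -/
abbrev Form (M : Type*) [TopologicalSpace M] [ChartedSpace E M] (k : ℕ) : Type _ :=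
  ∀ x : M, (TangentSpace 𝓘(ℂ, E) x) [⋀^Fin k]→L[ℝ] ℂ

variable {E} {M : Type*} [TopologicalSpace M] [ChartedSpace E M]
variable {N : Type*} [TopologicalSpace N] [ChartedSpace E N]

/-- Pull-back of forms under a holomorphic map. -/
def formPullback {k : ℕ} (f : M → N) (α : Form E N k) : Form E M k := fun x =>
  (α (f x)).compContinuousLinearMap ((mfderiv 𝓘(ℂ, E) 𝓘(ℂ, E) f x).restrictScalars ℝ)

/-- The expression of a form in the chart at `x₀`. -/
def inChart {k : ℕ} (x₀ : M) (α : Form E M k) (y : E) : E [⋀^Fin k]→L[ℝ] ℂ :=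
  (α ((chartAt E x₀).symm y)).compContinuousLinearMap
    ((mfderiv 𝓘(ℂ, E) 𝓘(ℂ, E) (chartAt E x₀).symm y).restrictScalars ℝ)

/-- Transport of an exterior form from the model space to the tangent space at `x`,
through the chart at `x`. -/
def fromChart {k : ℕ} (x : M) (β : E [⋀^Fin k]→L[ℝ] ℂ) :
    (TangentSpace 𝓘(ℂ, E) x) [⋀^Fin k]→L[ℝ] ℂ :=
  ContinuousAlternatingMap.compContinuousLinearMap β
    ((mfderiv 𝓘(ℂ, E) 𝓘(ℂ, E) (chartAt E x) x).restrictScalars ℝ)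

/-- Smooth (`C^∞`) forms. -/
def IsSmoothForm {k : ℕ} (α : Form E M k) : Prop :=
  ∀ x₀ : M, ContDiffOn ℝ ∞ (inChart x₀ α) (chartAt E x₀).target

/-- The exterior derivative. -/
def extD {k : ℕ} (α : Form E M k) : Form E M (k + 1) := fun x =>
  fromChart x (extDeriv (inChart x α) (chartAt E x x))

/-- The operator `∂`. -/
def del {k : ℕ} (α : Form E M k) : Form E M (k + 1) := fun x =>
  fromChart x (flatDel (inChart x α) (chartAt E x x))

/-- The operator `∂̄`. -/
def delbar {k : ℕ} (α : Form E M k) : Form E M (k + 1) := fun x =>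
  fromChart x (flatDelbar (inChart x α) (chartAt E x x))

/-- Wedge product of differential forms. -/
def Form.wedge {k l : ℕ} (α : Form E M k) (β : Form E M l) : Form E M (k + l) := fun x =>
  _root_.wedge (α x) (β x)

/-- The conjugate of a differential form. -/
def Form.conj {k : ℕ} (α : Form E M k) : Form E M k := fun x => conjForm (α x)

/-- `Ω` is a smooth transverse real `(p,p)`-form. -/
def IsTransverseForm (p : ℕ) (Ω : Form E M (p + p)) : Prop :=
  IsSmoothForm Ω ∧ ∀ x, IsTransverseAt p (Ω x)

/-- `Ω` is a `p`-pluriclosed form: transverse with `∂∂̄Ω = 0`. -/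
def IsPluriclosedForm (p : ℕ) (Ω : Form E M (p + p)) : Prop :=
  IsTransverseForm p Ω ∧ del (delbar Ω) = 0

variable (E) (M) [IsManifold 𝓘(ℂ, E) ω M]

/-- `p`-Kähler (pK) complex manifolds, `1 ≤ p ≤ dim M - 1`. -/
def IsPK (p : ℕ) : Prop :=
  ∃ Ω : Form E M (p + p), IsTransverseForm p Ω ∧ extD Ω = 0

/-- Weakly `p`-Kähler (pWK) complex manifolds: there is a transverse `(p,p)`-form `Ω` with
`∂Ω = ∂∂̄α` for some (smooth) form `α`; the cast identifies the degrees of both sides. -/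
def IsPWK (p : ℕ) : Prop :=
  ∃ Ω : Form E M (p + p), IsTransverseForm p Ω ∧
    ∃ (j : ℕ) (h : p + p + 1 = j + 1 + 1) (α : Form E M j), IsSmoothForm α ∧
      ∀ (x : M) (v : Fin (j + 1 + 1) → TangentSpace 𝓘(ℂ, E) x),
        del Ω x (fun i => v (Fin.cast h i)) = del (delbar α) x v

/-- `p`-symplectic (pS) complex manifolds: there is a closed real `2p`-form `Ψ` whose
`(p,p)`-component is transverse; `c a` is the component of `Ψ` of type `(a, 2p - a)`. -/
def IsPS (p : ℕ) : Prop :=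
  ∃ Ψ : Form E M (p + p), IsSmoothForm Ψ ∧ (∀ x, IsRealForm (Ψ x)) ∧ extD Ψ = 0 ∧
    ∃ c : ℕ → Form E M (p + p),
      (∀ a ≤ p + p, ∀ x, HasType a (p + p - a) (c a x)) ∧
      Ψ = ∑ a ∈ Finset.range (p + p + 1), c a ∧
      ∀ x, IsTransverseAt p (c p x)

/-- `p`-pluriclosed (pPL) complex manifolds; for `p = 1` these are the SKT manifolds. -/
def IsPPL (p : ℕ) : Prop :=
  ∃ Ω : Form E M (p + p), IsPluriclosedForm p Ω

end Manifold

/-! ### The nilpotent group and its quotients -/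

/-- The underlying complex manifold `ℂ⁴` of the nilpotent group. -/
def NilG : Type := Fin 4 → ℂ

namespace NilG

instance : TopologicalSpace NilG := inferInstanceAs (TopologicalSpace (Fin 4 → ℂ))

instance : T2Space NilG := inferInstanceAs (T2Space (Fin 4 → ℂ))

instance : ChartedSpace (Fin 4 → ℂ) NilG := inferInstanceAs (ChartedSpace (Fin 4 → ℂ) (Fin 4 → ℂ))

instance : IsManifold 𝓘(ℂ, Fin 4 → ℂ) ω NilG :=
  inferInstanceAs (IsManifold 𝓘(ℂ, Fin 4 → ℂ) ω (Fin 4 → ℂ))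

/-- The group law; all right translations `z ↦ z * a` are holomorphic. -/
def mulFun (z a : Fin 4 → ℂ) : Fin 4 → ℂ :=
  ![z 0 + a 0, z 1 + a 1,
    z 2 + a 2 - a 0 * z 1 + starRingEnd ℂ (a 0) * z 0 + starRingEnd ℂ (a 1) * z 1,
    z 3 + a 3 - a 0 * z 1]

/-- The inverse for the group law. -/
def invFun (a : Fin 4 → ℂ) : Fin 4 → ℂ :=
  ![-a 0, -a 1,
    -a 2 - a 0 * a 1 + starRingEnd ℂ (a 0) * a 0 + starRingEnd ℂ (a 1) * a 1,
    -a 3 - a 0 * a 1]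

instance : Mul NilG := ⟨mulFun⟩

instance : One NilG := ⟨(0 : Fin 4 → ℂ)⟩

instance : Inv NilG := ⟨invFun⟩

instance : Group NilG :=
  Group.ofLeftAxioms
    (by
      intro x y z
      change mulFun (mulFun x y) z = mulFun x (mulFun y z)
      funext i; fin_cases i <;> simp [mulFun] <;> ring)
    (by
      intro x
      change mulFun 0 x = x
      funext i; fin_cases i <;> simp [mulFun])
    (by
      intro x
      change mulFun (invFun x) x = 0
      funext i; fin_cases i <;> simp [mulFun, invFun] <;> ring)

theorem mul_def (z a : NilG) : z * a = mulFun z a := rfl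

instance : IsTopologicalGroup NilG where
  continuous_mul := by
    change Continuous fun p : (Fin 4 → ℂ) × (Fin 4 → ℂ) => mulFun p.1 p.2
    refine continuous_pi fun i => ?_
    fin_cases i <;> simp [mulFun] <;> fun_prop
  continuous_inv := by
    change Continuous fun p : Fin 4 → ℂ => invFun p
    refine continuous_pi fun i => ?_
    fin_cases i <;> simp [invFun] <;> fun_prop

/-- The `(1,0)`-covectors at `z` of the invariant coframe
`φ₁ = dz₁`, `φ₂ = dz₂`, `φ₃ = dz₃ + z₁ dz₂ - z̄₁ dz₁ - z̄₂ dz₂`, `φ₄ = dz₄ + z₁ dz₂`. -/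
def coframeAt (z : Fin 4 → ℂ) : Fin 4 → ((Fin 4 → ℂ) →L[ℂ] ℂ) :=
  let π : Fin 4 → ((Fin 4 → ℂ) →L[ℂ] ℂ) := fun j => ContinuousLinearMap.proj j
  ![π 0, π 1,
    π 2 + z 0 • π 1 - starRingEnd ℂ (z 0) • π 0 - starRingEnd ℂ (z 1) • π 1,
    π 3 + z 0 • π 1]

/-- The invariant coframe `φ₁, …, φ₄` on the group (indexed by `0, …, 3`). -/
def coframe (j : Fin 4) : Form (Fin 4 → ℂ) NilG 1 := fun z =>
  oneForm (V := TangentSpace 𝓘(ℂ, Fin 4 → ℂ) z) ((coframeAt z j).restrictScalars ℝ)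

variable (Γ : Subgroup NilG)

/-- A lattice in the nilpotent group: a discrete cocompact subgroup. -/
class IsLattice : Prop where
  discrete : DiscreteTopology Γ
  cocompact : CompactSpace (NilG ⧸ Γ)

variable [hΓ : IsLattice Γ]

theorem isLocalHomeomorph_mk : IsLocalHomeomorph ((↑) : NilG → NilG ⧸ Γ) := by
  have := hΓ.discrete
  exact (Subgroup.isQuotientCoveringMap Γ ⟨this⟩).isCoveringMap.isLocalHomeomorph

/-- The chart of `G ⧸ Γ` at `q`: the inverse of the restriction of the projection `G → G ⧸ Γ` to an
open set on which it is a homeomorphism onto a neighbourhood of `q`. -/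
def quotChart (q : NilG ⧸ Γ) : OpenPartialHomeomorph (NilG ⧸ Γ) (Fin 4 → ℂ) :=
  (isLocalHomeomorph_mk Γ q.out).choose.symm

theorem quotChart_symm (q : NilG ⧸ Γ) :
    ((quotChart Γ q).symm : (Fin 4 → ℂ) → NilG ⧸ Γ) = ((↑) : NilG → NilG ⧸ Γ) :=
  (isLocalHomeomorph_mk Γ q.out).choose_spec.2.symm

theorem mem_quotChart_source (q : NilG ⧸ Γ) : q ∈ (quotChart Γ q).source := by
  have h := (isLocalHomeomorph_mk Γ q.out).choose_spec
  have h2 := (isLocalHomeomorph_mk Γ q.out).choose.map_source h.1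
  rw [← h.2] at h2
  have h3 : ((q.out : NilG) : NilG ⧸ Γ) = q := QuotientGroup.out_eq' q
  rw [h3] at h2
  exact h2

/-- The quotient `G ⧸ Γ` as a complex manifold: charts are the local inverses of `G → G ⧸ Γ`. -/
instance : ChartedSpace (Fin 4 → ℂ) (NilG ⧸ Γ) where
  atlas := Set.range (quotChart Γ)
  chartAt := quotChart Γ
  mem_chart_source := mem_quotChart_source Γ
  chart_mem_atlas := Set.mem_range_self

theorem contDiff_mul_right (a : NilG) {n : WithTop ℕ∞} :
    ContDiff ℂ n fun z : Fin 4 → ℂ => mulFun z a := by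
  refine contDiff_pi.2 fun i => ?_
  fin_cases i <;> simp [mulFun] <;> fun_prop

instance : IsManifold 𝓘(ℂ, Fin 4 → ℂ) ω (NilG ⧸ Γ) := by
  refine isManifold_of_contDiffOn _ _ _ ?_
  rintro _ _ ⟨p, rfl⟩ ⟨q, rfl⟩
  simp only [modelWithCornersSelf_coe, modelWithCornersSelf_coe_symm, Function.id_comp,
    Function.comp_id, Set.preimage_id, Set.range_id, Set.inter_univ]
  intro z hz
  refine ContDiffAt.contDiffWithinAt ?_
  rw [OpenPartialHomeomorph.trans_source] at hz
  obtain ⟨-, hz2⟩ := hz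
  change (quotChart Γ p).symm z ∈ (quotChart Γ q).source at hz2
  set w : NilG := quotChart Γ q ((quotChart Γ p).symm z) with hw
  have hwt : w ∈ (quotChart Γ q).target := (quotChart Γ q).map_source hz2
  -- near `z` the transition map is the right translation by `z⁻¹ * w`
  set γ : NilG := (show NilG from z)⁻¹ * w with hγ
  have hzw : (show NilG from z) * γ = w :=
    mul_inv_cancel_left (G := NilG) z w
  have hγΓ : γ ∈ Γ := by
    rw [hγ]
    refine QuotientGroup.eq.1 ?_
    have h1 := (quotChart Γ q).left_inv hz2
    rw [quotChart_symm, quotChart_symm] at h1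
    have h2 : w = quotChart Γ q ((show NilG from z : NilG) : NilG ⧸ Γ) := by
      rw [hw, quotChart_symm]
    rw [h2]
    exact h1.symm
  have hcont : ContinuousAt (fun y : Fin 4 → ℂ => mulFun y γ) z :=
    (contDiff_mul_right γ (n := 0)).continuous.continuousAt
  have hev : ∀ᶠ y in nhds z, mulFun y γ ∈ (quotChart Γ q).target :=
    hcont.eventually_mem ((quotChart Γ q).open_target.mem_nhds (by
      change mulFun z γ = w at hzw
      rw [hzw]; exact hwt))
  refine (contDiff_mul_right γ).contDiffAt.congr_of_eventuallyEq ?_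
  filter_upwards [hev] with y hy
  have h3 := (quotChart Γ q).right_inv hy
  rw [quotChart_symm] at h3
  change quotChart Γ q ((quotChart Γ p).symm y) = mulFun y γ
  rw [quotChart_symm, ← h3]
  congr 1
  refine QuotientGroup.eq.2 ?_
  change (show NilG from y)⁻¹ * ((show NilG from y) * γ) ∈ Γ
  rw [inv_mul_cancel_left (G := NilG) y γ]
  exact hγΓ

end NilG

/-!
The group is a central extension of `ℂ²` by `ℂ²`, hence nilpotent, and its points with Gaussian
integer coordinates form a lattice. For a lattice `Γ`, the existence results come from right
invariant forms, for which `∂` and `∂̄` are algebraic. The nonexistence results come from Stokes'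
theorem: a transverse form is positive on complex planes, and some sums of complex planes spanned
by right invariant fields are boundaries.

**Reduction to periodic forms on `ℂ⁴`.** The inverse of every chart of `G ⧸ Γ` is the projection
`G → G ⧸ Γ`, so the expression of a form `α` in any chart is its pull-back `lift Γ α` to `ℂ⁴`.
Pull-back is a bijection onto the forms on `ℂ⁴` invariant under right translations by `Γ`
(`lift_descend`, `descend_lift`); it respects smoothness and transversality, and it intertwines
`d`, `∂`, `∂̄` with the flat operators, since right translations are holomorphic. The three
operators are treated at once as `twD a b`, in which the coefficients are differentiated in the
direction `v` by `a ∂ᵥ + b ∂ᵢᵥ`. In the frame of right invariant vector fields, `twD a b β` is a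
sum of derivatives of the coefficients along the frame and of an algebraic term
`structureTerm a b β` (`twD_frame`). On right invariant forms only the algebraic term is left,
which gives the structure equations, the SKT form, and, with the fact that invariant forms of
codegree one are closed under all these operators, the `3`-pluriclosed form
`∑ⱼ σ₃ φ_J ∧ conj φ_J`, where `J` is the complement of `j`.

**Stokes' theorem.** Let `f` be a sum of derivatives of smooth `Γ`-periodic functions along right
invariant vector fields. The averages of `f ∘ δ_R` against a fixed cut-off function, for the
dilation automorphisms `δ_R` of `G`, tend to zero as `R → ∞`: integrate by parts, and use that the
dilations rescale the frame while periodic functions are bounded. Hence `f` is not positive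
everywhere (`not_forall_pos_of_mem_divSpace`).

**Transversality.** A real `(p,p)`-form `Ω` is transverse if and only if, up to a constant
depending on `p`, its value on `v₁, …, vₚ, i v₁, …, i vₚ` is positive for all linearly independent
`v₁, …, vₚ` (`IsTransverseAt.pos_planeTuple`, `isTransverseAt_of_pos`); forms of type `(a, b)`
with `a ≠ b` vanish on such tuples (`HasType.planeTuple_eq_zero`).

**Obstructions.** Modulo divergences, `twD a b β` evaluated on a constant polyvector is the
algebraic term, that is, `β` on the boundary of this polyvector. For `p = 1, 2, 3` there is a
polyvector `ξ` whose boundary is a sum of complex planes, and on this sum every `twD a b α` is a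
divergence (`HasObstruction`). Applied to `d` it excludes `p`-symplectic and `p`-Kähler forms,
applied to `∂Ω - ∂∂̄α` it excludes weakly `p`-Kähler forms. Similarly, if `W` is the complex line
spanned by `e₃ + e₄`, then `∂∂̄Ω` evaluated on `W` and the lines of `e₁`, `e₂` is, modulo
divergences, a nonzero multiple of `Ω` on the plane spanned by `e₃` and `W`
(`twD_twD_mem_divSpace`), which excludes `2`-pluriclosed forms.

In comments the coordinates and the coframe are numbered from `1` to `4`, in the code from `0` to
`3`; thus the basis vectors `e 0, …, e 3` are `e₁, …, e₄`.
-/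

/-! ### Wedge products as determinants -/

section WedgeAlgebra

variable {V : Type*} [AddCommGroup V] [Module ℂ V] [TopologicalSpace V]

theorem wedge_apply {k l : ℕ} (α : V [⋀^Fin k]→L[ℝ] ℂ) (β : V [⋀^Fin l]→L[ℝ] ℂ)
    (v : Fin (k + l) → V) :
    wedge α β v = LinearMap.mul' ℝ ℂ
      (α.toAlternatingMap.domCoprod β.toAlternatingMap (v ∘ finSumFinEquiv)) := rfl

/-- If `β` vanishes as soon as one of its arguments is among the `a j`, only the identity shuffle
contributes to the wedge product. -/
theorem wedge_append_of_vanish {k l : ℕ} (α : V [⋀^Fin k]→L[ℝ] ℂ) (β : V [⋀^Fin l]→L[ℝ] ℂ)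
    (a : Fin k → V) (b : Fin l → V)
    (h : ∀ (w : Fin l → V) (i : Fin l) (j : Fin k), w i = a j → β w = 0) :
    wedge α β (Fin.append a b) = α a * β b := by
  rw [wedge_apply]
  have hv : Fin.append a b ∘ finSumFinEquiv = Sum.elim a b := by
    funext x; rcases x with x | x <;> simp
  rw [hv, AlternatingMap.domCoprod_apply, sum_apply, map_sum]
  refine (Finset.sum_eq_single (Quotient.mk'' (1 : Equiv.Perm (Fin k ⊕ Fin l))) ?_ ?_).trans ?_
  rotate_left 2
  · rw [AlternatingMap.domCoprod.summand_mk'']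
    simp [MultilinearMap.domCoprod_apply]
  · intro s _ hs
    induction s using Quotient.inductionOn' with
    | h s =>
      have : ∃ i j, s (Sum.inr i) = Sum.inl j := by
        by_contra! hcon
        refine hs (Quotient.sound' ?_)
        rw [QuotientGroup.leftRel_apply, mul_one]
        refine inv_mem (Equiv.Perm.mem_sumCongrHom_range_of_perm_mapsTo_inl
          ((Equiv.Perm.perm_mapsTo_inl_iff_mapsTo_inr s).2 ?_))
        rintro _ ⟨i, rfl⟩
        rcases h' : s (Sum.inr i) with j | j
        · exact absurd h' (hcon i j)
        · exact ⟨j, rfl⟩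
      obtain ⟨i, j, hij⟩ := this
      rw [AlternatingMap.domCoprod.summand_mk'']
      have h0 : β.toAlternatingMap (fun i => Sum.elim a b (s (Sum.inr i))) = 0 :=
        h _ i j (by rw [hij]; rfl)
      have h1 : (α.toAlternatingMap.toMultilinearMap.domCoprod β.toAlternatingMap.toMultilinearMap)
          (fun i => Sum.elim a b (s i)) = 0 := by
        rw [MultilinearMap.domCoprod_apply]
        exact (congrArg _ h0).trans (TensorProduct.tmul_zero _ _)
      rw [smul_apply, MultilinearMap.domDomCongr_apply, h1, smul_zero, map_zero]
  · intro h; exact absurd (Finset.mem_univ _) h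

/-- The product `v ↦ ∏ᵢ χᵢ(vᵢ)` of functionals. -/
def prodFunctional {ι : Type*} [Fintype ι] (χ : ι → (V →L[ℝ] ℂ)) :
    MultilinearMap ℝ (fun _ : ι => V) ℂ :=
  (MultilinearMap.mkPiAlgebra ℝ ι ℂ).compLinearMap fun i => (χ i : V →ₗ[ℝ] ℂ)

theorem alternatization_prodFunctional {ι : Type*} [Fintype ι] [DecidableEq ι]
    (χ : ι → (V →L[ℝ] ℂ)) (v : ι → V) :
    MultilinearMap.alternatization (prodFunctional χ) v
      = (Matrix.of fun i j => χ i (v j)).det := by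
  rw [MultilinearMap.alternatization_apply, ← Matrix.det_transpose, Matrix.det_apply]
  rfl

/-- The wedge product of two determinants of functionals is the determinant of all of them
(the Laplace expansion along the first rows). -/
theorem wedge_det {k l : ℕ} {α : V [⋀^Fin k]→L[ℝ] ℂ} {β : V [⋀^Fin l]→L[ℝ] ℂ}
    {χ : Fin k → (V →L[ℝ] ℂ)} {ψ : Fin l → (V →L[ℝ] ℂ)}
    (hα : ∀ v, α v = (Matrix.of fun i j => χ i (v j)).det)
    (hβ : ∀ v, β v = (Matrix.of fun i j => ψ i (v j)).det) (v : Fin (k + l) → V) :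
    wedge α β v =
      (Matrix.of fun i j : Fin k ⊕ Fin l => Sum.elim χ ψ i (v (finSumFinEquiv j))).det := by
  have ha : α.toAlternatingMap = MultilinearMap.alternatization (prodFunctional χ) := by
    ext v; rw [alternatization_prodFunctional]; exact hα v
  have hb : β.toAlternatingMap = MultilinearMap.alternatization (prodFunctional ψ) := by
    ext v; rw [alternatization_prodFunctional]; exact hβ v
  rw [wedge_apply, ha, hb, ← MultilinearMap.domCoprod_alternization,
    ← LinearMap.compAlternatingMap_apply, ← LinearMap.compMultilinearMap_alternatization]
  have : (LinearMap.mul' ℝ ℂ).compMultilinearMap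
      ((prodFunctional χ).domCoprod (prodFunctional ψ)) = prodFunctional (Sum.elim χ ψ) := by
    ext w
    simp [prodFunctional, MultilinearMap.domCoprod_apply]
  rw [this, alternatization_prodFunctional]
  rfl

theorem simpleForm_apply {k : ℕ} (χ : Fin k → (V →L[ℝ] ℂ)) (v : Fin k → V) :
    simpleForm χ v = (Matrix.of fun i j => χ i (v j)).det := by
  induction k with
  | zero => simp [simpleForm]
  | succ k ih =>
    have h1 : ∀ w : Fin 1 → V, oneForm (χ (Fin.last k)) w
        = (Matrix.of fun i j => (fun _ : Fin 1 => χ (Fin.last k)) i (w j)).det := by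
      intro w; simp [oneForm]
    rw [simpleForm, wedge_det (ih _) h1, ← Matrix.det_reindex_self finSumFinEquiv]
    congr 1
    ext i j
    simp only [Matrix.reindex_apply, Matrix.submatrix_apply, Matrix.of_apply,
      Equiv.apply_symm_apply]
    congr 1
    refine Fin.lastCases ?_ (fun i => ?_) i
    · have : finSumFinEquiv.symm (Fin.last k) = (Sum.inr 0 : Fin k ⊕ Fin 1) := by
        rw [Equiv.symm_apply_eq]; rfl
      rw [this]; rfl
    · have : finSumFinEquiv.symm (Fin.castSucc i) = (Sum.inl i : Fin k ⊕ Fin 1) := by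
        rw [Equiv.symm_apply_eq]; rfl
      rw [this]; rfl

theorem conjForm_apply {k : ℕ} (α : V [⋀^Fin k]→L[ℝ] ℂ) (v : Fin k → V) :
    conjForm α v = starRingEnd ℂ (α v) := rfl

theorem wedge_oneForm_oneForm_apply (χ ψ : V →L[ℝ] ℂ) (v : Fin 2 → V) :
    wedge (oneForm χ) (oneForm ψ) v = χ (v 0) * ψ (v 1) - χ (v 1) * ψ (v 0) := by
  have h1 : ∀ (χ : V →L[ℝ] ℂ) (w : Fin 1 → V), oneForm χ w
        = (Matrix.of fun i j => (fun _ : Fin 1 => χ) i (w j)).det := by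
      intro χ w; simp [oneForm]
  have := wedge_det (h1 χ) (h1 ψ) v
  rw [this, ← Matrix.det_reindex_self finSumFinEquiv, Matrix.det_fin_two]
  rfl

theorem simplePositive_apply {k : ℕ} (χ : Fin k → (V →L[ℂ] ℂ)) (v : Fin (k + k) → V) :
    simplePositive χ v = sigmaConst k *
      (Matrix.of fun i j : Fin k ⊕ Fin k =>
        Sum.elim (fun i => χ i (v (finSumFinEquiv j)))
          (fun i => starRingEnd ℂ (χ i (v (finSumFinEquiv j)))) i).det := by
  have h1 := simpleForm_apply (fun i => (χ i).restrictScalars ℝ)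
  have h2 : ∀ v, conjForm (simpleForm fun i => (χ i).restrictScalars ℝ) v
      = (Matrix.of fun i j => ((Complex.conjCLE : ℂ →L[ℝ] ℂ).comp
          ((χ i).restrictScalars ℝ)) (v j)).det := by
    intro v
    rw [conjForm_apply, h1, RingHom.map_det]
    rfl
  change sigmaConst k * wedge _ _ v = _
  rw [wedge_det h1 h2]
  congr 2
  ext i j
  rcases i with i | i <;> rfl

end WedgeAlgebra

/-! ### Transversality in terms of complex planes -/

section Transverse

open Module

/-- A linearly independent family can be completed to a basis indexed by a sum. -/
theorem exists_basis_sum_inr {W : Type*} [AddCommGroup W] [Module ℂ W] [FiniteDimensional ℂ W]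
    {p k : ℕ} (hW : finrank ℂ W = p + k) {v : Fin k → W} (hv : LinearIndependent ℂ v) :
    ∃ b : Basis (Fin p ⊕ Fin k) ℂ W, ∀ i, b (Sum.inr i) = v i := by
  obtain ⟨q, hq⟩ := (Submodule.span ℂ (Set.range v)).exists_isCompl
  have h1 : finrank ℂ (Submodule.span ℂ (Set.range v)) = k := by
    simpa using finrank_span_eq_card hv
  have h2 : finrank ℂ q = p := by
    have := Submodule.finrank_add_eq_of_isCompl hq
    omega
  let bq := finBasisOfFinrankEq ℂ q h2
  have hu : LinearIndependent ℂ fun i => (bq i : W) :=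
    bq.linearIndependent.map' q.subtype q.ker_subtype
  have hspan : Submodule.span ℂ (Set.range fun i => (bq i : W)) ≤ q := by
    rw [Submodule.span_le]; rintro _ ⟨i, rfl⟩; exact (bq i).2
  have hli := LinearIndependent.sum_type hu hv (hq.symm.disjoint.mono_left hspan)
  let b := basisOfLinearIndependentOfCardEqFinrank' _ hli (by simp [hW])
  exact ⟨b, fun i => by simp [b]⟩

theorem exists_basis_sum_inl {W : Type*} [AddCommGroup W] [Module ℂ W] [FiniteDimensional ℂ W]
    {p k : ℕ} (hW : finrank ℂ W = p + k) {v : Fin p → W} (hv : LinearIndependent ℂ v) :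
    ∃ b : Basis (Fin p ⊕ Fin k) ℂ W, ∀ i, b (Sum.inl i) = v i := by
  obtain ⟨b, hb⟩ := exists_basis_sum_inr (hW.trans (add_comm p k)) hv
  exact ⟨b.reindex (Equiv.sumComm _ _), fun i => by simp [hb]⟩

/-- The real tuple `(v₁, …, vₖ, i v₁, …, i vₖ)` attached to complex vectors `v₁, …, vₖ`; it spans
the complex subspace generated by the `vⱼ`. -/
def planeTuple {V : Type*} [AddCommGroup V] [Module ℂ V] {k : ℕ} (v : Fin k → V) :
    Fin (k + k) → V :=
  Fin.append v fun i => Complex.I • v i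

@[simp]
theorem planeTuple_castAdd {V : Type*} [AddCommGroup V] [Module ℂ V] {k : ℕ} (v : Fin k → V)
    (i : Fin k) : planeTuple v (Fin.castAdd k i) = v i := by
  simp [planeTuple]

@[simp]
theorem planeTuple_natAdd {V : Type*} [AddCommGroup V] [Module ℂ V] {k : ℕ} (v : Fin k → V)
    (i : Fin k) : planeTuple v (Fin.natAdd k i) = Complex.I • v i :=
  Fin.append_right _ _ i

variable {V : Type*} [NormedAddCommGroup V] [NormedSpace ℂ V]

/-- The normalization `σₖ (-2i)ᵏ` is the value of `σₖ χ_I ∧ conj χ_I` on the plane tuple of vectors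
dual to `χ`. -/
def planeConst (k : ℕ) : ℂ := sigmaConst k * (-2 * Complex.I) ^ k

theorem planeConst_ne_zero (k : ℕ) : planeConst k ≠ 0 := by
  simp [planeConst, sigmaConst]

theorem simplePositive_planeTuple {k : ℕ} (χ : Fin k → (V →L[ℂ] ℂ)) (v : Fin k → V) :
    simplePositive χ (planeTuple v) =
      planeConst k * (Complex.normSq (Matrix.of fun i j => χ i (v j)).det : ℂ) := by
  rw [simplePositive_apply]
  set B : Matrix (Fin k) (Fin k) ℂ := Matrix.of fun i j => χ i (v j) with hB
  have h1 : (Matrix.of fun i j : Fin k ⊕ Fin k =>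
        Sum.elim (fun i => χ i (planeTuple v (finSumFinEquiv j)))
          (fun i => starRingEnd ℂ (χ i (planeTuple v (finSumFinEquiv j)))) i)
      = Matrix.fromBlocks B 0 0 (B.map (starRingEnd ℂ)) *
        Matrix.fromBlocks 1 (Complex.I • 1) 1 (-Complex.I • 1) := by
    rw [Matrix.fromBlocks_multiply]
    ext i j
    rcases i with i | i <;> rcases j with j | j <;>
      simp [-Fin.natAdd_eq_addNat, hB]
  rw [h1, Matrix.det_mul, Matrix.det_fromBlocks_zero₂₁, Matrix.det_fromBlocks_one₁₁, one_mul,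
    ← sub_smul, Matrix.det_smul, Matrix.det_one, ← RingHom.mapMatrix_apply, ← RingHom.map_det,
    ← Complex.mul_conj]
  simp only [planeConst, Fintype.card_fin]
  rw [show -Complex.I - Complex.I = -2 * Complex.I by ring]
  ring

/-- The permutation which turns `((v, w), (iv, iw))` into `((v, iv), (w, iw))`. -/
def blockPerm (p k : ℕ) : Equiv.Perm (Fin ((p + k) + (p + k))) :=
  (finCongr (show (p + k) + (p + k) = (p + p) + (k + k) by omega)).trans <|
    finSumFinEquiv.symm.trans <|
      (Equiv.sumCongr finSumFinEquiv.symm finSumFinEquiv.symm).trans <|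
        (Equiv.sumSumSumComm (Fin p) (Fin p) (Fin k) (Fin k)).trans <|
          (Equiv.sumCongr finSumFinEquiv finSumFinEquiv).trans finSumFinEquiv

theorem planeTuple_append_comp_blockPerm {p k : ℕ} (v : Fin p → V) (w : Fin k → V)
    (h : (p + k) + (p + k) = (p + p) + (k + k)) :
    (fun i => Fin.append (planeTuple v) (planeTuple w) (Fin.cast h i)) =
      planeTuple (Fin.append v w) ∘ blockPerm p k := by
  funext i
  obtain ⟨j, rfl⟩ := (finCongr h).symm.surjective i
  simp only [Function.comp_apply, blockPerm, Equiv.trans_apply, Equiv.apply_symm_apply]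
  change Fin.append (planeTuple v) (planeTuple w) j = _
  refine Fin.addCases (fun j => ?_) (fun j => ?_) j <;>
  refine Fin.addCases (fun j => ?_) (fun j => ?_) j <;>
  simp [-Fin.natAdd_eq_addNat, finSumFinEquiv_symm_apply_natAdd]

/-- The constant relating the positivity of `Ω` on plane tuples of `p` vectors to that of
`Ω ∧ σₖ χ ∧ conj χ`. -/
def transverseConst (p k : ℕ) : ℂ :=
  (Equiv.Perm.sign (blockPerm p k) : ℤ) * planeConst (p + k) / planeConst k

theorem transverseConst_ne_zero (p k : ℕ) : transverseConst p k ≠ 0 := by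
  simp [transverseConst, planeConst_ne_zero]

theorem simplePositive_cast {n m : ℕ} (h : n = m) (χ : Fin m → (V →L[ℂ] ℂ))
    (u : Fin (m + m) → V) :
    simplePositive χ u = simplePositive (fun i => χ (Fin.cast h i))
      (fun i => u (Fin.cast (by omega) i)) := by
  subst h; rfl

theorem simplePositive_append_planeTuple {p k : ℕ} (χ : Fin (p + k) → (V →L[ℂ] ℂ))
    (v : Fin p → V) (w : Fin k → V) (h : (p + k) + (p + k) = (p + p) + (k + k)) :
    simplePositive χ (fun i => Fin.append (planeTuple v) (planeTuple w) (Fin.cast h i)) =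
      transverseConst p k * planeConst k *
        (Complex.normSq (Matrix.of fun i j => χ i (Fin.append v w j)).det : ℂ) := by
  rw [planeTuple_append_comp_blockPerm, transverseConst, div_mul_cancel₀ _ (planeConst_ne_zero k),
    mul_assoc, ← simplePositive_planeTuple, ← zsmul_eq_mul, ← Units.smul_def]
  exact (simplePositive χ).toAlternatingMap.map_perm _ _

/-- If the `χᵢ` vanish on the `vⱼ` and are dual to the `wⱼ`, then `Ω ∧ σₖ χ ∧ conj χ` is computed by
the value of `Ω` on the plane of the `vⱼ`. -/
theorem wedge_simplePositive_append {p k : ℕ} (Ω : V [⋀^Fin (p + p)]→L[ℝ] ℂ)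
    (χ : Fin k → (V →L[ℂ] ℂ)) (v : Fin p → V) (w : Fin k → V)
    (hv : ∀ i j, χ i (v j) = 0) (hw : ∀ i j, χ i (w j) = if i = j then 1 else 0) :
    wedge Ω (simplePositive χ) (Fin.append (planeTuple v) (planeTuple w)) =
      Ω (planeTuple v) * planeConst k := by
  rw [wedge_append_of_vanish, simplePositive_planeTuple]
  · have : (Matrix.of fun i j => χ i (w j)) = 1 := by
      ext i j; simp [hw, Matrix.one_apply]
    rw [this]; simp
  · intro u i j hij
    have hz : ∀ l, χ l (u i) = 0 := by
      intro l
      rw [hij]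
      refine Fin.addCases (fun j => ?_) (fun j => ?_) j <;> simp [-Fin.natAdd_eq_addNat, hv]
    rw [simplePositive_apply, Matrix.det_eq_zero_of_column_eq_zero (finSumFinEquiv.symm i),
      mul_zero]
    rintro (l | l) <;> simp [hz]

theorem planeConst_one : planeConst 1 = 1 := by
  norm_num [planeConst, sigmaConst, div_mul_eq_mul_div, mul_comm Complex.I, mul_assoc]

theorem planeConst_three : planeConst 3 = -1 := by
  have h9 : Complex.I ^ 9 = Complex.I := by
    rw [show 9 = 4 * 2 + 1 by norm_num, pow_add, pow_mul, Complex.I_pow_four]; simp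
  have h3 : Complex.I ^ 3 = -Complex.I := Complex.I_pow_three
  norm_num [planeConst, sigmaConst, mul_pow, h9, h3]
  ring_nf
  norm_num

theorem planeConst_four : planeConst 4 = 1 := by
  have h16 : Complex.I ^ 16 = 1 := by
    rw [show 16 = 4 * 4 by norm_num, pow_mul, Complex.I_pow_four, one_pow]
  norm_num [planeConst, sigmaConst, mul_pow, h16]

theorem transverseConst_one_three : transverseConst 1 3 = 1 := by
  have : Equiv.Perm.sign (blockPerm 1 3) = -1 := by decide +kernel
  rw [transverseConst, this, planeConst_three, planeConst_four]
  norm_num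

theorem transverseConst_three_one : transverseConst 3 1 = -1 := by
  have : Equiv.Perm.sign (blockPerm 3 1) = -1 := by decide +kernel
  rw [transverseConst, this, planeConst_one, planeConst_four]
  norm_num

/-- A form of type `(a, b)` with `a ≠ b` vanishes on complex planes: the polyvector
`v₁ ∧ ⋯ ∧ vₖ ∧ iv₁ ∧ ⋯ ∧ ivₖ` is invariant under `v ↦ exp(iθ) v`, and the derivative at `θ = 0`
of the homogeneity relation gives `(a - b) α(v, iv) = 0`. -/
theorem HasType.planeTuple_eq_zero {k a b : ℕ} (hab : a ≠ b) {α : V [⋀^Fin (k + k)]→L[ℝ] ℂ}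
    (h : HasType a b α) (v : Fin k → V) : α (planeTuple v) = 0 := by
  set u := planeTuple v with hu
  let γ : ℝ → Fin (k + k) → V := fun t j => Complex.exp (t * Complex.I) • u j
  have hγ0 : γ 0 = u := by funext j; simp [γ]
  have hexp : ∀ m : ℂ, HasDerivAt (fun t : ℝ => Complex.exp (t * m)) m 0 := by
    intro m
    have h1 : HasDerivAt (fun t : ℝ => (t : ℂ) * m) m 0 := by
      simpa using (Complex.ofRealCLM.hasDerivAt (x := (0 : ℝ))).mul_const m
    simpa using h1.cexp
  have hγ : HasDerivAt γ (fun j => Complex.I • u j) 0 :=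
    hasDerivAt_pi.2 fun j => (hexp Complex.I).smul_const (u j)
  have h1 : HasDerivAt (fun t => α (γ t))
      (α.toContinuousMultilinearMap.linearDeriv (γ 0) fun j => Complex.I • u j) 0 :=
    (α.toContinuousMultilinearMap.hasFDerivAt (γ 0)).comp_hasDerivAt 0 hγ
  have hzero : α.toContinuousMultilinearMap.linearDeriv (γ 0) (fun j => Complex.I • u j) = 0 := by
    rw [ContinuousMultilinearMap.linearDeriv_apply, hγ0]
    refine Finset.sum_eq_zero fun i _ => ?_
    refine Fin.addCases (fun j => ?_) (fun j => ?_) i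
    · refine α.map_eq_zero_of_eq _ (i := Fin.castAdd k j) (j := Fin.natAdd k j) ?_ ?_
      · rw [Function.update_self, Function.update_of_ne]
        · simp [hu, -Fin.natAdd_eq_addNat]
        · have := j.2; simp [Fin.ext_iff]; omega
      · have := j.2; simp [Fin.ext_iff]; omega
    · have hne : Fin.castAdd k j ≠ Fin.natAdd k j := by have := j.2; simp [Fin.ext_iff]; omega
      have h2 : Complex.I • u (Fin.natAdd k j) = (-1 : ℝ) • v j := by
        rw [hu, planeTuple_natAdd, smul_smul, Complex.I_mul_I]; simp
      change α (Function.update u (Fin.natAdd k j) (Complex.I • u (Fin.natAdd k j))) = 0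
      rw [h2, α.map_update_smul]
      rw [α.map_eq_zero_of_eq _ (i := Fin.castAdd k j) (j := Fin.natAdd k j) _ hne, smul_zero]
      rw [Function.update_self, Function.update_of_ne hne]
      simp [hu]
  rw [hzero] at h1
  have h2 : (fun t => α (γ t))
      = fun t : ℝ => Complex.exp (t * (((a : ℂ) - b) * Complex.I)) * α u := by
    funext t
    have h3 := h (Complex.exp (t * Complex.I)) u
    refine h3.trans ?_
    rw [← Complex.exp_conj, ← Complex.exp_nat_mul, ← Complex.exp_nat_mul, ← Complex.exp_add]
    congr 2
    simp
    ring
  have h4 := (hexp (((a : ℂ) - b) * Complex.I)).mul_const (α u)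
  rw [← h2] at h4
  have h5 := h1.unique h4
  have h6 : ((a : ℂ) - b) * Complex.I ≠ 0 :=
    mul_ne_zero (sub_ne_zero.2 (by exact_mod_cast hab)) Complex.I_ne_zero
  exact (mul_eq_zero.1 h5.symm).resolve_left h6

theorem hasType_simplePositive {k : ℕ} (χ : Fin k → (V →L[ℂ] ℂ)) :
    HasType k k (simplePositive χ) := by
  intro c v
  rw [simplePositive_apply, simplePositive_apply]
  have : (Matrix.of fun i j : Fin k ⊕ Fin k =>
        Sum.elim (fun i => χ i (c • v (finSumFinEquiv j)))
          (fun i => starRingEnd ℂ (χ i (c • v (finSumFinEquiv j)))) i)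
      = Matrix.diagonal (Sum.elim (fun _ => c) (fun _ => starRingEnd ℂ c)) *
      (Matrix.of fun i j : Fin k ⊕ Fin k =>
        Sum.elim (fun i => χ i (v (finSumFinEquiv j)))
          (fun i => starRingEnd ℂ (χ i (v (finSumFinEquiv j)))) i) := by
    ext i j
    rcases i with i | i <;> simp [Matrix.diagonal_mul]
  rw [this, Matrix.det_mul, Matrix.det_diagonal]
  simp
  ring

/-- Conjugation exchanges the two blocks of rows of the determinant, an odd permutation, and
conjugates `σ₃ = i/8`. -/
theorem isRealForm_simplePositive_three (χ : Fin 3 → (V →L[ℂ] ℂ)) :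
    IsRealForm (simplePositive χ) := by
  ext v
  rw [conjForm_apply, simplePositive_apply, map_mul, RingHom.map_det]
  have h9 : Complex.I ^ 9 = Complex.I := by
    rw [show 9 = 4 * 2 + 1 by norm_num, pow_add, pow_mul, Complex.I_pow_four]; simp
  have hs : starRingEnd ℂ (sigmaConst 3) = -sigmaConst 3 := by
    norm_num [sigmaConst, h9, map_ofNat]
    ring
  have hsign : Equiv.Perm.sign (Equiv.sumComm (Fin 3) (Fin 3) : Equiv.Perm (Fin 3 ⊕ Fin 3))
      = -1 := by
    decide +kernel
  have hp := Matrix.det_permute (Equiv.sumComm (Fin 3) (Fin 3) : Equiv.Perm (Fin 3 ⊕ Fin 3))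
    (Matrix.of fun i j : Fin 3 ⊕ Fin 3 =>
        Sum.elim (fun i => χ i (v (finSumFinEquiv j)))
          (fun i => starRingEnd ℂ (χ i (v (finSumFinEquiv j)))) i)
  rw [hsign] at hp
  have hm : (starRingEnd ℂ).mapMatrix (Matrix.of fun i j : Fin 3 ⊕ Fin 3 =>
        Sum.elim (fun i => χ i (v (finSumFinEquiv j)))
          (fun i => starRingEnd ℂ (χ i (v (finSumFinEquiv j)))) i)
      = (Matrix.of fun i j : Fin 3 ⊕ Fin 3 =>
        Sum.elim (fun i => χ i (v (finSumFinEquiv j)))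
          (fun i => starRingEnd ℂ (χ i (v (finSumFinEquiv j)))) i).submatrix
          (Equiv.sumComm (Fin 3) (Fin 3)) id := by
    ext i j
    rcases i with i | i <;> simp
  rw [hm]
  refine (congrArg _ hp).trans ?_
  rw [hs]
  simp

variable [FiniteDimensional ℂ V]

/-- Transverse `(p,p)`-forms are positive, up to a normalization, on complex `p`-planes: complete
`v` to a basis and wedge with the dual functionals of the added vectors. -/
theorem IsTransverseAt.pos_planeTuple {p k : ℕ} (hV : finrank ℂ V = p + k)
    {Ω : V [⋀^Fin (p + p)]→L[ℝ] ℂ} (hΩ : IsTransverseAt p Ω) {v : Fin p → V}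
    (hv : LinearIndependent ℂ v) :
    ∃ c : ℝ, 0 < c ∧ Ω (planeTuple v) = c * transverseConst p k := by
  obtain ⟨b, hb⟩ := exists_basis_sum_inl hV hv
  let χ : Fin k → (V →L[ℂ] ℂ) := fun i => LinearMap.toContinuousLinearMap (b.coord (Sum.inr i))
  have hχ : LinearIndependent ℂ χ := by
    have h1 : LinearIndependent ℂ b.coord := by
      rw [← b.coe_dualBasis]; exact b.dualBasis.linearIndependent
    have h2 := (h1.comp Sum.inr Sum.inr_injective).map'
      (LinearMap.toContinuousLinearMap : (V →ₗ[ℂ] ℂ) ≃ₗ[ℂ] (V →L[ℂ] ℂ)).toLinearMap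
      (LinearEquiv.ker _)
    exact h2
  obtain ⟨h, χ', hχ', c, hc, hτ⟩ := hΩ.2.2 k hV.symm χ hχ
  let w : Fin k → V := fun i => b (Sum.inr i)
  have h1 := hτ (Fin.append (planeTuple v) (planeTuple w))
  rw [wedge_simplePositive_append _ _ _ _
      (fun i j => by simp [χ, ← hb])
      (fun i j => by simp [χ, w, Finsupp.single_apply, eq_comm]),
    simplePositive_cast hV.symm] at h1
  simp only [Fin.cast_cast] at h1
  rw [simplePositive_append_planeTuple] at h1
  set D := (Matrix.of fun i j => χ' (Fin.cast hV.symm i) (Fin.append v w j)).det with hD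
  have hD0 : D ≠ 0 := by
    intro h0
    obtain ⟨g, hg, hg0⟩ := Matrix.exists_vecMul_eq_zero_iff.2 (hD.symm.trans h0)
    refine hg (funext fun i => ?_)
    have hz : ∑ i, g i • χ' (Fin.cast hV.symm i) = 0 := by
      have hz' : ((∑ i, g i • χ' (Fin.cast hV.symm i) : V →L[ℂ] ℂ) : V →ₗ[ℂ] ℂ) = 0 := by
        refine b.ext fun j => ?_
        have := congrFun hg0 (finSumFinEquiv j)
        rcases j with j | j <;>
          simpa [Matrix.vecMul, dotProduct, ← hb, w] using this
      ext x; exact LinearMap.congr_fun hz' x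
    have hli : LinearIndependent ℂ fun i => χ' (Fin.cast hV.symm i) :=
      hχ'.comp _ (Fin.cast_injective _)
    exact Fintype.linearIndependent_iff.1 hli g hz i
  refine ⟨c * Complex.normSq D, mul_pos hc (Complex.normSq_pos.2 hD0), ?_⟩
  refine mul_right_cancel₀ (planeConst_ne_zero k) (h1.trans ?_)
  push_cast
  ring

/-- Forms of top degree are determined by their value on one real basis. -/
theorem AlternatingMap.eq_of_apply_eq_of_top {m : ℕ}
    (hm : finrank ℂ V + finrank ℂ V = m) {τ τ' : V [⋀^Fin m]→ₗ[ℝ] ℂ} {u : Fin m → V}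
    (hu : LinearIndependent ℝ u) (h : τ u = τ' u) : τ = τ' := by
  let e := basisOfLinearIndependentOfCardEqFinrank' u hu
    (by rw [Fintype.card_fin, finrank_real_of_complex, ← hm, two_mul])
  have he : ∀ i, e i = u i := fun i => by simp [e]
  refine Basis.ext_alternating e fun i hi => ?_
  let σ := Equiv.ofBijective i (Finite.injective_iff_bijective.1 hi)
  simp only [he]
  change τ (u ∘ σ) = τ' (u ∘ σ)
  rw [τ.map_perm u σ, τ'.map_perm u σ, h]

/-- The converse of `IsTransverseAt.pos_planeTuple`: a form of top degree is determined by its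
value on a basis, here one adapted to the kernel of the given functionals. -/
theorem isTransverseAt_of_pos {p k : ℕ} (hV : finrank ℂ V = p + k)
    {Ω : V [⋀^Fin (p + p)]→L[ℝ] ℂ} (ht : HasType p p Ω) (hr : IsRealForm Ω)
    (hpos : ∀ v : Fin p → V, LinearIndependent ℂ v →
      ∃ c : ℝ, 0 < c ∧ Ω (planeTuple v) = c * transverseConst p k) :
    IsTransverseAt p Ω := by
  refine ⟨ht, hr, fun k' hk' χ hχ => ?_⟩
  obtain rfl : k' = k := by omega
  have hli : LinearIndependent ℂ fun i => ((χ i : V →ₗ[ℂ] ℂ) : Dual ℂ V) := by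
    exact hχ.map' (LinearMap.toContinuousLinearMap : (V →ₗ[ℂ] ℂ) ≃ₗ[ℂ] (V →L[ℂ] ℂ)).symm.toLinearMap
      (LinearEquiv.ker _)
  obtain ⟨c, hc⟩ := exists_basis_sum_inr
    ((Subspace.dual_finrank_eq (K := ℂ) (V := V)).trans hV) hli
  -- the basis of `V` dual to the basis `c` of the dual space
  let b : Basis (Fin p ⊕ Fin k') ℂ V := c.dualBasis.map (evalEquiv ℂ V).symm
  have hcb : ∀ i j, c i (b j) = if i = j then 1 else 0 := by
    intro i j
    simp [b, Finsupp.single_apply]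
  let v : Fin p → V := fun i => b (Sum.inl i)
  let w : Fin k' → V := fun i => b (Sum.inr i)
  obtain ⟨r, hr0, hr⟩ := hpos v (b.linearIndependent.comp _ Sum.inl_injective)
  have hχc : ∀ i x, χ i x = c (Sum.inr i) x := fun i x => by rw [hc]; rfl
  let χ' : Fin (finrank ℂ V) → (V →L[ℂ] ℂ) :=
    fun i => LinearMap.toContinuousLinearMap (c (finSumFinEquiv.symm (Fin.cast hV i)))
  have h : finrank ℂ V + finrank ℂ V = p + p + (k' + k') := by omega
  have hval : simplePositive χ' (fun i => Fin.append (planeTuple v) (planeTuple w) (Fin.cast h i))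
      = transverseConst p k' * planeConst k' := by
    rw [simplePositive_cast hV.symm]
    simp only [Fin.cast_cast]
    rw [simplePositive_append_planeTuple]
    have : (Matrix.of fun i j => χ' (Fin.cast hV.symm i) (Fin.append v w j)) = 1 := by
      ext i j
      obtain ⟨i, rfl⟩ := finSumFinEquiv.surjective i
      obtain ⟨j, rfl⟩ := finSumFinEquiv.surjective j
      have : Fin.append v w (finSumFinEquiv j) = b j := by rcases j with j | j <;> simp [v, w]
      simp [χ', this, hcb, Matrix.one_apply]
    rw [this]; simp
  refine ⟨h, χ', ?_, r, hr0, ?_⟩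
  · have := (c.linearIndependent.comp (fun i : Fin (finrank ℂ V) =>
      finSumFinEquiv.symm (Fin.cast hV i)) (finSumFinEquiv.symm.injective.comp
        (Fin.cast_injective _))).map'
      (LinearMap.toContinuousLinearMap : (V →ₗ[ℂ] ℂ) ≃ₗ[ℂ] (V →L[ℂ] ℂ)).toLinearMap
      (LinearEquiv.ker _)
    exact this
  · have key : (wedge Ω (simplePositive χ)).toAlternatingMap
        = (r : ℂ) • (simplePositive χ').toAlternatingMap.domDomCongr (finCongr h) := by
      have h2 : (r : ℂ) * simplePositive χ'
          (fun i => Fin.append (planeTuple v) (planeTuple w) (Fin.cast h i)) ≠ 0 := by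
        rw [hval]
        exact mul_ne_zero (by exact_mod_cast hr0.ne')
          (mul_ne_zero (transverseConst_ne_zero _ _) (planeConst_ne_zero _))
      refine AlternatingMap.eq_of_apply_eq_of_top h
        (u := Fin.append (planeTuple v) (planeTuple w)) ?_ ?_
      · by_contra hcon
        exact h2 (((r : ℂ) • (simplePositive χ').toAlternatingMap.domDomCongr
          (finCongr h)).map_linearDependent _ hcon)
      · refine (wedge_simplePositive_append _ _ _ _ (fun i j => by simp [hχc, v, hcb])
          (fun i j => by simp [hχc, w, hcb])).trans ?_
        rw [hr]
        change _ = (r : ℂ) * simplePositive χ'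
          (fun i => Fin.append (planeTuple v) (planeTuple w) (Fin.cast h i))
        rw [hval]; ring
    intro u
    exact DFunLike.congr_fun key u

end Transverse

/-- The model space `ℂ⁴`. -/
abbrev C4 : Type := Fin 4 → ℂ

/-! ### Smoothness of exterior forms on a finite dimensional space -/

section Smooth

variable {F : Type*} [NormedAddCommGroup F] [NormedSpace ℝ F]

/-- The real basis `e₁, …, e₄, i e₁, …, i e₄` of `ℂ⁴`. -/
def realBasis : Module.Basis ((_ : Fin 4) × Fin 2) ℝ C4 :=
  Pi.basis fun _ => Complex.basisOneI

theorem contDiff_alternating_apply {k : ℕ} {β : F → C4 [⋀^Fin k]→L[ℝ] ℂ} {V : Fin k → F → C4}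
    (hβ : ContDiff ℝ ∞ β) (hV : ∀ i, ContDiff ℝ ∞ (V i)) :
    ContDiff ℝ ∞ fun w => β w fun i => V i w := by
  have h : (fun w => β w fun i => V i w) = fun w =>
      ∑ r : Fin k → (_ : Fin 4) × Fin 2, (∏ i, realBasis.coord (r i) (V i w)) •
        β w (fun i => realBasis (r i)) := by
    funext w
    have h1 : (fun i => V i w) = fun i => ∑ j, realBasis.coord j (V i w) • realBasis j := by
      funext i; exact (realBasis.sum_repr _).symm
    conv_lhs => rw [h1]
    have h2 := (β w).toMultilinearMap.map_sum
      (fun i j => realBasis.coord j (V i w) • realBasis j)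
    refine h2.trans (Finset.sum_congr rfl fun r _ => ?_)
    exact (β w).toMultilinearMap.map_smul_univ _ _
  rw [h]
  refine ContDiff.sum fun r _ => ContDiff.fun_smul (contDiff_prod fun i _ => ?_) ?_
  · exact (LinearMap.toContinuousLinearMap (realBasis.coord (r i))).contDiff.comp (hV i)
  · exact (ContinuousAlternatingMap.apply ℝ C4 ℂ fun i => realBasis (r i)).contDiff.comp hβ

/-- The forms on `ℂ⁴` are a finite dimensional space, with coordinates the values on a basis. -/
theorem contDiff_alternating_of_apply {k : ℕ} {β : F → C4 [⋀^Fin k]→L[ℝ] ℂ}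
    (h : ∀ v, ContDiff ℝ ∞ fun w => β w v) : ContDiff ℝ ∞ β := by
  let ev : (C4 [⋀^Fin k]→L[ℝ] ℂ) →ₗ[ℝ] ((Fin k → (_ : Fin 4) × Fin 2) → ℂ) :=
    LinearMap.pi fun r =>
      (ContinuousAlternatingMap.apply ℝ C4 ℂ fun i => realBasis (r i)).toLinearMap
  have hinj : Function.Injective ev := by
    intro f g hfg
    have : f.toAlternatingMap = g.toAlternatingMap :=
      Module.Basis.ext_alternating realBasis fun r _ => congrFun hfg r
    ext v
    exact DFunLike.congr_fun this v
  have hfin : FiniteDimensional ℝ (C4 [⋀^Fin k]→L[ℝ] ℂ) := FiniteDimensional.of_injective ev hinj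
  obtain ⟨g, hg⟩ := ev.exists_leftInverse_of_injective (LinearMap.ker_eq_bot.2 hinj)
  have h1 : β = (LinearMap.toContinuousLinearMap g) ∘ fun w r => β w fun i => realBasis (r i) := by
    funext w
    exact (LinearMap.congr_fun hg (β w)).symm
  rw [h1]
  exact (LinearMap.toContinuousLinearMap g).contDiff.comp (contDiff_pi.2 fun r => h _)

end Smooth

/-! ### Right invariant frame and trivialization of forms -/

namespace NilG

/-- The bilinear part of the group law: the derivative at the identity in the first variable of
`z ↦ z * u` is `c ↦ c + twist u c`. -/
def twist (u c : C4) : C4 :=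
  ![0, 0, -u 0 * c 1 + starRingEnd ℂ (u 0) * c 0 + starRingEnd ℂ (u 1) * c 1, -u 0 * c 1]

/-- `twist` as a real bilinear map. -/
def twistCLM : C4 →L[ℝ] C4 →L[ℝ] C4 :=
  LinearMap.toContinuousLinearMap
    { toFun := fun u => LinearMap.toContinuousLinearMap
        { toFun := twist u
          map_add' := fun c d => by
            funext i; fin_cases i <;> simp [twist]; all_goals ring
          map_smul' := fun r c => by
            funext i; fin_cases i <;> simp [twist]; all_goals ring }
      map_add' := fun u w => by
        ext c i; fin_cases i <;> simp [twist]; all_goals ring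
      map_smul' := fun r u => by
        ext c i; fin_cases i <;> simp [twist]; all_goals ring }

@[simp] theorem twistCLM_apply (u c : C4) : twistCLM u c = twist u c := rfl

theorem twist_smul_right (u : C4) (r : ℂ) (c : C4) : twist u (r • c) = r • twist u c := by
  funext i; fin_cases i <;> simp [twist]; all_goals ring

/-- The frame of right invariant vector fields: `frame z c` is the value at `z` of the right
invariant field with value `c` at the identity. It is also the differential of the right
translation by `z`, at every point. -/
def frame (z : C4) : C4 →L[ℝ] C4 := ContinuousLinearMap.id ℝ C4 + twistCLM z

/-- The inverse of the invariant frame; its components are the invariant coframe. -/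
def coframeMap (z : C4) : C4 →L[ℝ] C4 := ContinuousLinearMap.id ℝ C4 - twistCLM z

theorem frame_apply (z c : C4) : frame z c = c + twist z c := rfl
theorem coframeMap_apply (z c : C4) : coframeMap z c = c - twist z c := rfl

theorem twist_twist_left (u c d : C4) : twist (twist u c) d = 0 := by
  funext i; fin_cases i <;> simp [twist]

theorem twist_twist_right (u c d : C4) : twist u (twist c d) = 0 := by
  funext i; fin_cases i <;> simp [twist]

theorem frame_smul (z : C4) (r : ℂ) (c : C4) : frame z (r • c) = r • frame z c := by
  simp [frame_apply, twist_smul_right]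

theorem frame_twist (z u c : C4) : frame z (twist u c) = twist u c := by
  simp [frame_apply, twist_twist_right]

theorem twist_frame (z u c : C4) : twist (frame z u) c = twist u c := by
  rw [frame_apply, ← twistCLM_apply, map_add]
  simp [twist_twist_left]

theorem coframeMap_frame (z c : C4) : coframeMap z (frame z c) = c := by
  rw [coframeMap_apply, frame_apply, ← twistCLM_apply z (c + _), map_add]
  simp [twist_twist_right]

theorem frame_coframeMap (z c : C4) : frame z (coframeMap z c) = c := by
  rw [frame_apply, coframeMap_apply, ← twistCLM_apply z (c - _), map_sub]
  simp [twist_twist_right]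

theorem mulFun_eq (z a : C4) : mulFun z a = z + a + twist a z := by
  funext i; fin_cases i <;> simp [mulFun, twist]; all_goals ring

theorem hasFDerivAt_mulFun (a z : C4) : HasFDerivAt (fun z => mulFun z a) (frame a) z := by
  have : (fun z => mulFun z a) = fun z => frame a z + a := by
    funext z; rw [mulFun_eq, frame_apply]; abel
  rw [this]
  exact (frame a).hasFDerivAt.add_const a

theorem frame_comp_frame (a z : C4) : (frame a).comp (frame z) = frame (mulFun z a) := by
  ext1 c
  have h1 : twistCLM (mulFun z a) c = twist z c + twist a c := by
    rw [mulFun_eq, map_add, map_add]; simp [twist_twist_left]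
  have h2 : twistCLM a (c + twist z c) = twist a c := by
    rw [map_add]; simp [twist_twist_right]
  change (c + twist z c) + twistCLM a (c + twist z c) = c + twistCLM (mulFun z a) c
  rw [h1, h2]
  abel

theorem hasFDerivAt_frame_apply (c z : C4) :
    HasFDerivAt (fun w => frame w c) (twistCLM.flip c) z :=
  (twistCLM.flip c).hasFDerivAt.const_add c

theorem contDiff_frame_apply (c : C4) : ContDiff ℝ ∞ fun w => frame w c :=
  contDiff_const.add (twistCLM.flip c).contDiff

theorem contDiff_coframeMap_apply (c : C4) : ContDiff ℝ ∞ fun w => coframeMap w c :=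
  contDiff_const.sub (twistCLM.flip c).contDiff

variable {k : ℕ}

/-- The coefficients of a form with respect to the invariant frame. -/
def trivialize (β : C4 → C4 [⋀^Fin k]→L[ℝ] ℂ) (z : C4) : C4 [⋀^Fin k]→L[ℝ] ℂ :=
  (β z).compContinuousLinearMap (frame z)

/-- The right invariant form with value `B` at the identity. -/
def invForm (B : C4 [⋀^Fin k]→L[ℝ] ℂ) (z : C4) : C4 [⋀^Fin k]→L[ℝ] ℂ :=
  B.compContinuousLinearMap (coframeMap z)

theorem trivialize_apply (β : C4 → C4 [⋀^Fin k]→L[ℝ] ℂ) (z : C4) (c : Fin k → C4) :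
    trivialize β z c = β z fun i => frame z (c i) := rfl

theorem invForm_apply (B : C4 [⋀^Fin k]→L[ℝ] ℂ) (z : C4) (c : Fin k → C4) :
    invForm B z c = B fun i => coframeMap z (c i) := rfl

theorem invForm_frame (B : C4 [⋀^Fin k]→L[ℝ] ℂ) (z : C4) (c : Fin k → C4) :
    (invForm B z fun i => frame z (c i)) = B c := by
  simp [invForm_apply, coframeMap_frame]

theorem trivialize_invForm (B : C4 [⋀^Fin k]→L[ℝ] ℂ) (z : C4) : trivialize (invForm B) z = B := by
  ext c; rw [trivialize_apply, invForm_frame]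

theorem contDiff_invForm (B : C4 [⋀^Fin k]→L[ℝ] ℂ) : ContDiff ℝ ∞ (invForm B) :=
  contDiff_alternating_of_apply fun v =>
    contDiff_alternating_apply (β := fun _ => B) (V := fun i w => coframeMap w (v i))
      contDiff_const fun i => contDiff_coframeMap_apply (v i)

theorem eq_of_frame {A B : C4 [⋀^Fin k]→L[ℝ] ℂ} (z : C4)
    (h : ∀ c : Fin k → C4, (A fun i => frame z (c i)) = B fun i => frame z (c i)) : A = B := by
  ext v
  simpa [frame_coframeMap] using h fun i => coframeMap z (v i)

/-- The first order operator which differentiates the coefficients by `a ∂ᵥ + b ∂ᵢᵥ` in the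
direction `v`. It is `d` for `(a, b) = (1, 0)`, `∂` for `(1/2, -i/2)` and `∂̄` for
`(1/2, i/2)`. -/
def twD (a b : ℂ) (β : C4 → C4 [⋀^Fin k]→L[ℝ] ℂ) (y : C4) : C4 [⋀^Fin (k + 1)]→L[ℝ] ℂ :=
  .alternatizeUncurryFin (a • fderiv ℝ β y + b • (fderiv ℝ β y).comp (mulI C4))

theorem extDeriv_eq_twD (β : C4 → C4 [⋀^Fin k]→L[ℝ] ℂ) : extDeriv β = twD 1 0 β := by
  funext y; simp [extDeriv, twD]

theorem flatDel_eq_twD (β : C4 → C4 [⋀^Fin k]→L[ℝ] ℂ) :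
    flatDel β = twD (1 / 2) (-Complex.I / 2) β := by
  funext y
  rw [flatDel, twD]
  congr 1
  ext v w
  simp
  ring

theorem flatDelbar_eq_twD (β : C4 → C4 [⋀^Fin k]→L[ℝ] ℂ) :
    flatDelbar β = twD (1 / 2) (Complex.I / 2) β := by
  funext y
  rw [flatDelbar, twD]
  congr 1
  ext v w
  simp
  ring

theorem twD_apply (a b : ℂ) (β : C4 → C4 [⋀^Fin k]→L[ℝ] ℂ) (y : C4) (v : Fin (k + 1) → C4) :
    twD a b β y v = ∑ i : Fin (k + 1), (-1) ^ (i : ℕ) *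
      (a * fderiv ℝ β y (v i) (i.removeNth v)
        + b * fderiv ℝ β y (Complex.I • v i) (i.removeNth v)) := by
  rw [twD, ContinuousAlternatingMap.alternatizeUncurryFin_apply]
  refine Finset.sum_congr rfl fun i _ => ?_
  simp [mulI, mul_add]

/-- The algebraic part of the operator `twD a b` in the invariant frame, with the opposite sign; it
comes from the derivatives `twist u c` of the invariant fields `c` in the direction `u`. -/
def structureTerm (a b : ℂ) (B : C4 [⋀^Fin k]→L[ℝ] ℂ) (c : Fin (k + 1) → C4) : ℂ :=
  ∑ i : Fin (k + 1), (-1) ^ (i : ℕ) * ∑ l : Fin k,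
    (a * B (Function.update (i.removeNth c) l (twist (c i) (i.removeNth c l)))
      + b * B (Function.update (i.removeNth c) l (twist (Complex.I • c i) (i.removeNth c l))))

/-- Differentiating the coefficients of a form in the invariant frame. -/
theorem fderiv_trivialize_apply {β : C4 → C4 [⋀^Fin k]→L[ℝ] ℂ} {z : C4}
    (hβ : DifferentiableAt ℝ β z) (u : C4) (c : Fin k → C4) :
    fderiv ℝ β z (frame z u) (fun i => frame z (c i)) =
      fderiv ℝ (fun w => trivialize β w c) z (frame z u)
        - ∑ l, trivialize β z (Function.update c l (twist u (c l))) := by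
  have h := fderiv_continuousAlternatingMap_apply_apply hβ
    (g := fun i w => frame w (c i)) (fun i => (hasFDerivAt_frame_apply (c i) z).differentiableAt)
    (frame z u)
  simp only [trivialize_apply]
  rw [h, add_sub_assoc, left_eq_add, sub_eq_zero]
  refine Finset.sum_congr rfl fun l _ => ?_
  congr 1
  funext j
  rw [(hasFDerivAt_frame_apply (c l) z).fderiv]
  simp only [ContinuousLinearMap.flip_apply, twistCLM_apply, twist_frame]
  rcases eq_or_ne j l with rfl | hj
  · simp [frame_twist]
  · simp [Function.update_of_ne hj]

/-- In the invariant frame `twD a b` differentiates the coefficients, up to an algebraic term. -/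
theorem twD_frame {a b : ℂ} {β : C4 → C4 [⋀^Fin k]→L[ℝ] ℂ} {z : C4}
    (hβ : DifferentiableAt ℝ β z) (c : Fin (k + 1) → C4) :
    (twD a b β z fun i => frame z (c i)) =
      ∑ i : Fin (k + 1), (-1) ^ (i : ℕ) *
        (a * fderiv ℝ (fun w => trivialize β w (i.removeNth c)) z (frame z (c i))
          + b * fderiv ℝ (fun w => trivialize β w (i.removeNth c)) z (frame z (Complex.I • c i)))
        - structureTerm a b (trivialize β z) c := by
  rw [twD_apply, structureTerm, ← Finset.sum_sub_distrib]
  refine Finset.sum_congr rfl fun i _ => ?_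
  have h1 := fderiv_trivialize_apply hβ (c i) (i.removeNth c)
  have h2 := fderiv_trivialize_apply hβ (Complex.I • c i) (i.removeNth c)
  rw [← frame_smul]
  change _ * (a * fderiv ℝ β z (frame z (c i)) (fun j => frame z (i.removeNth c j))
    + b * fderiv ℝ β z (frame z (Complex.I • c i)) (fun j => frame z (i.removeNth c j))) = _
  rw [h1, h2, Finset.sum_add_distrib, ← Finset.mul_sum, ← Finset.mul_sum]
  ring

/-- On right invariant forms the operator `twD a b` is algebraic. -/
theorem twD_invForm (a b : ℂ) (B : C4 [⋀^Fin k]→L[ℝ] ℂ) (z : C4) (c : Fin (k + 1) → C4) :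
    (twD a b (invForm B) z fun i => frame z (c i)) = -structureTerm a b B c := by
  rw [twD_frame ((contDiff_invForm B).differentiable (by simp) z)]
  simp [trivialize_invForm]

theorem twD_invForm_eq (a b : ℂ) (B : C4 [⋀^Fin k]→L[ℝ] ℂ) :
    twD a b (invForm B) = invForm (twD a b (invForm B) 0) := by
  funext z
  refine eq_of_frame z fun c => ?_
  have h0 := twD_invForm a b B 0 c
  have : ∀ c, frame 0 c = c := fun c => by rw [frame_apply, ← twistCLM_apply]; simp
  simp only [this] at h0
  rw [twD_invForm, invForm_frame, h0]

theorem contDiff_twD {a b : ℂ} {β : C4 → C4 [⋀^Fin k]→L[ℝ] ℂ} (hβ : ContDiff ℝ ∞ β) :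
    ContDiff ℝ ∞ (twD a b β) := by
  have h1 : ContDiff ℝ ∞ (fderiv ℝ β) := hβ.fderiv_right (by simp)
  have h2 : ContDiff ℝ ∞ fun y => a • fderiv ℝ β y + b • (fderiv ℝ β y).comp (mulI C4) :=
    (h1.const_smul a).add ((h1.clm_comp contDiff_const).const_smul b)
  exact (ContinuousAlternatingMap.alternatizeUncurryFinCLM ℝ C4 ℂ).contDiff.comp h2

end NilG

namespace NilG

open MeasureTheory Filter Topology

/-! ### Divergences of periodic functions -/

/-- The coordinates of an element of the group. -/
def toVec (γ : NilG) : C4 := γ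

/-- Functions on the group which are invariant under right translations by `Γ`. -/
def IsPeriodic (Γ : Subgroup NilG) {X : Type*} (g : C4 → X) : Prop :=
  ∀ γ : NilG, γ ∈ Γ → ∀ z, g (mulFun z γ.toVec) = g z

/-- The linear span of the derivatives of smooth periodic functions along right invariant vector
fields. -/
def divSpace (Γ : Subgroup NilG) : Submodule ℂ (C4 → ℂ) :=
  Submodule.span ℂ {f | ∃ g : C4 → ℂ, ContDiff ℝ ∞ g ∧ IsPeriodic Γ g ∧
    ∃ c : C4, f = fun z => fderiv ℝ g z (frame z c)}

theorem exists_continuous_quotient {Γ : Subgroup NilG} {X : Type*} [TopologicalSpace X] {g : C4 → X}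
    (hg : Continuous g) (hp : IsPeriodic Γ g) :
    ∃ h : NilG ⧸ Γ → X, Continuous h ∧ ∀ z : NilG, h (z : NilG ⧸ Γ) = g z := by
  have hrel : ∀ a b : NilG, QuotientGroup.leftRel Γ a b → (g a : X) = g b := by
    intro a b hab
    rw [QuotientGroup.leftRel_apply] at hab
    have h1 := hp _ hab a
    have h2 : mulFun a (a⁻¹ * b : NilG).toVec = b := mul_inv_cancel_left a b
    rw [h2] at h1
    exact h1.symm
  exact ⟨Quotient.lift (s := QuotientGroup.leftRel Γ) (fun z : NilG => g z) hrel,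
    Continuous.quotient_lift hg hrel, fun z => rfl⟩

theorem IsPeriodic.exists_norm_le {Γ : Subgroup NilG} [IsLattice Γ] {g : C4 → ℂ}
    (hp : IsPeriodic Γ g) (hg : Continuous g) : ∃ C : ℝ, ∀ z, ‖g z‖ ≤ C := by
  obtain ⟨h, hc, hh⟩ := exists_continuous_quotient hg hp
  have := IsLattice.cocompact (Γ := Γ)
  obtain ⟨C, hC⟩ := isCompact_univ.exists_bound_of_continuousOn hc.continuousOn
  exact ⟨C, fun z => (congrArg norm (hh z)).symm.trans_le (hC _ (Set.mem_univ _))⟩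

theorem IsPeriodic.exists_pos_le {Γ : Subgroup NilG} [IsLattice Γ] {g : C4 → ℝ}
    (hp : IsPeriodic Γ g) (hg : Continuous g) (hpos : ∀ z, 0 < g z) :
    ∃ r : ℝ, 0 < r ∧ ∀ z, r ≤ g z := by
  obtain ⟨h, hc, hh⟩ := exists_continuous_quotient hg hp
  have := IsLattice.cocompact (Γ := Γ)
  obtain ⟨x, -, hx⟩ := isCompact_univ.exists_isMinOn ⟨((1 : NilG) : NilG ⧸ Γ), Set.mem_univ _⟩
    hc.continuousOn
  obtain ⟨w, rfl⟩ := QuotientGroup.mk_surjective x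
  exact ⟨g w, hpos w, fun z => (hh w).symm.trans_le
    ((hx (Set.mem_univ (QuotientGroup.mk (α := NilG) z))).trans_eq (hh z))⟩

/-- The dilations are automorphisms of the group; they rescale the invariant frame. -/
def dilate (R : ℝ) : C4 →L[ℝ] C4 :=
  LinearMap.toContinuousLinearMap
    { toFun := fun z => ![R * z 0, R * z 1, R ^ 2 * z 2, R ^ 2 * z 3]
      map_add' := fun c d => by
        funext i; fin_cases i <;> simp; all_goals ring
      map_smul' := fun r c => by
        funext i; fin_cases i <;> simp; all_goals ring }

theorem dilate_apply (R : ℝ) (z : C4) :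
    dilate R z = ![R * z 0, R * z 1, R ^ 2 * z 2, R ^ 2 * z 3] := rfl

theorem dilate_frame (R : ℝ) (z c : C4) :
    dilate R (frame z c) = frame (dilate R z) (dilate R c) := by
  funext i
  fin_cases i <;> simp [dilate_apply, frame_apply, twist, Matrix.vecHead, Matrix.vecTail] <;> ring

theorem dilate_dilate_inv {R : ℝ} (hR : R ≠ 0) (c : C4) : dilate R (dilate R⁻¹ c) = c := by
  funext i
  fin_cases i <;> simp [dilate_apply]
  all_goals rw [← mul_assoc, mul_inv_cancel₀ (by exact_mod_cast (by simpa using hR)), one_mul]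

theorem norm_dilate_inv_le {R : ℝ} (hR : 1 ≤ R) (c : C4) : ‖dilate R⁻¹ c‖ ≤ ‖c‖ / R := by
  have hR0 : 0 < R := by linarith
  have hinv : R⁻¹ ≤ 1 := inv_le_one_of_one_le₀ hR
  have hinv0 : 0 < R⁻¹ := inv_pos.2 hR0
  rw [pi_norm_le_iff_of_nonneg (by positivity)]
  have hsq : R⁻¹ ^ 2 ≤ R⁻¹ := by nlinarith
  have h1 : ∀ i, R⁻¹ * ‖c i‖ ≤ ‖c‖ / R := fun i => by
    rw [div_eq_inv_mul]; exact mul_le_mul_of_nonneg_left (norm_le_pi_norm c i) hinv0.le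
  have h2 : ∀ i, R⁻¹ ^ 2 * ‖c i‖ ≤ ‖c‖ / R := fun i =>
    (mul_le_mul_of_nonneg_right hsq (norm_nonneg _)).trans (h1 i)
  intro i
  fin_cases i
  · simpa [dilate_apply, abs_of_pos hR0] using h1 0
  · simpa [dilate_apply, abs_of_pos hR0] using h1 1
  · simpa [dilate_apply, abs_of_pos hR0] using h2 2
  · simpa [dilate_apply, abs_of_pos hR0] using h2 3

theorem realBasis_apply (j : Fin 4) (t : Fin 2) :
    realBasis ⟨j, t⟩ = Pi.single j (![1, Complex.I] t) := by
  rw [realBasis, Pi.basis_apply, Complex.coe_basisOneI]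

/-- The coordinate `b` of an invariant field does not depend on the coordinate `b` of the point. -/
theorem realBasis_coord_twist_self (b : (_ : Fin 4) × Fin 2) (c : C4) :
    realBasis.coord b (twist (realBasis b) c) = 0 := by
  obtain ⟨j, t⟩ := b
  rw [realBasis_apply]
  have : ∀ v : C4, realBasis.coord ⟨j, t⟩ v = Complex.basisOneI.repr (v j) t := fun v => by
    simp [realBasis, Pi.basis_repr]
  rw [this]
  fin_cases j <;> simp [twist]

/-- Right invariant vector fields are divergence free. -/
theorem integral_fderiv_frame {F : C4 → ℂ} (hF : ContDiff ℝ ∞ F) (hc : HasCompactSupport F)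
    (c : C4) : ∫ z, fderiv ℝ F z (frame z c) = 0 := by
  let κ : (_ : Fin 4) × Fin 2 → C4 → ℝ := fun b z => realBasis.coord b (frame z c)
  have hκ : ∀ b z, HasFDerivAt (κ b)
      ((LinearMap.toContinuousLinearMap (realBasis.coord b)).comp (twistCLM.flip c)) z := fun b z =>
    (LinearMap.toContinuousLinearMap (realBasis.coord b)).hasFDerivAt.comp z
      (hasFDerivAt_frame_apply c z)
  have hκc : ∀ b, Continuous (κ b) := fun b =>
    continuous_iff_continuousAt.2 fun z => (hκ b z).continuousAt
  have hdF : Continuous (fderiv ℝ F) := hF.continuous_fderiv (by simp)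
  have hdc : ∀ v, HasCompactSupport fun z => fderiv ℝ F z v := fun v => hc.fderiv_apply (𝕜 := ℝ) v
  have hint : ∀ b, Integrable fun z => κ b z • fderiv ℝ F z (realBasis b) := fun b =>
    ((hκc b).smul (hdF.clm_apply continuous_const)).integrable_of_hasCompactSupport
      ((hdc _).smul_left)
  have h1 : ∀ z, fderiv ℝ F z (frame z c) = ∑ b, κ b z • fderiv ℝ F z (realBasis b) := by
    intro z
    conv_lhs => rw [← realBasis.sum_repr (frame z c), map_sum]
    refine Finset.sum_congr rfl fun b _ => ?_
    rw [map_smul]; rfl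
  simp_rw [h1]
  rw [integral_finsetSum _ fun b _ => hint b]
  refine Finset.sum_eq_zero fun b _ => ?_
  have hz : ∀ z, fderiv ℝ (κ b) z (realBasis b) = 0 := by
    intro z
    rw [(hκ b z).fderiv]
    exact realBasis_coord_twist_self b c
  rw [integral_smul_fderiv_eq_neg_fderiv_smul_of_integrable _ (hint b)]
  · simp [hz]
  · exact ((hκc b).smul hF.continuous).integrable_of_hasCompactSupport hc.smul_left
  · exact fun x _ => (hκ b x).differentiableAt
  · exact fun x _ => hF.differentiable (by simp) x
  · simp [hz]

/-- A fixed smooth cut-off function on `ℂ⁴`. -/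
def cutoff : ContDiffBump (0 : C4) := default

/-- The weighted averages of `f` at scale `R`. -/
def scaledMean (R : ℝ) (f : C4 → ℂ) : ℂ := ∫ z, cutoff z • f (dilate R z)

theorem integrable_scaledMean {f : C4 → ℂ} (hf : Continuous f) (R : ℝ) :
    Integrable fun z => cutoff z • f (dilate R z) :=
  (cutoff.continuous.smul (hf.comp (dilate R).continuous)).integrable_of_hasCompactSupport
    cutoff.hasCompactSupport.smul_right

/-- After the substitution `z ↦ dilate R z` the field of `c` becomes the field of `dilate R⁻¹ c`,
which is `O(1/R)`; integration by parts moves the derivative to the cut-off function. -/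
theorem norm_scaledMean_fderiv_le {g : C4 → ℂ} (hg : ContDiff ℝ ∞ g) {C : ℝ}
    (hC : ∀ z, ‖g z‖ ≤ C) (c : C4) {R : ℝ} (hR : 1 ≤ R) :
    ‖scaledMean R fun z => fderiv ℝ g z (frame z c)‖ ≤
      C * (∫ z, ‖fderiv ℝ cutoff z‖ * ‖frame z‖) * ‖c‖ / R := by
  have hR0 : R ≠ 0 := by positivity
  set c' := dilate R⁻¹ c with hc'
  set G : C4 → ℂ := fun z => g (dilate R z) with hG
  have hGs : ContDiff ℝ ∞ G := hg.comp (dilate R).contDiff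
  have hχ : ContDiff ℝ ∞ (cutoff : C4 → ℝ) := cutoff.contDiff
  have hframe : Continuous fun z : C4 => frame z :=
    continuous_const.add twistCLM.continuous
  have hdχ : Continuous (fderiv ℝ (cutoff : C4 → ℝ)) := hχ.continuous_fderiv (by simp)
  have hdG : Continuous (fderiv ℝ G) := hGs.continuous_fderiv (by simp)
  have h1 : ∀ z, fderiv ℝ g (dilate R z) (frame (dilate R z) c) = fderiv ℝ G z (frame z c') := by
    intro z
    have h2 : HasFDerivAt G ((fderiv ℝ g (dilate R z)).comp (dilate R)) z :=
      (hg.differentiable (by simp) (dilate R z)).hasFDerivAt.comp z (dilate R).hasFDerivAt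
    rw [h2.fderiv, ContinuousLinearMap.comp_apply, dilate_frame, hc', dilate_dilate_inv hR0]
  have h2 : ∀ z, fderiv ℝ (fun z => cutoff z • G z) z (frame z c')
      = cutoff z • fderiv ℝ G z (frame z c') + fderiv ℝ cutoff z (frame z c') • G z := by
    intro z
    rw [fderiv_fun_smul (hχ.differentiable (by simp) z) (hGs.differentiable (by simp) z)]
    simp
  have h3 := integral_fderiv_frame (hχ.smul hGs) cutoff.hasCompactSupport.smul_right c'
  have hi1 : Integrable fun z => cutoff z • fderiv ℝ G z (frame z c') :=
    (cutoff.continuous.smul (hdG.clm_apply (hframe.clm_apply continuous_const))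
      ).integrable_of_hasCompactSupport cutoff.hasCompactSupport.smul_right
  have hcs : HasCompactSupport (fderiv ℝ (cutoff : C4 → ℝ)) := cutoff.hasCompactSupport.fderiv ℝ
  have hi2 : Integrable fun z => fderiv ℝ cutoff z (frame z c') • G z := by
    refine ((hdχ.clm_apply (hframe.clm_apply continuous_const)).smul hGs.continuous
      ).integrable_of_hasCompactSupport (hcs.mono' ?_)
    intro z hz
    refine subset_tsupport _ ?_
    contrapose! hz
    simp only [Function.mem_support, not_not] at hz ⊢
    simp [hz]
  have hi3 : Integrable fun z => ‖fderiv ℝ cutoff z‖ * ‖frame z‖ := by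
    refine (hdχ.norm.mul hframe.norm).integrable_of_hasCompactSupport ?_
    exact hcs.norm.mul_right
  have h4 : scaledMean R (fun z => fderiv ℝ g z (frame z c))
      = -∫ z, fderiv ℝ cutoff z (frame z c') • G z := by
    rw [scaledMean, eq_neg_iff_add_eq_zero]
    simp_rw [h1]
    rw [← integral_add hi1 hi2, ← h3]
    refine integral_congr_ae (Eventually.of_forall fun z => ?_)
    exact (h2 z).symm
  have hC0 : 0 ≤ C := (norm_nonneg _).trans (hC 0)
  rw [h4, norm_neg]
  calc ‖∫ z, fderiv ℝ cutoff z (frame z c') • G z‖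
      ≤ ∫ z, (‖fderiv ℝ cutoff z‖ * ‖frame z‖) * (C * (‖c‖ / R)) := by
        refine norm_integral_le_of_norm_le (hi3.mul_const _) (Eventually.of_forall fun z => ?_)
        rw [norm_smul]
        calc ‖fderiv ℝ cutoff z (frame z c')‖ * ‖G z‖
            ≤ (‖fderiv ℝ cutoff z‖ * (‖frame z‖ * (‖c‖ / R))) * C := by
              refine mul_le_mul ?_ (hC _) (norm_nonneg _) (by positivity)
              refine (ContinuousLinearMap.le_opNorm _ _).trans ?_
              refine mul_le_mul_of_nonneg_left ?_ (norm_nonneg _)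
              refine (ContinuousLinearMap.le_opNorm _ _).trans ?_
              exact mul_le_mul_of_nonneg_left (norm_dilate_inv_le hR c) (norm_nonneg _)
          _ = _ := by ring
    _ = _ := by rw [integral_mul_const]; ring

theorem tendsto_scaledMean_of_mem_divSpace {Γ : Subgroup NilG} [IsLattice Γ] {f : C4 → ℂ}
    (hf : f ∈ divSpace Γ) :
    Continuous f ∧ Tendsto (fun R => scaledMean R f) atTop (𝓝 0) := by
  induction hf using Submodule.span_induction with
  | mem f hf =>
    obtain ⟨g, hg, hp, c, rfl⟩ := hf
    refine ⟨(hg.continuous_fderiv (by simp)).clm_apply (contDiff_frame_apply c).continuous, ?_⟩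
    obtain ⟨C, hC⟩ := hp.exists_norm_le hg.continuous
    refine squeeze_zero_norm' ?_ (tendsto_const_nhds.div_atTop tendsto_id :
      Tendsto (fun R : ℝ => C * (∫ z, ‖fderiv ℝ cutoff z‖ * ‖frame z‖) * ‖c‖ / R) atTop (𝓝 0))
    filter_upwards [eventually_ge_atTop 1] with R hR
    exact norm_scaledMean_fderiv_le hg hC c hR
  | zero => exact ⟨continuous_const, by simp [scaledMean]⟩
  | add f g _ _ hf hg =>
    refine ⟨hf.1.add hg.1, ?_⟩
    have : (fun R => scaledMean R (f + g)) = fun R => scaledMean R f + scaledMean R g := by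
      funext R
      rw [scaledMean, scaledMean, scaledMean,
        ← integral_add (integrable_scaledMean hf.1 R) (integrable_scaledMean hg.1 R)]
      simp [smul_add]
    rw [this]
    simpa using hf.2.add hg.2
  | smul r f _ hf =>
    refine ⟨hf.1.const_smul r, ?_⟩
    have : (fun R => scaledMean R (r • f)) = fun R => r * scaledMean R f := by
      funext R
      rw [scaledMean, scaledMean, ← integral_const_mul]
      refine integral_congr_ae (Eventually.of_forall fun z => ?_)
      simp; ring
    rw [this]
    simpa using hf.2.const_mul r

/-- A divergence of periodic functions is not everywhere positive. This replaces Stokes' theorem on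
the compact quotient. -/
theorem not_forall_pos_of_mem_divSpace {Γ : Subgroup NilG} [IsLattice Γ] {f : C4 → ℂ}
    (hf : f ∈ divSpace Γ) (hp : IsPeriodic Γ f) :
    ¬ ∀ z, ∃ c : ℝ, 0 < c ∧ f z = c := by
  intro hpos
  obtain ⟨hc, ht⟩ := tendsto_scaledMean_of_mem_divSpace hf
  choose φ hφ0 hφ using hpos
  have hφe : φ = fun z => (f z).re := by funext z; rw [hφ z]; simp
  have hφc : Continuous φ := by rw [hφe]; exact Complex.continuous_re.comp hc
  have hφp : IsPeriodic Γ φ := fun γ hγ z => by rw [hφe]; simp only [hp γ hγ z]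
  obtain ⟨r, hr, hrφ⟩ := hφp.exists_pos_le hφc hφ0
  have hI : 0 < ∫ z, cutoff z := cutoff.integral_pos
  have hlow : ∀ R : ℝ, r * (∫ z, cutoff z) ≤ ‖scaledMean R f‖ := by
    intro R
    have h1 : scaledMean R f = ((∫ z, cutoff z * φ (dilate R z) : ℝ) : ℂ) := by
      rw [scaledMean, ← integral_complex_ofReal]
      refine integral_congr_ae (Eventually.of_forall fun z => ?_)
      simp [hφ]
    have hi : Integrable fun z => cutoff z * φ (dilate R z) :=
      (cutoff.continuous.mul (hφc.comp (dilate R).continuous)).integrable_of_hasCompactSupport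
        cutoff.hasCompactSupport.mul_right
    have h2 : r * (∫ z, cutoff z) ≤ ∫ z, cutoff z * φ (dilate R z) := by
      rw [← integral_const_mul]
      refine integral_mono ((cutoff.continuous.integrable_of_hasCompactSupport
        cutoff.hasCompactSupport).const_mul r) hi fun z => ?_
      have := mul_le_mul_of_nonneg_left (hrφ (dilate R z)) (cutoff.nonneg (x := z))
      simpa [mul_comm] using this
    rw [h1, Complex.norm_real]
    exact h2.trans (le_abs_self _)
  have h0 : r * (∫ z, cutoff z) ≤ 0 := by
    have := ht.norm
    rw [norm_zero] at this
    exact ge_of_tendsto' this hlow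
  exact absurd h0 (not_le.2 (mul_pos hr hI))

end NilG

namespace NilG

/-! ### Periodic forms -/

variable {k : ℕ}

/-- Forms on the group which are invariant under right translations by `Γ`. -/
def IsInvariant (Γ : Subgroup NilG) (β : C4 → C4 [⋀^Fin k]→L[ℝ] ℂ) : Prop :=
  ∀ γ : NilG, γ ∈ Γ → ∀ z, (β (mulFun z γ.toVec)).compContinuousLinearMap (frame γ.toVec) = β z

theorem IsInvariant.trivialize_periodic {Γ : Subgroup NilG} {β : C4 → C4 [⋀^Fin k]→L[ℝ] ℂ}
    (h : IsInvariant Γ β) (c : Fin k → C4) : IsPeriodic Γ fun z => trivialize β z c := by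
  intro γ hγ z
  simp only [trivialize_apply]
  rw [← frame_comp_frame, ← h γ hγ z]
  rfl

theorem contDiff_trivialize {β : C4 → C4 [⋀^Fin k]→L[ℝ] ℂ} (hβ : ContDiff ℝ ∞ β)
    (c : Fin k → C4) : ContDiff ℝ ∞ fun z => trivialize β z c :=
  contDiff_alternating_apply (V := fun i w => frame w (c i)) hβ fun i => contDiff_frame_apply (c i)

/-- The operators `twD a b` commute with right translations, whose differentials are complex
linear. -/
theorem twD_mulFun {a b : ℂ} {α β : C4 → C4 [⋀^Fin k]→L[ℝ] ℂ} {γ z : C4}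
    (hβ : DifferentiableAt ℝ β (mulFun z γ))
    (h : ∀ w, (β (mulFun w γ)).compContinuousLinearMap (frame γ) = α w) :
    (twD a b β (mulFun z γ)).compContinuousLinearMap (frame γ) = twD a b α z := by
  have h1 : HasFDerivAt α (((ContinuousAlternatingMap.compContinuousLinearMapCLM (frame γ)).comp
      (fderiv ℝ β (mulFun z γ))).comp (frame γ)) z := by
    have h2 := (ContinuousAlternatingMap.compContinuousLinearMapCLM (frame γ)).hasFDerivAt.comp z
      (hβ.hasFDerivAt.comp z (hasFDerivAt_mulFun γ z))
    refine h2.congr_of_eventuallyEq (Filter.Eventually.of_forall fun w => ?_)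
    exact (h w).symm
  ext v
  rw [twD_apply]
  change twD a b β (mulFun z γ) (fun i => frame γ (v i)) = _
  rw [twD_apply, h1.fderiv]
  refine Finset.sum_congr rfl fun i _ => ?_
  rw [← frame_smul]
  rfl

theorem IsInvariant.twD {Γ : Subgroup NilG} {a b : ℂ} {β : C4 → C4 [⋀^Fin k]→L[ℝ] ℂ}
    (h : IsInvariant Γ β) (hβ : ContDiff ℝ ∞ β) : IsInvariant Γ (twD a b β) :=
  fun γ hγ _ => twD_mulFun (hβ.differentiable (by simp) _) (h γ hγ)

theorem isInvariant_invForm (Γ : Subgroup NilG) (B : C4 [⋀^Fin k]→L[ℝ] ℂ) :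
    IsInvariant Γ (invForm B) := by
  intro γ _ z
  refine eq_of_frame z fun c => ?_
  rw [invForm_frame]
  have : ∀ i, frame γ.toVec (frame z (c i)) = frame (mulFun z γ.toVec) (c i) := fun i => by
    rw [← frame_comp_frame]; rfl
  change invForm B (mulFun z γ.toVec) (fun i => frame γ.toVec (frame z (c i))) = _
  simp only [this, invForm_frame]

/-- In the invariant frame, a twisted derivative of a periodic form is algebraic up to
divergences. -/
theorem twD_add_structureTerm_mem {Γ : Subgroup NilG} (a b : ℂ)
    {β : C4 → C4 [⋀^Fin k]→L[ℝ] ℂ} (hβ : ContDiff ℝ ∞ β) (h : IsInvariant Γ β)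
    (c : Fin (k + 1) → C4) :
    (fun z => trivialize (NilG.twD a b β) z c + structureTerm a b (trivialize β z) c)
      ∈ divSpace Γ := by
  have h1 : (fun z => trivialize (NilG.twD a b β) z c + structureTerm a b (trivialize β z) c)
      = ∑ i : Fin (k + 1), (((-1) ^ (i : ℕ) * a) •
          (fun z => fderiv ℝ (fun w => trivialize β w (i.removeNth c)) z (frame z (c i)))
        + ((-1) ^ (i : ℕ) * b) • (fun z =>
          fderiv ℝ (fun w => trivialize β w (i.removeNth c)) z (frame z (Complex.I • c i)))) := by
    funext z
    rw [trivialize_apply, twD_frame (hβ.differentiable (by simp) z), sub_add_cancel,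
      Finset.sum_apply]
    refine Finset.sum_congr rfl fun i _ => ?_
    simp
    ring
  rw [h1]
  refine Submodule.sum_mem _ fun i _ => Submodule.add_mem _ (Submodule.smul_mem _ _ ?_)
    (Submodule.smul_mem _ _ ?_)
  · exact Submodule.subset_span ⟨_, contDiff_trivialize hβ _, h.trivialize_periodic _, _, rfl⟩
  · exact Submodule.subset_span ⟨_, contDiff_trivialize hβ _, h.trivialize_periodic _, _, rfl⟩

/-! ### The algebraic part of the operators -/

/-- Vectors tangent to the centre. -/
def IsCentral (w : C4) : Prop := w 0 = 0 ∧ w 1 = 0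

theorem IsCentral.twist_left {w : C4} (hw : IsCentral w) (c : C4) : twist w c = 0 := by
  funext i; fin_cases i <;> simp [twist, hw.1, hw.2]

theorem IsCentral.twist_right {w : C4} (hw : IsCentral w) (c : C4) : twist c w = 0 := by
  funext i; fin_cases i <;> simp [twist, hw.1, hw.2]

theorem IsCentral.smul {w : C4} (hw : IsCentral w) (r : ℂ) : IsCentral (r • w) := by
  simp [IsCentral, hw.1, hw.2]

/-- A central vector can be contracted out of the algebraic part. -/
theorem structureTerm_cons (a b : ℂ) (B : C4 [⋀^Fin (k + 1)]→L[ℝ] ℂ) {w : C4} (hw : IsCentral w)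
    (c : Fin (k + 1) → C4) :
    structureTerm a b B (Matrix.vecCons w c) = -structureTerm a b (B.curryLeft w) c := by
  rw [structureTerm, Fin.sum_univ_succ]
  have h0 : ∀ (v : Fin (k + 1) → C4) l, B (Function.update v l 0) = 0 := fun v l =>
    B.map_coord_zero l (by simp)
  have h1 : ∀ l : Fin (k + 1), twist ((Matrix.vecCons w c : Fin (k + 2) → C4) 0)
      (Fin.removeNth 0 (Matrix.vecCons w c : Fin (k + 2) → C4) l) = 0 := fun l =>
    hw.twist_left _
  have h2 : ∀ l : Fin (k + 1), twist (Complex.I • (Matrix.vecCons w c : Fin (k + 2) → C4) 0)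
      (Fin.removeNth 0 (Matrix.vecCons w c : Fin (k + 2) → C4) l) = 0 := fun l =>
    (hw.smul _).twist_left _
  simp only [h1, h2, h0, mul_zero, add_zero, Finset.sum_const_zero, zero_add]
  rw [structureTerm, ← Finset.sum_neg_distrib]
  refine Finset.sum_congr rfl fun i _ => ?_
  have h3 : Fin.removeNth i.succ (Matrix.vecCons w c : Fin (k + 2) → C4)
      = Matrix.vecCons w (Fin.removeNth i c) := by
    funext l
    refine Fin.cases ?_ (fun l => ?_) l <;> simp [Fin.removeNth]
  have h4 : ∀ (v : Fin k → C4) (l : Fin k) (x : C4),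
      Function.update (Matrix.vecCons w v : Fin (k + 1) → C4) l.succ x
        = Matrix.vecCons w (Function.update v l x) := fun v l x =>
    (Fin.cons_update (α := fun _ => C4) w v l x).symm
  rw [h3, Fin.sum_univ_succ]
  simp only [Matrix.cons_val_zero, hw.twist_right, h0, mul_zero, add_zero, zero_add,
    Matrix.cons_val_succ, h4, Fin.val_succ, pow_succ]
  simp

/-- The standard basis vectors. -/
def e (j : Fin 4) : C4 := Pi.single j 1

/-- The vector `e₃ + e₄`, spanning the central direction killed by `φ₃ - φ₄`. -/
def eW : C4 := e 2 + e 3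

theorem isCentral_e_two : IsCentral (e 2) := by simp [IsCentral, e]
theorem isCentral_e_three : IsCentral (e 3) := by simp [IsCentral, e]
theorem isCentral_eW : IsCentral eW := by simp [IsCentral, e, eW]

theorem structureTerm_two (a b : ℂ) (L : C4 [⋀^Fin 1]→L[ℝ] ℂ) (x y : C4) :
    structureTerm a b L ![x, y] = a * L ![twist x y] + b * L ![twist (Complex.I • x) y]
      - (a * L ![twist y x] + b * L ![twist (Complex.I • y) x]) := by
  have h : ∀ (v : Fin 1 → C4) (w : C4), Function.update v 0 w = ![w] := by
    intro v w; funext i; fin_cases i; rfl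
  simp [structureTerm, Fin.sum_univ_succ, h, Fin.removeNth]
  ring

theorem twist_e_zero (x : C4) : twist (e 0) x = (-x 1) • eW + x 0 • e 2 := by
  funext i; fin_cases i <;> simp [twist, e, eW]
theorem twist_I_e_zero (x : C4) :
    twist (Complex.I • e 0) x = (-Complex.I * x 1) • eW + (-Complex.I * x 0) • e 2 := by
  funext i; fin_cases i <;> simp [twist, e, eW]
theorem twist_e_one (x : C4) : twist (e 1) x = x 1 • e 2 := by
  funext i; fin_cases i <;> simp [twist, e]
theorem twist_I_e_one (x : C4) : twist (Complex.I • e 1) x = (-Complex.I * x 1) • e 2 := by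
  funext i; fin_cases i <;> simp [twist, e]

theorem alternating_one_neg (L : C4 [⋀^Fin 1]→L[ℝ] ℂ) (x : C4) : L ![-x] = -L ![x] := by
  have := L.map_update_neg ![x] 0 x
  have h : ∀ (v : Fin 1 → C4) (w : C4), Function.update v 0 w = ![w] := by
    intro v w; funext i; fin_cases i; rfl
  simpa [h] using this

/-- On the complex line of `e₁` or `e₂`, the boundary is the multiple of `e₃` given by the term
`φ₁ ∧ conj φ₁ + φ₂ ∧ conj φ₂` of `∂̄φ₃`. -/
theorem structureTerm_plane (a b : ℂ) (L : C4 [⋀^Fin 1]→L[ℝ] ℂ) {j : Fin 4} (hj : j = 0 ∨ j = 1) :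
    structureTerm a b L ![e j, Complex.I • e j] =
      2 * a * L ![Complex.I • e 2] + 2 * b * L ![e 2] := by
  rw [structureTerm_two]
  have hII : Complex.I • Complex.I • e j = -e j := by rw [smul_smul, Complex.I_mul_I]; simp
  have hneg : twist (-e j) (e j) = -twist (e j) (e j) := by
    rw [← twistCLM_apply, map_neg]; rfl
  rw [hII, hneg]
  rcases hj with rfl | rfl
  · simp only [twist_e_zero, twist_I_e_zero]
    simp [e, eW, alternating_one_neg]
    ring
  · simp only [twist_e_one, twist_I_e_one]
    simp [e, alternating_one_neg]
    ring

end NilG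

namespace NilG

/-! ### Boundaries of special polyvectors -/

theorem structureTerm_four (a b : ℂ) (L : C4 [⋀^Fin 3]→L[ℝ] ℂ) (x y z w : C4) :
    structureTerm a b L ![x, y, z, w] =
      (a * L ![twist x y, z, w] + b * L ![twist (Complex.I • x) y, z, w]
        + (a * L ![y, twist x z, w] + b * L ![y, twist (Complex.I • x) z, w])
        + (a * L ![y, z, twist x w] + b * L ![y, z, twist (Complex.I • x) w]))
      - (a * L ![twist y x, z, w] + b * L ![twist (Complex.I • y) x, z, w]
        + (a * L ![x, twist y z, w] + b * L ![x, twist (Complex.I • y) z, w])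
        + (a * L ![x, z, twist y w] + b * L ![x, z, twist (Complex.I • y) w]))
      + (a * L ![twist z x, y, w] + b * L ![twist (Complex.I • z) x, y, w]
        + (a * L ![x, twist z y, w] + b * L ![x, twist (Complex.I • z) y, w])
        + (a * L ![x, y, twist z w] + b * L ![x, y, twist (Complex.I • z) w]))
      - (a * L ![twist w x, y, z] + b * L ![twist (Complex.I • w) x, y, z]
        + (a * L ![x, twist w y, z] + b * L ![x, twist (Complex.I • w) y, z])
        + (a * L ![x, y, twist w z] + b * L ![x, y, twist (Complex.I • w) z])) := by
  have h0 : ∀ p q r s : C4, Function.update ![p, q, r] 0 s = ![s, q, r] := by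
    intro p q r s; funext i; fin_cases i <;> rfl
  have h1 : ∀ p q r s : C4, Function.update ![p, q, r] 1 s = ![p, s, r] := by
    intro p q r s; funext i; fin_cases i <;> rfl
  have h2 : ∀ p q r s : C4, Function.update ![p, q, r] 2 s = ![p, q, s] := by
    intro p q r s; funext i; fin_cases i <;> rfl
  have r0 : Fin.removeNth 0 ![x, y, z, w] = ![y, z, w] := by
    funext i; fin_cases i <;> rfl
  have r1 : Fin.removeNth 1 ![x, y, z, w] = ![x, z, w] := by
    funext i; fin_cases i <;> rfl
  have r2 : Fin.removeNth 2 ![x, y, z, w] = ![x, y, w] := by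
    funext i; fin_cases i <;> rfl
  have r3 : Fin.removeNth 3 ![x, y, z, w] = ![x, y, z] := by
    funext i; fin_cases i <;> rfl
  rw [structureTerm, Fin.sum_univ_four]
  simp only [Fin.sum_univ_three]
  rw [r0, r1, r2, r3, h0, h1, h2, h0, h1, h2, h0, h1, h2, h0, h1, h2]
  simp only [h0, h1, h2, Matrix.cons_val_zero, Matrix.cons_val_one, Matrix.cons_val]
  norm_num
  ring

/-- On the plane of `e₁` and `e₂`, when `L` kills the line of `e₃ + e₄`: the terms `φ₁ ∧ φ₂` of
`dφ₃` and `dφ₄` give multiples of `e₃ + e₄`, and only those of `structureTerm_plane` are left. -/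
theorem structureTerm_planes (a b : ℂ) (L : C4 [⋀^Fin 3]→L[ℝ] ℂ)
    (hL : ∀ v i (r : ℂ), L (Function.update v i (r • eW)) = 0) :
    structureTerm a b L ![e 0, Complex.I • e 0, e 1, Complex.I • e 1] =
      2 * a * (L ![Complex.I • e 2, e 1, Complex.I • e 1]
        + L ![e 0, Complex.I • e 0, Complex.I • e 2])
      + 2 * b * (L ![e 2, e 1, Complex.I • e 1] + L ![e 0, Complex.I • e 0, e 2]) := by
  have h0 : ∀ p q r s : C4, Function.update ![p, q, r] 0 s = ![s, q, r] := by
    intro p q r s; funext i; fin_cases i <;> rfl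
  have h1 : ∀ p q r s : C4, Function.update ![p, q, r] 1 s = ![p, s, r] := by
    intro p q r s; funext i; fin_cases i <;> rfl
  have h2 : ∀ p q r s : C4, Function.update ![p, q, r] 2 s = ![p, q, s] := by
    intro p q r s; funext i; fin_cases i <;> rfl
  have hW0 : ∀ (r : ℂ) q s, L ![r • eW, q, s] = 0 := fun r q s => by
    rw [← h0 0 q s (r • eW)]; exact hL _ _ _
  have hW1 : ∀ (r : ℂ) q s, L ![q, r • eW, s] = 0 := fun r q s => by
    rw [← h1 q 0 s (r • eW)]; exact hL _ _ _
  have hW2 : ∀ (r : ℂ) q s, L ![q, s, r • eW] = 0 := fun r q s => by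
    rw [← h2 q s 0 (r • eW)]; exact hL _ _ _
  have hn0 : ∀ p q r, L ![-p, q, r] = -L ![p, q, r] := fun p q r => by
    have := L.map_update_neg ![p, q, r] 0 p
    simp only [h0] at this
    exact this
  have hn2 : ∀ p q r, L ![q, r, -p] = -L ![q, r, p] := fun p q r => by
    have := L.map_update_neg ![q, r, p] 2 p
    simp only [h2] at this
    exact this
  have hz0 : ∀ q r, L ![0, q, r] = 0 := fun q r => by simpa using hW0 0 q r
  have hz1 : ∀ q r, L ![q, 0, r] = 0 := fun q r => by simpa using hW1 0 q r
  have hz2 : ∀ q r, L ![q, r, 0] = 0 := fun q r => by simpa using hW2 0 q r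
  have hII : ∀ j, Complex.I • Complex.I • e j = -e j := fun j => by
    rw [smul_smul, Complex.I_mul_I]; simp
  have hneg : ∀ x y, twist (-x) y = -twist x y := fun x y => by
    rw [← twistCLM_apply, map_neg]; rfl
  have e01 : e 0 1 = 0 := by simp [e]
  have e00 : e 0 0 = 1 := by simp [e]
  have e10 : e 1 0 = 0 := by simp [e]
  have e11 : e 1 1 = 1 := by simp [e]
  have hV1 : ∀ q s, L ![q, eW, s] = 0 := fun q s => by simpa using hW1 1 q s
  have hV2 : ∀ q s, L ![q, s, eW] = 0 := fun q s => by simpa using hW2 1 q s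
  have hN1 : ∀ q s, L ![q, -eW, s] = 0 := fun q s => by simpa using hW1 (-1) q s
  have hNI1 : ∀ q s, L ![q, -(Complex.I • eW), s] = 0 := fun q s => by
    simpa using hW1 (-Complex.I) q s
  rw [structureTerm_four]
  simp only [hII, hneg, twist_e_zero, twist_I_e_zero, twist_e_one, twist_I_e_one, Pi.smul_apply,
    e00, e01, e10, e11, smul_eq_mul, mul_zero, mul_one, zero_smul, add_zero, zero_add,
    hW2, hz0, hz1, neg_zero, one_smul, neg_mul, neg_neg, Complex.I_mul_I, neg_smul,
    hn0, hn2, hV1, hV2, hN1, hNI1]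
  ring

theorem smul_eW (r : ℂ) : r • eW = r.re • eW + r.im • (Complex.I • eW) := by
  conv_lhs => rw [← Complex.re_add_im r, add_smul, mul_smul]
  rfl

/-- Contracting with `eW` and `i eW` kills the complex line of `eW`. -/
theorem curryLeft_eW_update (B : C4 [⋀^Fin 5]→L[ℝ] ℂ) (v : Fin 3 → C4) (i : Fin 3) (r : ℂ) :
    ((B.curryLeft eW).curryLeft (Complex.I • eW)) (Function.update v i (r • eW)) = 0 := by
  rw [smul_eW r]
  set C := (B.curryLeft eW).curryLeft (Complex.I • eW) with hC
  have h1 : ∀ w : Fin 3 → C4, w i = eW → C w = 0 := fun w hw =>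
    B.map_eq_zero_of_eq (Matrix.vecCons eW (Matrix.vecCons (Complex.I • eW) w))
      (i := 0) (j := i.succ.succ) hw.symm (Fin.succ_ne_zero _).symm
  have h2 : ∀ w : Fin 3 → C4, w i = Complex.I • eW → C w = 0 := fun w hw =>
    B.map_eq_zero_of_eq (Matrix.vecCons eW (Matrix.vecCons (Complex.I • eW) w))
      (i := 1) (j := i.succ.succ) hw.symm
      (by intro h; have := congrArg Fin.val h; simp at this)
  rw [C.map_update_add, C.map_update_smul, C.map_update_smul, h1 _ (by simp), h2 _ (by simp)]
  simp

/-- The boundary of `e₃ ∧ e₁ ∧ ie₁` is the complex line of `e₃`. -/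
theorem structureTerm_obstruction_one (a b : ℂ) (B : C4 [⋀^Fin 2]→L[ℝ] ℂ) :
    structureTerm a b B ![e 2, e 0, Complex.I • e 0] = -(2 * a * B ![e 2, Complex.I • e 2]) := by
  rw [structureTerm_cons _ _ _ isCentral_e_two, structureTerm_plane _ _ _ (Or.inl rfl)]
  have h0 : B ![e 2, e 2] = 0 := B.map_eq_zero_of_eq _ (i := 0) (j := 1) rfl (by decide)
  change -(2 * a * B ![e 2, Complex.I • e 2] + 2 * b * B ![e 2, e 2]) = _
  rw [h0, mul_zero, add_zero]

/-- The boundary of `e₃ ∧ W ∧ e₁ ∧ ie₁`, with `W` the line of `e₃ + e₄`, is the complex plane of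
`e₃` and `e₃ + e₄`. -/
theorem structureTerm_obstruction_two (a b : ℂ) (B : C4 [⋀^Fin 4]→L[ℝ] ℂ) :
    structureTerm a b B ![e 2, eW, Complex.I • eW, e 0, Complex.I • e 0] =
      2 * a * B ![e 2, eW, Complex.I • e 2, Complex.I • eW] := by
  rw [structureTerm_cons _ _ _ isCentral_e_two, structureTerm_cons _ _ _ isCentral_eW,
    structureTerm_cons _ _ _ (isCentral_eW.smul _), structureTerm_plane _ _ _ (Or.inl rfl)]
  have h0 : B ![e 2, eW, Complex.I • eW, e 2] = 0 :=
    B.map_eq_zero_of_eq _ (i := 0) (j := 3) rfl (by decide)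
  have h1 : B ![e 2, eW, Complex.I • eW, Complex.I • e 2]
      = -B ![e 2, eW, Complex.I • e 2, Complex.I • eW] := by
    refine Eq.trans ?_ (B.toAlternatingMap.map_swap _ (show (2 : Fin 4) ≠ 3 by decide))
    refine congrArg B ?_
    funext i; fin_cases i <;> rfl
  change -(-(-(2 * a * B ![e 2, eW, Complex.I • eW, Complex.I • e 2]
    + 2 * b * B ![e 2, eW, Complex.I • eW, e 2]))) = _
  rw [h0, h1]
  ring

/-- The boundary of `e₃ ∧ W ∧ e₁ ∧ ie₁ ∧ e₂ ∧ ie₂`, with `W` the line of `e₃ + e₄`, is the sum of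
the complex `3`-planes of `e₃, e₃ + e₄, e₁` and of `e₃, e₃ + e₄, e₂`. -/
theorem structureTerm_obstruction_three (a b : ℂ) (B : C4 [⋀^Fin 6]→L[ℝ] ℂ) :
    structureTerm a b B ![e 2, eW, Complex.I • eW, e 0, Complex.I • e 0, e 1, Complex.I • e 1] =
      2 * a * (B ![e 2, eW, e 0, Complex.I • e 2, Complex.I • eW, Complex.I • e 0]
        + B ![e 2, eW, e 1, Complex.I • e 2, Complex.I • eW, Complex.I • e 1]) := by
  rw [structureTerm_cons _ _ _ isCentral_e_two, structureTerm_cons _ _ _ isCentral_eW,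
    structureTerm_cons _ _ _ (isCentral_eW.smul _),
    structureTerm_planes _ _ _ (curryLeft_eW_update _)]
  have h0 : B ![e 2, eW, Complex.I • eW, e 2, e 1, Complex.I • e 1] = 0 :=
    B.map_eq_zero_of_eq _ (i := 0) (j := 3) rfl (by decide)
  have h0' : B ![e 2, eW, Complex.I • eW, e 0, Complex.I • e 0, e 2] = 0 :=
    B.map_eq_zero_of_eq _ (i := 0) (j := 5) rfl (by decide)
  have h1 : B ![e 2, eW, Complex.I • eW, Complex.I • e 2, e 1, Complex.I • e 1]
      = -B ![e 2, eW, e 1, Complex.I • e 2, Complex.I • eW, Complex.I • e 1] := by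
    refine Eq.trans ?_ (B.toAlternatingMap.map_swap _ (show (2 : Fin 6) ≠ 4 by decide))
    refine congrArg B ?_
    funext i; fin_cases i <;> rfl
  have h2 : B ![e 2, eW, Complex.I • eW, e 0, Complex.I • e 0, Complex.I • e 2]
      = -B ![e 2, eW, e 0, Complex.I • e 2, Complex.I • eW, Complex.I • e 0] := by
    have hs : (![e 2, eW, Complex.I • eW, e 0, Complex.I • e 0, Complex.I • e 2] : Fin 6 → C4)
        = ![e 2, eW, e 0, Complex.I • e 2, Complex.I • eW, Complex.I • e 0] ∘
          (Equiv.swap (2 : Fin 6) 3 * Equiv.swap (2 : Fin 6) 5 * Equiv.swap (2 : Fin 6) 4) := by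
      funext i; fin_cases i <;> rfl
    have hsign : Equiv.Perm.sign
        (Equiv.swap (2 : Fin 6) 3 * Equiv.swap (2 : Fin 6) 5 * Equiv.swap (2 : Fin 6) 4) = -1 := by
      decide
    rw [hs]
    refine (B.toAlternatingMap.map_perm _ _).trans ?_
    rw [hsign]
    simp
  change -(-(-(2 * a * (B ![e 2, eW, Complex.I • eW, Complex.I • e 2, e 1, Complex.I • e 1]
    + B ![e 2, eW, Complex.I • eW, e 0, Complex.I • e 0, Complex.I • e 2])
    + 2 * b * (B ![e 2, eW, Complex.I • eW, e 2, e 1, Complex.I • e 1]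
      + B ![e 2, eW, Complex.I • eW, e 0, Complex.I • e 0, e 2])))) = _
  rw [h0, h0', h1, h2]
  ring

end NilG

namespace NilG

/-! ### The obstructions -/

theorem add_mem_divSpace_of_eq {Γ : Subgroup NilG} {k : ℕ} {a b : ℂ}
    {β : C4 → C4 [⋀^Fin k]→L[ℝ] ℂ} (hβ : ContDiff ℝ ∞ β) (h : IsInvariant Γ β)
    (c : Fin (k + 1) → C4) {s : C4 → ℂ} (hs : ∀ z, structureTerm a b (trivialize β z) c = s z) :
    (fun z => trivialize (NilG.twD a b β) z c + s z) ∈ divSpace Γ := by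
  simpa only [hs] using twD_add_structureTerm_mem a b hβ h c

/-- The obstruction to `p`-symplectic and weakly `p`-Kähler forms on `G ⧸ Γ`: a polyvector `ξ` whose
boundary is, up to a factor, a sum of complex `p`-planes `T t`, such that on this sum all the
operators `twD a b` vanish up to divergences. The degrees `d` and `j + 1` are equal to `p + p` only
propositionally, since `∂̄α` is to be inserted for `β`. -/
def HasObstruction (Γ : Subgroup NilG) (p : ℕ) : Prop :=
  ∃ (m : ℕ) (T : Fin (m + 1) → Fin p → C4) (ξ : Fin (p + p + 1) → C4) (s : ℂ), s ≠ 0 ∧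
    (∀ t, LinearIndependent ℂ (T t)) ∧
    (∀ (d : ℕ) (h : d = p + p) (a b : ℂ) (β : C4 → C4 [⋀^Fin d]→L[ℝ] ℂ), ContDiff ℝ ∞ β →
      IsInvariant Γ β →
      (fun z => trivialize (twD a b β) z (fun i => ξ (Fin.cast (by rw [h]) i))
        + a * s * ∑ t, trivialize β z fun i => planeTuple (T t) (Fin.cast h i)) ∈ divSpace Γ) ∧
    (∀ (j : ℕ) (h : j + 1 = p + p) (a b : ℂ) (α : C4 → C4 [⋀^Fin j]→L[ℝ] ℂ), ContDiff ℝ ∞ α →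
      IsInvariant Γ α →
      (fun z => ∑ t, trivialize (twD a b α) z fun i => planeTuple (T t) (Fin.cast h i))
        ∈ divSpace Γ)

theorem planeTuple_one (v : C4) : planeTuple ![v] = ![v, Complex.I • v] := by
  funext i; fin_cases i <;> rfl

theorem planeTuple_two (v w : C4) :
    planeTuple ![v, w] = ![v, w, Complex.I • v, Complex.I • w] := by
  funext i; fin_cases i <;> rfl

theorem planeTuple_three (u v w : C4) :
    planeTuple ![u, v, w] = ![u, v, w, Complex.I • u, Complex.I • v, Complex.I • w] := by
  funext i; fin_cases i <;> rfl

theorem linearIndependent_one : LinearIndependent ℂ ![e 2] := by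
  rw [Fintype.linearIndependent_iff]
  intro g hg i
  have := congrFun hg 2
  fin_cases i
  simpa [e] using this

theorem linearIndependent_two : LinearIndependent ℂ ![e 2, eW] := by
  rw [Fintype.linearIndependent_iff]
  intro g hg i
  have h2 := congrFun hg 2
  have h3 := congrFun hg 3
  simp [e, eW, Fin.sum_univ_two] at h2 h3
  fin_cases i <;> simp_all

theorem linearIndependent_three {j : Fin 4} (hj : j = 0 ∨ j = 1) :
    LinearIndependent ℂ ![e 2, eW, e j] := by
  rw [Fintype.linearIndependent_iff]
  intro g hg i
  have h2 := congrFun hg 2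
  have h3 := congrFun hg 3
  have h0 := congrFun hg j
  rcases hj with rfl | rfl <;>
  · simp [e, eW, Fin.sum_univ_three] at h0 h2 h3
    fin_cases i <;> simp_all

theorem hasObstruction_one (Γ : Subgroup NilG) : HasObstruction Γ 1 := by
  refine ⟨0, ![![e 2]], ![e 2, e 0, Complex.I • e 0], -2, by norm_num, ?_, ?_, ?_⟩
  · intro t; fin_cases t; exact linearIndependent_one
  · intro d h a b β hβ hi
    subst h
    refine add_mem_divSpace_of_eq hβ hi _ fun z => ?_
    rw [Fin.sum_univ_one]
    refine (structureTerm_obstruction_one a b _).trans ?_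
    change _ = a * -2 * trivialize β z (planeTuple ![e 2])
    rw [planeTuple_one]
    ring
  · intro j h a b α hα hi
    obtain rfl : j = 1 := by omega
    have := add_mem_divSpace_of_eq (a := a) (b := b) hα hi ![e 2, Complex.I • e 2] (s := 0)
      fun z => by
        rw [structureTerm_cons _ _ _ isCentral_e_two]
        simp [structureTerm]
    refine cast (congrArg (· ∈ divSpace Γ) (funext fun z => ?_)) this
    rw [Fin.sum_univ_one]
    change _ = trivialize (twD a b α) z (planeTuple ![e 2])
    rw [planeTuple_one]
    simp

theorem hasObstruction_two (Γ : Subgroup NilG) : HasObstruction Γ 2 := by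
  refine ⟨0, ![![e 2, eW]], ![e 2, eW, Complex.I • eW, e 0, Complex.I • e 0], 2, by norm_num,
    ?_, ?_, ?_⟩
  · intro t; fin_cases t; exact linearIndependent_two
  · intro d h a b β hβ hi
    subst h
    refine add_mem_divSpace_of_eq hβ hi _ fun z => ?_
    rw [Fin.sum_univ_one]
    refine (structureTerm_obstruction_two a b _).trans ?_
    change _ = a * 2 * trivialize β z (planeTuple ![e 2, eW])
    rw [planeTuple_two]
    ring
  · intro j h a b α hα hi
    obtain rfl : j = 3 := by omega
    have := add_mem_divSpace_of_eq (a := a) (b := b) hα hi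
      ![e 2, eW, Complex.I • e 2, Complex.I • eW] (s := 0)
      fun z => by
        rw [structureTerm_cons _ _ _ isCentral_e_two, structureTerm_cons _ _ _ isCentral_eW,
          structureTerm_cons _ _ _ (isCentral_e_two.smul _)]
        simp [structureTerm]
    refine cast (congrArg (· ∈ divSpace Γ) (funext fun z => ?_)) this
    rw [Fin.sum_univ_one]
    change _ = trivialize (twD a b α) z (planeTuple ![e 2, eW])
    rw [planeTuple_two]
    simp

/-- On `e₃, e₃ + e₄` and a third vector `eⱼ` the algebraic part of the operators vanishes, as the
central directions are exhausted. -/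
theorem structureTerm_plane_three (a b : ℂ) (B : C4 [⋀^Fin 5]→L[ℝ] ℂ) {j : Fin 4}
    (hj : j = 0 ∨ j = 1) :
    structureTerm a b B ![e 2, eW, Complex.I • e 2, Complex.I • eW, e j, Complex.I • e j] = 0 := by
  rw [structureTerm_cons _ _ _ isCentral_e_two, structureTerm_cons _ _ _ isCentral_eW,
    structureTerm_cons _ _ _ (isCentral_e_two.smul _),
    structureTerm_cons _ _ _ (isCentral_eW.smul _), structureTerm_plane _ _ _ hj]
  have h1 : B ![e 2, eW, Complex.I • e 2, Complex.I • eW, e 2] = 0 :=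
    B.map_eq_zero_of_eq _ (i := 0) (j := 4) rfl (by decide)
  have h2 : B ![e 2, eW, Complex.I • e 2, Complex.I • eW, Complex.I • e 2] = 0 :=
    B.map_eq_zero_of_eq _ (i := 2) (j := 4) rfl (by decide)
  change - - - -(2 * a * B ![e 2, eW, Complex.I • e 2, Complex.I • eW, Complex.I • e 2]
    + 2 * b * B ![e 2, eW, Complex.I • e 2, Complex.I • eW, e 2]) = 0
  rw [h1, h2]
  simp

theorem planeTuple_three_perm (B : C4 [⋀^Fin 6]→L[ℝ] ℂ) (u v w : C4) :
    B (planeTuple ![u, v, w]) = B ![u, v, Complex.I • u, Complex.I • v, w, Complex.I • w] := by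
  have hs : planeTuple ![u, v, w]
      = ![u, v, Complex.I • u, Complex.I • v, w, Complex.I • w] ∘
        (Equiv.swap (2 : Fin 6) 3 * Equiv.swap (2 : Fin 6) 4) := by
    funext i; fin_cases i <;> rfl
  have hsign : Equiv.Perm.sign (Equiv.swap (2 : Fin 6) 3 * Equiv.swap (2 : Fin 6) 4) = 1 := by
    decide
  rw [hs]
  refine (B.toAlternatingMap.map_perm _ _).trans ?_
  rw [hsign, one_smul]
  rfl

theorem hasObstruction_three (Γ : Subgroup NilG) : HasObstruction Γ 3 := by
  refine ⟨1, ![![e 2, eW, e 0], ![e 2, eW, e 1]],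
    ![e 2, eW, Complex.I • eW, e 0, Complex.I • e 0, e 1, Complex.I • e 1], 2, by norm_num,
    ?_, ?_, ?_⟩
  · intro t
    fin_cases t
    · exact linearIndependent_three (Or.inl rfl)
    · exact linearIndependent_three (Or.inr rfl)
  · intro d h a b β hβ hi
    subst h
    refine add_mem_divSpace_of_eq hβ hi _ fun z => ?_
    rw [Fin.sum_univ_two]
    refine (structureTerm_obstruction_three a b _).trans ?_
    change _ = a * 2 * (trivialize β z (planeTuple ![e 2, eW, e 0])
      + trivialize β z (planeTuple ![e 2, eW, e 1]))
    rw [planeTuple_three, planeTuple_three]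
    ring
  · intro j h a b α hα hi
    obtain rfl : j = 5 := by omega
    have key : ∀ j : Fin 4, j = 0 ∨ j = 1 →
        (fun z => trivialize (twD a b α) z (planeTuple ![e 2, eW, e j])) ∈ divSpace Γ := by
      intro j hj
      have := add_mem_divSpace_of_eq (a := a) (b := b) hα hi
        ![e 2, eW, Complex.I • e 2, Complex.I • eW, e j, Complex.I • e j] (s := 0)
        fun z => structureTerm_plane_three a b _ hj
      refine cast (congrArg (· ∈ divSpace Γ) (funext fun z => ?_)) this
      rw [planeTuple_three_perm]
      simp
    refine cast (congrArg (· ∈ divSpace Γ) (funext fun z => ?_))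
      (Submodule.add_mem _ (key 0 (Or.inl rfl)) (key 1 (Or.inr rfl)))
    rw [Fin.sum_univ_two]
    rfl

theorem hasObstruction (Γ : Subgroup NilG) {p : ℕ} (h1 : 1 ≤ p) (h3 : p ≤ 3) :
    HasObstruction Γ p := by
  interval_cases p
  exacts [hasObstruction_one Γ, hasObstruction_two Γ, hasObstruction_three Γ]

/-- The obstruction to `2`-pluriclosed forms: on the polyvector `W ∧ e₁ ∧ ie₁ ∧ e₂ ∧ ie₂`, with
`W` the line of `e₃ + e₄`, a second derivative of a periodic `4`-form is, up to divergences, a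
multiple of its value on the plane of the central vectors. Taking the boundary twice removes one
of the lines of `e₁`, `e₂` at each step. -/
theorem twD_twD_mem_divSpace {Γ : Subgroup NilG} (a b a' b' : ℂ)
    {β : C4 → C4 [⋀^Fin 4]→L[ℝ] ℂ} (hβ : ContDiff ℝ ∞ β) (h : IsInvariant Γ β) :
    (fun z => trivialize (twD a b (twD a' b' β)) z
        ![eW, Complex.I • eW, e 0, Complex.I • e 0, e 1, Complex.I • e 1]
      + 8 * (a * b' - b * a') * trivialize β z ![e 2, eW, Complex.I • e 2, Complex.I • eW])
      ∈ divSpace Γ := by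
  set C := twD a' b' β with hC
  have hCs : ContDiff ℝ ∞ C := contDiff_twD hβ
  have hCi : IsInvariant Γ C := h.twD hβ
  -- first derivative
  have h1 := twD_add_structureTerm_mem a b hCs hCi
    ![eW, Complex.I • eW, e 0, Complex.I • e 0, e 1, Complex.I • e 1]
  -- second derivative, on the tuples with one noncentral plane left
  have h2 : ∀ (r : ℂ) (j : Fin 4), j = 0 ∨ j = 1 →
      (fun z => trivialize C z ![eW, Complex.I • eW, r • e 2, e j, Complex.I • e j]
        - (2 * a' * trivialize β z ![eW, Complex.I • eW, r • e 2, Complex.I • e 2]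
          + 2 * b' * trivialize β z ![eW, Complex.I • eW, r • e 2, e 2])) ∈ divSpace Γ := by
    intro r j hj
    simp only [sub_eq_add_neg]
    refine add_mem_divSpace_of_eq hβ h _ fun z => ?_
    rw [structureTerm_cons _ _ _ isCentral_eW, structureTerm_cons _ _ _ (isCentral_eW.smul _),
      structureTerm_cons _ _ _ (isCentral_e_two.smul _), structureTerm_plane _ _ _ hj, neg_neg]
    rfl
  have key : ∀ L : C4 [⋀^Fin 5]→L[ℝ] ℂ,
      L ![eW, Complex.I • eW, e 0, Complex.I • e 0, Complex.I • e 2]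
        = L ![eW, Complex.I • eW, Complex.I • e 2, e 0, Complex.I • e 0] ∧
      L ![eW, Complex.I • eW, e 0, Complex.I • e 0, e 2]
        = L ![eW, Complex.I • eW, (1 : ℂ) • e 2, e 0, Complex.I • e 0] := by
    intro L
    have hp : ∀ x, L ![eW, Complex.I • eW, e 0, Complex.I • e 0, x]
        = L ![eW, Complex.I • eW, x, e 0, Complex.I • e 0] := fun x => by
      have hs : ![eW, Complex.I • eW, e 0, Complex.I • e 0, x]
          = ![eW, Complex.I • eW, x, e 0, Complex.I • e 0] ∘
            (Equiv.swap (2 : Fin 5) 4 * Equiv.swap (2 : Fin 5) 3) := by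
        funext i; fin_cases i <;> rfl
      have hsign : Equiv.Perm.sign (Equiv.swap (2 : Fin 5) 4 * Equiv.swap (2 : Fin 5) 3) = 1 := by
        decide
      rw [hs]
      refine (L.toAlternatingMap.map_perm _ _).trans ?_
      rw [hsign, one_smul]
      rfl
    exact ⟨hp _, by rw [one_smul]; exact hp _⟩
  have hst : ∀ L : C4 [⋀^Fin 5]→L[ℝ] ℂ, structureTerm a b L
      ![eW, Complex.I • eW, e 0, Complex.I • e 0, e 1, Complex.I • e 1] =
      2 * a * (L ![eW, Complex.I • eW, Complex.I • e 2, e 1, Complex.I • e 1]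
        + L ![eW, Complex.I • eW, Complex.I • e 2, e 0, Complex.I • e 0])
      + 2 * b * (L ![eW, Complex.I • eW, (1 : ℂ) • e 2, e 1, Complex.I • e 1]
        + L ![eW, Complex.I • eW, (1 : ℂ) • e 2, e 0, Complex.I • e 0]) := by
    intro L
    rw [structureTerm_cons _ _ _ isCentral_eW, structureTerm_cons _ _ _ (isCentral_eW.smul _),
      structureTerm_planes _ _ _ (curryLeft_eW_update L), neg_neg, ← (key L).1, ← (key L).2,
      one_smul]
    rfl
  -- the values of `β` that remain
  have hβ0 : ∀ (L : C4 [⋀^Fin 4]→L[ℝ] ℂ) (r : ℂ), L ![eW, Complex.I • eW, r • e 2, r • e 2] = 0 :=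
    fun L r => L.map_eq_zero_of_eq _ (i := 2) (j := 3) rfl (by decide)
  have hβ1 : ∀ L : C4 [⋀^Fin 4]→L[ℝ] ℂ, L ![eW, Complex.I • eW, Complex.I • e 2, e 2]
      = L ![e 2, eW, Complex.I • e 2, Complex.I • eW] := by
    intro L
    have hs : ![eW, Complex.I • eW, Complex.I • e 2, e 2]
        = ![e 2, eW, Complex.I • e 2, Complex.I • eW] ∘
          (Equiv.swap (0 : Fin 4) 1 * Equiv.swap (1 : Fin 4) 3) := by
      funext i; fin_cases i <;> rfl
    have hsign : Equiv.Perm.sign (Equiv.swap (0 : Fin 4) 1 * Equiv.swap (1 : Fin 4) 3) = 1 := by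
      decide
    rw [hs]
    refine (L.toAlternatingMap.map_perm _ _).trans ?_
    rw [hsign, one_smul]
    rfl
  have hβ2 : ∀ L : C4 [⋀^Fin 4]→L[ℝ] ℂ, L ![eW, Complex.I • eW, (1 : ℂ) • e 2, Complex.I • e 2]
      = -L ![e 2, eW, Complex.I • e 2, Complex.I • eW] := by
    intro L
    rw [← hβ1, one_smul]
    refine Eq.trans ?_ (L.toAlternatingMap.map_swap _ (show (2 : Fin 4) ≠ 3 by decide))
    refine congrArg L ?_
    funext i; fin_cases i <;> rfl
  have hI := Submodule.smul_mem _ (2 * a) (Submodule.add_mem _ (h2 Complex.I 1 (Or.inr rfl))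
    (h2 Complex.I 0 (Or.inl rfl)))
  have hO := Submodule.smul_mem _ (2 * b) (Submodule.add_mem _ (h2 1 1 (Or.inr rfl))
    (h2 1 0 (Or.inl rfl)))
  refine cast (congrArg (· ∈ divSpace Γ) (funext fun z => ?_))
    (Submodule.sub_mem _ (Submodule.sub_mem _ h1 hI) hO)
  have hβ3 := hβ0 (trivialize β z) 1
  simp only [Pi.sub_apply, Pi.add_apply, Pi.smul_apply, smul_eq_mul, hst, hβ0, hβ1, hβ2]
  rw [one_smul] at hβ3 ⊢
  rw [hβ3]
  ring

end NilG

/-! ### Structure equations of the invariant coframe -/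

section

variable {V W : Type*} [AddCommGroup V] [Module ℂ V] [TopologicalSpace V]
  [AddCommGroup W] [Module ℂ W] [TopologicalSpace W]

theorem wedge_compContinuousLinearMap {k l : ℕ} (α : V [⋀^Fin k]→L[ℝ] ℂ)
    (β : V [⋀^Fin l]→L[ℝ] ℂ) (f : W →L[ℝ] V) :
    wedge (α.compContinuousLinearMap f) (β.compContinuousLinearMap f)
      = (wedge α β).compContinuousLinearMap f := by
  ext v
  change _ = wedge α β (f ∘ v)
  rw [wedge_apply, wedge_apply, AlternatingMap.domCoprod_apply, AlternatingMap.domCoprod_apply,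
    sum_apply, sum_apply]
  congr 1
  refine Finset.sum_congr rfl fun s _ => ?_
  induction s using Quotient.inductionOn' with
  | h s => rfl

end

namespace NilG

/-- The value of the coframe at the identity: the coordinate functionals. -/
def coord (j : Fin 4) : C4 [⋀^Fin 1]→L[ℝ] ℂ :=
  oneForm ((ContinuousLinearMap.proj j : C4 →L[ℂ] ℂ).restrictScalars ℝ)

theorem coord_apply (j : Fin 4) (v : Fin 1 → C4) : coord j v = v 0 j := rfl

theorem wedge_coord_apply (i j : Fin 4) (v : Fin 2 → C4) :
    wedge (coord i) (coord j) v = v 0 i * v 1 j - v 1 i * v 0 j :=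
  wedge_oneForm_oneForm_apply _ _ v

theorem wedge_coord_conjForm_apply (i j : Fin 4) (v : Fin 2 → C4) :
    wedge (coord i) (conjForm (coord j)) v
      = v 0 i * starRingEnd ℂ (v 1 j) - v 1 i * starRingEnd ℂ (v 0 j) :=
  wedge_oneForm_oneForm_apply _
    ((Complex.conjCLE : ℂ →L[ℝ] ℂ).comp
      ((ContinuousLinearMap.proj j : C4 →L[ℂ] ℂ).restrictScalars ℝ)) v

theorem twD_invForm_eq_of {k : ℕ} {a b : ℂ} {B : C4 [⋀^Fin k]→L[ℝ] ℂ}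
    {C : C4 [⋀^Fin (k + 1)]→L[ℝ] ℂ} (h : ∀ c, structureTerm a b B c = -C c) :
    twD a b (invForm B) = invForm C := by
  funext z
  refine eq_of_frame z fun c => ?_
  rw [twD_invForm, invForm_frame, h, neg_neg]

theorem structureTerm_coord (a b : ℂ) (j : Fin 4) (c : Fin 2 → C4) :
    structureTerm a b (coord j) c = a * twist (c 0) (c 1) j + b * twist (Complex.I • c 0) (c 1) j
      - (a * twist (c 1) (c 0) j + b * twist (Complex.I • c 1) (c 0) j) := by
  have hc : c = ![c 0, c 1] := by funext i; fin_cases i <;> rfl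
  conv_lhs => rw [hc, structureTerm_two]
  rfl

theorem twD_invForm_coord_of_lt (a b : ℂ) {j : Fin 4} (hj : j = 0 ∨ j = 1) :
    twD a b (invForm (coord j)) = 0 := by
  refine (twD_invForm_eq_of (C := 0) fun c => ?_).trans ?_
  · rw [structureTerm_coord]
    rcases hj with rfl | rfl <;> simp [twist]
  · funext z; ext v; rfl

theorem twD_del_coord {j : Fin 4} (hj : j = 2 ∨ j = 3) :
    twD (1 / 2) (-Complex.I / 2) (invForm (coord j)) = invForm (wedge (coord 0) (coord 1)) := by
  refine twD_invForm_eq_of fun c => ?_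
  rw [structureTerm_coord, wedge_coord_apply]
  have hI := Complex.I_sq
  rcases hj with rfl | rfl <;> simp [twist] <;> ring_nf <;> simp only [Complex.I_sq] <;> ring

theorem twD_delbar_coord_two :
    twD (1 / 2) (Complex.I / 2) (invForm (coord 2)) =
      invForm (wedge (coord 0) (conjForm (coord 0)) + wedge (coord 1) (conjForm (coord 1))) := by
  refine twD_invForm_eq_of fun c => ?_
  rw [structureTerm_coord, ContinuousAlternatingMap.add_apply, wedge_coord_conjForm_apply,
    wedge_coord_conjForm_apply]
  simp [twist]; ring_nf; simp only [Complex.I_sq]; ring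

theorem twD_delbar_coord_three :
    twD (1 / 2) (Complex.I / 2) (invForm (coord 3)) = 0 := by
  refine (twD_invForm_eq_of (C := 0) fun c => ?_).trans ?_
  · rw [structureTerm_coord]
    simp [twist]; ring_nf; simp only [Complex.I_sq]; ring
  · funext z; ext v; rfl

theorem finrank_C4 : Module.finrank ℂ C4 = 4 := by simp

/-! ### The SKT form -/

/-- The value `σ₁ ∑ⱼ φⱼ ∧ conj φⱼ` of the SKT form at the identity. -/
def sktValue : C4 [⋀^Fin 2]→L[ℝ] ℂ :=
  sigmaConst 1 • ∑ j, wedge (coord j) (conjForm (coord j))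

theorem sktValue_apply (v : Fin 2 → C4) :
    sktValue v = Complex.I / 2 *
      ∑ j, (v 0 j * starRingEnd ℂ (v 1 j) - v 1 j * starRingEnd ℂ (v 0 j)) := by
  rw [sktValue, ContinuousAlternatingMap.smul_apply, ContinuousAlternatingMap.sum_apply]
  simp only [wedge_coord_conjForm_apply]
  simp [sigmaConst]

theorem isTransverseAt_sktValue : IsTransverseAt 1 sktValue := by
  refine isTransverseAt_of_pos (k := 3) finrank_C4 (fun c v => ?_) ?_ fun v hv => ?_
  · rw [sktValue_apply, sktValue_apply]
    simp [Fin.sum_univ_four]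
    ring
  · ext v
    rw [conjForm_apply, sktValue_apply]
    simp [Fin.sum_univ_four, map_ofNat]
    ring
  · have h0 : v 0 ≠ 0 := hv.ne_zero 0
    obtain ⟨i, hi⟩ : ∃ i, v 0 i ≠ 0 := by
      by_contra hcon
      push Not at hcon
      exact h0 (funext hcon)
    refine ⟨∑ j, Complex.normSq (v 0 j), ?_, ?_⟩
    · exact Finset.sum_pos' (fun j _ => Complex.normSq_nonneg _)
        ⟨i, Finset.mem_univ _, Complex.normSq_pos.2 hi⟩
    · rw [sktValue_apply, transverseConst_one_three, mul_one]
      have e0 : planeTuple v 0 = v 0 := planeTuple_castAdd v 0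
      have e1 : planeTuple v 1 = Complex.I • v 0 := planeTuple_natAdd v 0
      rw [e0, e1]
      push_cast
      rw [Finset.mul_sum]
      refine Finset.sum_congr rfl fun j _ => ?_
      rw [Complex.normSq_eq_conj_mul_self]
      simp
      ring_nf
      simp only [Complex.I_sq]
      ring

/-- The differential `∂̄` of the SKT form, with one central argument. -/
theorem structureTerm_sktValue {t : C4} (ht : IsCentral t) (y z : C4) :
    structureTerm (1 / 2) (Complex.I / 2) sktValue ![t, y, z] = -(Complex.I / 2 *
      ((y 0 * starRingEnd ℂ (z 0) - z 0 * starRingEnd ℂ (y 0)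
        + (y 1 * starRingEnd ℂ (z 1) - z 1 * starRingEnd ℂ (y 1))) * starRingEnd ℂ (t 2)
      - (t 2 + t 3) * (starRingEnd ℂ (y 0 * z 1) - starRingEnd ℂ (z 0 * y 1)))) := by
  rw [structureTerm_cons _ _ _ ht, structureTerm_two]
  change -(1 / 2 * sktValue ![t, _] + _ * sktValue ![t, _]
    - (1 / 2 * sktValue ![t, _] + _ * sktValue ![t, _])) = _
  simp only [sktValue_apply, Fin.sum_univ_four]
  simp [twist, ht.1, ht.2]
  ring_nf
  simp only [Complex.I_pow_three]
  ring

theorem isCentral_twist (u c : C4) : IsCentral (twist u c) := ⟨rfl, rfl⟩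

theorem twD_twD_sktValue :
    twD (1 / 2) (-Complex.I / 2) (twD (1 / 2) (Complex.I / 2) (invForm sktValue)) = 0 := by
  rw [twD_invForm_eq]
  set C := twD (1 / 2) (Complex.I / 2) (invForm sktValue) 0 with hC
  have hCv : ∀ c, C c = -structureTerm (1 / 2) (Complex.I / 2) sktValue c := by
    intro c
    have h0 : ∀ c, frame 0 c = c := fun c => by rw [frame_apply, ← twistCLM_apply]; simp
    have := twD_invForm (1 / 2) (Complex.I / 2) sktValue 0 c
    simpa only [h0] using this
  have h1 : ∀ {t}, IsCentral t → ∀ y z, C ![t, y, z] = Complex.I / 2 *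
      ((y 0 * starRingEnd ℂ (z 0) - z 0 * starRingEnd ℂ (y 0)
        + (y 1 * starRingEnd ℂ (z 1) - z 1 * starRingEnd ℂ (y 1))) * starRingEnd ℂ (t 2)
      - (t 2 + t 3) * (starRingEnd ℂ (y 0 * z 1) - starRingEnd ℂ (z 0 * y 1))) :=
    fun ht y z => by rw [hCv, structureTerm_sktValue ht, neg_neg]
  have h2 : ∀ x y z, C ![x, y, z] = -C ![y, x, z] := fun x y z => by
    refine Eq.trans ?_ (C.toAlternatingMap.map_swap _ (show (0 : Fin 3) ≠ 1 by decide))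
    refine congrArg C ?_
    funext i; fin_cases i <;> rfl
  have h3 : ∀ x y z, C ![x, y, z] = C ![z, x, y] := fun x y z => by
    rw [h2 z x y]
    refine Eq.trans ?_ (C.toAlternatingMap.map_swap _ (show (1 : Fin 3) ≠ 2 by decide))
    refine congrArg C ?_
    funext i; fin_cases i <;> rfl
  refine (twD_invForm_eq_of (C := 0) fun c => ?_).trans (by funext z; ext v; rfl)
  have hc : c = ![c 0, c 1, c 2, c 3] := by funext i; fin_cases i <;> rfl
  rw [hc, structureTerm_four]
  have k1 : ∀ u x y z, C ![twist u x, y, z] = _ := fun u x => h1 (isCentral_twist u x)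
  have k2 : ∀ u x y z, C ![y, twist u x, z] = _ := fun u x y z =>
    (h2 _ _ _).trans (congrArg Neg.neg (k1 u x y z))
  have k3 : ∀ u x y z, C ![y, z, twist u x] = _ := fun u x y z =>
    (h3 _ _ _).trans (k1 u x y z)
  simp only [k1, k2, k3]
  simp [twist]
  ring_nf


/-! ### The `3`-pluriclosed form -/

theorem linearIndependent_top : LinearIndependent ℝ ![e 2, Complex.I • e 2, e 3, Complex.I • e 3,
    e 0, Complex.I • e 0, e 1, Complex.I • e 1] := by
  rw [Fintype.linearIndependent_iff]
  intro g hg i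
  have h : ∀ j, _ := fun j => congrFun hg j
  have h0 := h 0
  have h1 := h 1
  have h2 := h 2
  have h3 := h 3
  simp [Fin.sum_univ_eight, e, Complex.ext_iff] at h0 h1 h2 h3
  fin_cases i <;> simp_all

/-- On invariant forms of codegree one the operators vanish: the top degree form is evaluated on a
basis starting with the central directions, and the boundary of the rest is central. -/
theorem twD_invForm_seven (a b : ℂ) (B : C4 [⋀^Fin 7]→L[ℝ] ℂ) : twD a b (invForm B) = 0 := by
  have h0 : ∀ c, frame 0 c = c := fun c => by rw [frame_apply, ← twistCLM_apply]; simp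
  have h1 := twD_invForm a b B 0
  simp only [h0] at h1
  have h2 : (twD a b (invForm B) 0).toAlternatingMap = 0 := by
    refine AlternatingMap.eq_of_apply_eq_of_top (by rw [finrank_C4]) linearIndependent_top ?_
    refine (h1 _).trans ?_
    rw [structureTerm_cons _ _ _ isCentral_e_two,
      structureTerm_cons _ _ _ (isCentral_e_two.smul _), structureTerm_cons _ _ _ isCentral_e_three,
      structureTerm_cons _ _ _ (isCentral_e_three.smul _)]
    set L := (((B.curryLeft (e 2)).curryLeft (Complex.I • e 2)).curryLeft (e 3)).curryLeft
      (Complex.I • e 3) with hL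
    have hk : ∀ (w : Fin 3 → C4) (i : Fin 3), w i = e 2 ∨ w i = Complex.I • e 2 ∨ w i = e 3 ∨
        w i = Complex.I • e 3 → L w = 0 := by
      intro w i hw
      have key : ∀ j : Fin 7, (j : ℕ) < 4 → (Matrix.vecCons (e 2) (Matrix.vecCons (Complex.I • e 2)
          (Matrix.vecCons (e 3) (Matrix.vecCons (Complex.I • e 3) w))) : Fin 7 → C4) j = w i →
          L w = 0 := fun j hj h =>
        B.map_eq_zero_of_eq _ (i := j) (j := i.succ.succ.succ.succ) h
          (by rintro rfl; simp at hj; omega)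
      rcases hw with hw | hw | hw | hw
      exacts [key 0 (by decide) hw.symm, key 1 (by decide) hw.symm, key 2 (by decide) hw.symm,
        key 3 (by decide) hw.symm]
    -- the twisted arguments are central, hence combinations of the contracted vectors
    have hL0 : ∀ (v : Fin 3 → C4) (i : Fin 3) (t : C4), IsCentral t →
        L (Function.update v i t) = 0 := by
      intro v i t ht
      have htt : t = (t 2).re • e 2 + (t 2).im • (Complex.I • e 2)
          + ((t 3).re • e 3 + (t 3).im • (Complex.I • e 3)) := by
        funext j
        fin_cases j <;> simp [e, ht.1, ht.2, Complex.re_add_im]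
      rw [htt]
      simp only [L.map_update_add, L.map_update_smul]
      rw [hk (Function.update v i (e 2)) i (by simp),
        hk (Function.update v i (Complex.I • e 2)) i (by simp),
        hk (Function.update v i (e 3)) i (by simp),
        hk (Function.update v i (Complex.I • e 3)) i (by simp)]
      simp
    have hz : ∀ c, structureTerm a b L c = 0 := fun c => by
      simp [structureTerm, hL0 _ _ _ (isCentral_twist _ _)]
    rw [hz]
    simp
  rw [twD_invForm_eq]
  have h3 : twD a b (invForm B) 0 = 0 := by
    ext v; exact DFunLike.congr_fun h2 v
  rw [h3]
  funext z; ext v; rfl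

/-- The value `∑ⱼ σ₃ φ_J ∧ conj φ_J`, `J` the complement of `j`, of the `3`-pluriclosed form at the
identity. -/
def threeValue : C4 [⋀^Fin (3 + 3)]→L[ℝ] ℂ :=
  ∑ j : Fin 4, simplePositive fun i : Fin 3 =>
    (ContinuousLinearMap.proj (j.succAbove i) : C4 →L[ℂ] ℂ)

theorem isTransverseAt_threeValue : IsTransverseAt 3 threeValue := by
  refine isTransverseAt_of_pos (p := 3) (k := 1) (finrank_C4.trans (by norm_num))
    (fun c v => ?_) ?_ fun v hv => ?_
  · rw [threeValue, ContinuousAlternatingMap.sum_apply, ContinuousAlternatingMap.sum_apply,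
      Finset.mul_sum]
    refine Finset.sum_congr rfl fun j _ => ?_
    have h := hasType_simplePositive (V := C4) (k := 3)
      (fun i => ContinuousLinearMap.proj (j.succAbove i))
    rw [h c v]
  · ext v
    rw [conjForm_apply, threeValue, ContinuousAlternatingMap.sum_apply, map_sum]
    refine Finset.sum_congr rfl fun j _ => ?_
    rw [← conjForm_apply, isRealForm_simplePositive_three]
  · -- completing `v` to a basis and expanding its determinant, some `3 × 3` minor of `v` is nonzero
    have h4 : 3 < Module.finrank ℂ C4 := by rw [finrank_C4]; norm_num
    obtain ⟨x, hx⟩ := exists_linearIndependent_cons_of_lt_finrank hv h4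
    set A : Matrix (Fin 4) (Fin 4) ℂ := Matrix.of (Fin.cons x v : Fin 4 → C4) with hA
    have hdet : A.det ≠ 0 :=
      ((Matrix.isUnit_iff_isUnit_det A).1 (Matrix.linearIndependent_rows_iff_isUnit.1 hx)).ne_zero
    rw [Matrix.det_succ_row_zero] at hdet
    obtain ⟨j, -, hj⟩ := Finset.exists_ne_zero_of_sum_ne_zero hdet
    have hm : ∀ j : Fin 4, (Matrix.of fun i k : Fin 3 => v k (j.succAbove i)).det
        = (A.submatrix Fin.succ j.succAbove).det := fun j => by
      rw [← Matrix.det_transpose]; rfl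
    refine ⟨∑ j : Fin 4, Complex.normSq (A.submatrix Fin.succ j.succAbove).det, ?_, ?_⟩
    · exact Finset.sum_pos' (fun j _ => Complex.normSq_nonneg _)
        ⟨j, Finset.mem_univ _, Complex.normSq_pos.2 (right_ne_zero_of_mul hj)⟩
    · rw [threeValue, ContinuousAlternatingMap.sum_apply, transverseConst_three_one]
      push_cast
      rw [Finset.sum_mul]
      refine Finset.sum_congr rfl fun j _ => ?_
      rw [simplePositive_planeTuple, planeConst_three, ← hm, mul_comm]
      rfl

end NilG

namespace NilG

/-! ### The projection to the quotient in charts -/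

theorem hasFDerivAt_mulFun_complex (a z : C4) :
    ∃ A : C4 →L[ℂ] C4, HasFDerivAt (fun z => mulFun z a) A z ∧ ∀ c, A c = frame a c := by
  have h := ((contDiff_mul_right a (n := 1)).differentiable (by simp) z).hasFDerivAt
  refine ⟨_, h, fun c => ?_⟩
  exact DFunLike.congr_fun ((h.restrictScalars ℝ).unique (hasFDerivAt_mulFun a z)) c

variable (Γ : Subgroup NilG)

/-- The projection `ℂ⁴ → G ⧸ Γ`. -/
def quotMap (z : C4) : NilG ⧸ Γ := QuotientGroup.mk (α := NilG) z

theorem quotMap_surjective : Function.Surjective (quotMap Γ) := fun x =>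
  QuotientGroup.mk_surjective (α := NilG) x

theorem quotMap_mulFun {γ : NilG} (hγ : γ ∈ Γ) :
    (quotMap Γ ∘ fun z => mulFun z γ.toVec) = quotMap Γ :=
  funext fun z => QuotientGroup.mk_mul_of_mem (α := NilG) z hγ

variable [IsLattice Γ]

theorem chartAt_symm (x : NilG ⧸ Γ) :
    ((chartAt C4 x).symm : C4 → NilG ⧸ Γ) = quotMap Γ := quotChart_symm Γ x

theorem quotMap_chartAt (x : NilG ⧸ Γ) : quotMap Γ (chartAt C4 x x) = x := by
  rw [← chartAt_symm Γ x]
  exact (chartAt C4 x).left_inv (mem_chart_source C4 x)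

/-- In charts the projection is a right translation by an element of `Γ`. -/
theorem exists_chartAt_quotMap (z : C4) :
    ∃ γ : NilG, γ ∈ Γ ∧ mulFun z γ.toVec ∈ (chartAt C4 (quotMap Γ z)).target ∧
      ∀ᶠ y in nhds z, chartAt C4 (quotMap Γ z) (quotMap Γ y) = mulFun y γ.toVec := by
  set x := quotMap Γ z with hx
  set w : NilG := chartAt C4 x x with hw
  have hwt : w ∈ (chartAt C4 x).target := mem_chart_target C4 x
  set γ : NilG := (show NilG from z)⁻¹ * w with hγ
  have hzw : mulFun z γ.toVec = w := mul_inv_cancel_left (G := NilG) z w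
  have hγΓ : γ ∈ Γ := QuotientGroup.eq.1 (quotMap_chartAt Γ x).symm
  refine ⟨γ, hγΓ, hzw ▸ hwt, ?_⟩
  have hev : ∀ᶠ y in nhds z, mulFun y γ.toVec ∈ (chartAt C4 x).target :=
    (contDiff_mul_right γ.toVec (n := 0)).continuous.continuousAt.eventually_mem
      ((chartAt C4 x).open_target.mem_nhds (hzw ▸ hwt))
  filter_upwards [hev] with y hy
  have h1 := (chartAt C4 x).right_inv hy
  rw [chartAt_symm] at h1
  rw [← h1]
  congr 1
  exact (congrFun (quotMap_mulFun Γ hγΓ) y).symm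

theorem isLocalDiffeomorph_quotMap :
    IsLocalDiffeomorph 𝓘(ℂ, C4) 𝓘(ℂ, C4) ω (quotMap Γ) := by
  intro z
  obtain ⟨γ, hγ, ht, -⟩ := exists_chartAt_quotMap Γ z
  let R : Diffeomorph 𝓘(ℂ, C4) 𝓘(ℂ, C4) C4 C4 ω :=
    { toFun := fun z => mulFun z γ.toVec
      invFun := fun z => mulFun z (γ⁻¹).toVec
      left_inv := fun z => mul_inv_cancel_right (G := NilG) z γ
      right_inv := fun z => inv_mul_cancel_right (G := NilG) z γ
      contMDiff_toFun := (contDiff_mul_right γ.toVec).contMDiff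
      contMDiff_invFun := (contDiff_mul_right (γ⁻¹).toVec).contMDiff }
  let S : PartialDiffeomorph 𝓘(ℂ, C4) 𝓘(ℂ, C4) C4 (NilG ⧸ Γ) ω :=
    { toPartialEquiv := (chartAt C4 (quotMap Γ z)).symm.toPartialEquiv
      open_source := (chartAt C4 (quotMap Γ z)).open_target
      open_target := (chartAt C4 (quotMap Γ z)).open_source
      contMDiffOn_toFun := contMDiffOn_chart_symm
      contMDiffOn_invFun := contMDiffOn_chart }
  have hS : IsLocalDiffeomorphAt 𝓘(ℂ, C4) 𝓘(ℂ, C4) ω S (R z) :=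
    PartialDiffeomorph.isLocalDiffeomorphAt _ _ _ S ht
  have hc := (R.isLocalDiffeomorph z).comp _ _ hS
  have heq : (S ∘ R : C4 → NilG ⧸ Γ) = quotMap Γ := by
    rw [← quotMap_mulFun Γ hγ]
    exact congrArg (· ∘ _) (chartAt_symm Γ _)
  rwa [heq] at hc

theorem mdifferentiableAt_quotMap (z : C4) :
    MDifferentiableAt 𝓘(ℂ, C4) 𝓘(ℂ, C4) (quotMap Γ) z :=
  (isLocalDiffeomorph_quotMap Γ).mdifferentiable (by simp) z

/-- The differential of the projection, all tangent spaces being identified with `ℂ⁴`. -/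
def quotDeriv (z : C4) : C4 →L[ℂ] C4 := mfderiv 𝓘(ℂ, C4) 𝓘(ℂ, C4) (quotMap Γ) z

/-- The differential of the chart at `x` at the point `x`. -/
def chartDeriv (x : NilG ⧸ Γ) : C4 →L[ℂ] C4 := mfderiv 𝓘(ℂ, C4) 𝓘(ℂ, C4) (chartAt C4 x) x

theorem mdifferentiableAt_chartAt (x : NilG ⧸ Γ) :
    MDifferentiableAt 𝓘(ℂ, C4) 𝓘(ℂ, C4) (chartAt C4 x) x :=
  mdifferentiableAt_atlas (chart_mem_atlas C4 x) (mem_chart_source C4 x)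

theorem quotDeriv_chartDeriv (x : NilG ⧸ Γ) (c : C4) :
    quotDeriv Γ (chartAt C4 x x) (chartDeriv Γ x c) = c := by
  have h1 := mfderiv_comp x (mdifferentiableAt_quotMap Γ (chartAt C4 x x))
    (mdifferentiableAt_chartAt Γ x)
  have h2 : (quotMap Γ ∘ chartAt C4 x) =ᶠ[nhds x] id := by
    filter_upwards [(chartAt C4 x).open_source.mem_nhds (mem_chart_source C4 x)] with y hy
    rw [← chartAt_symm Γ x]
    exact (chartAt C4 x).left_inv hy
  rw [h2.mfderiv_eq, mfderiv_id] at h1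
  exact (DFunLike.congr_fun h1 c).symm

theorem quotDeriv_frame {γ : NilG} (hγ : γ ∈ Γ) (z c : C4) :
    quotDeriv Γ (mulFun z γ.toVec) (frame γ.toVec c) = quotDeriv Γ z c := by
  obtain ⟨A, hA, hAc⟩ := hasFDerivAt_mulFun_complex γ.toVec z
  have h1 := ((mdifferentiableAt_quotMap Γ (mulFun z γ.toVec)).hasMFDerivAt.comp z
    hA.hasMFDerivAt).mfderiv
  rw [quotMap_mulFun Γ hγ] at h1
  rw [← hAc]
  exact (DFunLike.congr_fun h1 c).symm

theorem exists_chartDeriv_quotDeriv (z : C4) :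
    ∃ γ : NilG, γ ∈ Γ ∧ chartAt C4 (quotMap Γ z) (quotMap Γ z) = mulFun z γ.toVec ∧
      ∀ c, chartDeriv Γ (quotMap Γ z) (quotDeriv Γ z c) = frame γ.toVec c := by
  obtain ⟨γ, hγ, -, hev⟩ := exists_chartAt_quotMap Γ z
  refine ⟨γ, hγ, hev.self_of_nhds, fun c => ?_⟩
  obtain ⟨A, hA, hAc⟩ := hasFDerivAt_mulFun_complex γ.toVec z
  have h1 := mfderiv_comp z (mdifferentiableAt_chartAt Γ (quotMap Γ z))
    (mdifferentiableAt_quotMap Γ z)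
  have h2 : (chartAt C4 (quotMap Γ z) ∘ quotMap Γ) =ᶠ[nhds z] fun y => mulFun y γ.toVec := hev
  rw [h2.mfderiv_eq, hA.hasMFDerivAt.mfderiv] at h1
  rw [← hAc]
  exact (DFunLike.congr_fun h1 c).symm

theorem chartDeriv_injective (x : NilG ⧸ Γ) : Function.Injective (chartDeriv Γ x) :=
  Function.LeftInverse.injective (quotDeriv_chartDeriv Γ x)

theorem frame_injective (z : C4) : Function.Injective (frame z) :=
  Function.LeftInverse.injective (coframeMap_frame z)

theorem quotDeriv_injective (z : C4) : Function.Injective (quotDeriv Γ z) := by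
  obtain ⟨γ, -, -, h⟩ := exists_chartDeriv_quotDeriv Γ z
  intro c d hcd
  refine frame_injective γ.toVec ?_
  rw [← h, ← h, hcd]

/-! ### Forms on the quotient as periodic forms -/

variable {k : ℕ}

/-- The pull-back to `ℂ⁴` of a form on `G ⧸ Γ`, with all tangent spaces identified with `ℂ⁴`. -/
def lift (α : Form C4 (NilG ⧸ Γ) k) (z : C4) : C4 [⋀^Fin k]→L[ℝ] ℂ :=
  ContinuousAlternatingMap.compContinuousLinearMap (α (quotMap Γ z) : C4 [⋀^Fin k]→L[ℝ] ℂ)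
    ((quotDeriv Γ z).restrictScalars ℝ)

/-- The form on `G ⧸ Γ` whose pull-back to `ℂ⁴` is a given periodic form. -/
def descend (β : C4 → C4 [⋀^Fin k]→L[ℝ] ℂ) : Form C4 (NilG ⧸ Γ) k := fun x =>
  fromChart x (β (chartAt C4 x x))

/-- The expressions of a form in all the charts are restrictions of one form on `ℂ⁴`. -/
theorem inChart_eq_lift (x : NilG ⧸ Γ) (α : Form C4 (NilG ⧸ Γ) k) : inChart x α = lift Γ α := by
  have : ∀ f : C4 → NilG ⧸ Γ, f = quotMap Γ →
      (fun y => (α (f y)).compContinuousLinearMap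
        ((mfderiv 𝓘(ℂ, C4) 𝓘(ℂ, C4) f y).restrictScalars ℝ)) = lift Γ α := by
    rintro _ rfl; rfl
  exact this _ (chartAt_symm Γ x)

theorem isInvariant_lift (α : Form C4 (NilG ⧸ Γ) k) : IsInvariant Γ (lift Γ α) := by
  intro γ hγ z
  ext v
  have hx := congrFun (quotMap_mulFun Γ hγ) z
  have h1 : ∀ x, x = quotMap Γ z → (α x : C4 [⋀^Fin k]→L[ℝ] ℂ) = α (quotMap Γ z) := by
    rintro _ rfl; rfl
  change (α (quotMap Γ (mulFun z γ.toVec)) : C4 [⋀^Fin k]→L[ℝ] ℂ)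
    (fun i => quotDeriv Γ (mulFun z γ.toVec) (frame γ.toVec (v i))) = _
  refine (DFunLike.congr_fun (h1 (quotMap Γ (mulFun z γ.toVec)) hx) _).trans ?_
  refine congrArg (α (quotMap Γ z) : C4 [⋀^Fin k]→L[ℝ] ℂ) (funext fun i => ?_)
  exact quotDeriv_frame Γ hγ z (v i)

theorem descend_lift (α : Form C4 (NilG ⧸ Γ) k) : descend Γ (lift Γ α) = α := by
  funext x
  have h1 : ∀ y, y = x → (α y : C4 [⋀^Fin k]→L[ℝ] ℂ) = α x := by rintro _ rfl; rfl
  refine ContinuousAlternatingMap.ext (M := C4) fun v => ?_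
  change (α (quotMap Γ (chartAt C4 x x)) : C4 [⋀^Fin k]→L[ℝ] ℂ)
    (fun i => quotDeriv Γ (chartAt C4 x x) (chartDeriv Γ x (v i))) = _
  refine (DFunLike.congr_fun (h1 (quotMap Γ (chartAt C4 x x)) (quotMap_chartAt Γ x)) _).trans ?_
  refine congrArg (α x : C4 [⋀^Fin k]→L[ℝ] ℂ) (funext fun i => ?_)
  exact quotDeriv_chartDeriv Γ x (v i)

theorem lift_descend {β : C4 → C4 [⋀^Fin k]→L[ℝ] ℂ} (hβ : IsInvariant Γ β) :
    lift Γ (descend Γ β) = β := by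
  funext z
  obtain ⟨γ, hγ, h1, h2⟩ := exists_chartDeriv_quotDeriv Γ z
  ext v
  rw [← hβ γ hγ z]
  change β (chartAt C4 (quotMap Γ z) (quotMap Γ z))
    (fun i => chartDeriv Γ (quotMap Γ z) (quotDeriv Γ z (v i))) = _
  rw [h1]
  simp only [h2]
  rfl

theorem lift_injective : Function.Injective (lift Γ : Form C4 (NilG ⧸ Γ) k → _) :=
  Function.LeftInverse.injective (descend_lift Γ)

theorem isSmoothForm_iff (α : Form C4 (NilG ⧸ Γ) k) : IsSmoothForm α ↔ ContDiff ℝ ∞ (lift Γ α) := by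
  constructor
  · intro h
    refine contDiff_iff_contDiffAt.2 fun z => ?_
    obtain ⟨γ, hγ, ht, -⟩ := exists_chartAt_quotMap Γ z
    have h1 := h (quotMap Γ z)
    rw [inChart_eq_lift] at h1
    have h2 := h1.contDiffAt ((chartAt C4 (quotMap Γ z)).open_target.mem_nhds ht)
    have h3 : lift Γ α = fun z =>
        ContinuousAlternatingMap.compContinuousLinearMapCLM (frame γ.toVec)
          (lift Γ α (mulFun z γ.toVec)) := funext fun z => (isInvariant_lift Γ α γ hγ z).symm
    rw [h3]
    refine (ContinuousLinearMap.contDiff _).contDiffAt.comp z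
      (ContDiffAt.comp (g := lift Γ α) z h2 ?_)
    exact ((contDiff_mul_right γ.toVec).restrict_scalars ℝ).contDiffAt
  · intro h x
    rw [inChart_eq_lift]
    exact h.contDiffOn

theorem lift_extD {α : Form C4 (NilG ⧸ Γ) k} (h : IsSmoothForm α) :
    lift Γ (extD α) = twD 1 0 (lift Γ α) := by
  rw [← extDeriv_eq_twD, show extD α = descend Γ (extDeriv (lift Γ α)) from
    funext fun x => by rw [extD, inChart_eq_lift, descend]]
  rw [extDeriv_eq_twD]
  exact lift_descend Γ ((isInvariant_lift Γ α).twD ((isSmoothForm_iff Γ α).1 h))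

theorem lift_del {α : Form C4 (NilG ⧸ Γ) k} (h : IsSmoothForm α) :
    lift Γ (del α) = twD (1 / 2) (-Complex.I / 2) (lift Γ α) := by
  rw [← flatDel_eq_twD, show del α = descend Γ (flatDel (lift Γ α)) from
    funext fun x => by rw [del, inChart_eq_lift, descend]]
  rw [flatDel_eq_twD]
  exact lift_descend Γ ((isInvariant_lift Γ α).twD ((isSmoothForm_iff Γ α).1 h))

theorem lift_delbar {α : Form C4 (NilG ⧸ Γ) k} (h : IsSmoothForm α) :
    lift Γ (delbar α) = twD (1 / 2) (Complex.I / 2) (lift Γ α) := by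
  rw [← flatDelbar_eq_twD, show delbar α = descend Γ (flatDelbar (lift Γ α)) from
    funext fun x => by rw [delbar, inChart_eq_lift, descend]]
  rw [flatDelbar_eq_twD]
  exact lift_descend Γ ((isInvariant_lift Γ α).twD ((isSmoothForm_iff Γ α).1 h))

theorem isSmoothForm_delbar {α : Form C4 (NilG ⧸ Γ) k} (h : IsSmoothForm α) :
    IsSmoothForm (delbar α) := by
  rw [isSmoothForm_iff, lift_delbar Γ h]
  exact contDiff_twD ((isSmoothForm_iff Γ α).1 h)

theorem lift_wedge {l : ℕ} (α : Form C4 (NilG ⧸ Γ) k) (β : Form C4 (NilG ⧸ Γ) l) :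
    lift Γ (α.wedge β) = fun z => wedge (lift Γ α z) (lift Γ β z) :=
  funext fun _ => (wedge_compContinuousLinearMap (V := C4) (W := C4) _ _ _).symm

end NilG

/-- Transversality is invariant under complex linear isomorphisms. -/
theorem IsTransverseAt.compContinuousLinearMap {V : Type*} [NormedAddCommGroup V] [NormedSpace ℂ V]
    [FiniteDimensional ℂ V] {p k : ℕ} (hV : Module.finrank ℂ V = p + k)
    {Ω : V [⋀^Fin (p + p)]→L[ℝ] ℂ} (hΩ : IsTransverseAt p Ω) {A : V →L[ℂ] V}
    (hA : Function.Injective A) :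
    IsTransverseAt p (Ω.compContinuousLinearMap (A.restrictScalars ℝ)) := by
  refine isTransverseAt_of_pos hV (fun c v => ?_) ?_ fun v hv => ?_
  · have := hΩ.1 c fun i => A (v i)
    simp only [← A.map_smul] at this
    exact this
  · ext v
    exact DFunLike.congr_fun hΩ.2.1 _
  · obtain ⟨c, hc, h⟩ := hΩ.pos_planeTuple hV (hv.map' A.toLinearMap (LinearMap.ker_eq_bot.2 hA))
    refine ⟨c, hc, h ▸ ?_⟩
    refine congrArg Ω (funext fun i => ?_)
    refine Fin.addCases (fun i => ?_) (fun i => ?_) i <;>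
      simp [-Fin.natAdd_eq_addNat]

namespace NilG

variable (Γ : Subgroup NilG) [IsLattice Γ]

theorem isTransverseAt_lift {p k : ℕ} (hp : p + k = 4) {Ω : Form C4 (NilG ⧸ Γ) (p + p)}
    (h : ∀ x, IsTransverseAt p (Ω x)) (z : C4) : IsTransverseAt p (lift Γ Ω z) :=
  IsTransverseAt.compContinuousLinearMap (V := C4) (finrank_C4.trans hp.symm) (h (quotMap Γ z))
    (quotDeriv_injective Γ z)

theorem isTransverseAt_descend {p k : ℕ} (hp : p + k = 4) {β : C4 → C4 [⋀^Fin (p + p)]→L[ℝ] ℂ}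
    (h : ∀ z, IsTransverseAt p (β z)) (x : NilG ⧸ Γ) : IsTransverseAt p (descend Γ β x) :=
  IsTransverseAt.compContinuousLinearMap (V := C4) (finrank_C4.trans hp.symm) (h _)
    (chartDeriv_injective Γ x)

end NilG

namespace NilG

/-! ### Pluriclosed forms on the quotient -/

theorem isTransverseAt_trivialize {p k : ℕ} (hp : p + k = 4) {β : C4 → C4 [⋀^Fin (p + p)]→L[ℝ] ℂ}
    {z : C4} (h : IsTransverseAt p (β z)) : IsTransverseAt p (trivialize β z) := by
  obtain ⟨A, -, hA⟩ := hasFDerivAt_mulFun_complex z z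
  have h1 := h.compContinuousLinearMap (finrank_C4.trans hp.symm) (A := A)
    fun c d hcd => frame_injective z (by rw [← hA, ← hA, hcd])
  have h2 : A.restrictScalars ℝ = frame z := ContinuousLinearMap.ext hA
  rwa [h2] at h1

theorem coframeMap_eq_frame_neg (z : C4) : coframeMap z = frame (-z) := by
  rw [coframeMap, frame, map_neg, sub_eq_add_neg]

theorem isTransverseAt_invForm {p k : ℕ} (hp : p + k = 4) {B : C4 [⋀^Fin (p + p)]→L[ℝ] ℂ}
    (h : IsTransverseAt p B) (z : C4) : IsTransverseAt p (invForm B z) := by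
  rw [invForm, coframeMap_eq_frame_neg]
  exact isTransverseAt_trivialize (β := fun _ => B) hp h

variable (Γ : Subgroup NilG) [IsLattice Γ] {k : ℕ}

theorem eq_zero_of_lift {α : Form C4 (NilG ⧸ Γ) k} (h : lift Γ α = 0) : α = 0 :=
  lift_injective Γ h

theorem isSmoothForm_of_lift_eq {α : Form C4 (NilG ⧸ Γ) k} {B : C4 [⋀^Fin k]→L[ℝ] ℂ}
    (h : lift Γ α = invForm B) : IsSmoothForm α := by
  rw [isSmoothForm_iff, h]
  exact contDiff_invForm B

theorem lift_del_delbar {α : Form C4 (NilG ⧸ Γ) k} (h : IsSmoothForm α) :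
    lift Γ (del (delbar α)) =
      twD (1 / 2) (-Complex.I / 2) (twD (1 / 2) (Complex.I / 2) (lift Γ α)) := by
  rw [lift_del Γ (isSmoothForm_delbar Γ h), lift_delbar Γ h]

theorem isPluriclosedForm_of_lift_eq {p l : ℕ} (hp : p + l = 4) {Ω : Form C4 (NilG ⧸ Γ) (p + p)}
    {B : C4 [⋀^Fin (p + p)]→L[ℝ] ℂ} (hΩ : lift Γ Ω = invForm B) (hB : IsTransverseAt p B)
    (h : twD (1 / 2) (-Complex.I / 2) (twD (1 / 2) (Complex.I / 2) (invForm B)) = 0) :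
    IsPluriclosedForm p Ω := by
  have hs := isSmoothForm_of_lift_eq Γ hΩ
  refine ⟨⟨hs, fun x => ?_⟩, eq_zero_of_lift Γ ?_⟩
  · rw [← descend_lift Γ Ω, hΩ]
    exact isTransverseAt_descend Γ hp (isTransverseAt_invForm hp hB) x
  · rw [lift_del_delbar Γ hs, hΩ, h]

theorem isPPL_three : IsPPL C4 (NilG ⧸ Γ) 3 := by
  refine ⟨descend Γ (invForm threeValue), isPluriclosedForm_of_lift_eq Γ (l := 1) rfl
    (lift_descend Γ (isInvariant_invForm Γ _)) isTransverseAt_threeValue ?_⟩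
  rw [twD_invForm_eq (1 / 2) (Complex.I / 2) threeValue]
  exact twD_invForm_seven _ _ _

/-! ### The coframe on the quotient -/

/-- The coframe `φ₁, …, φ₄` on `G ⧸ Γ`. -/
def quotCoframe (j : Fin 4) : Form C4 (NilG ⧸ Γ) 1 := descend Γ (invForm (coord j))

theorem lift_quotCoframe (j : Fin 4) : lift Γ (quotCoframe Γ j) = invForm (coord j) :=
  lift_descend Γ (isInvariant_invForm Γ _)

theorem coframeAt_apply (z c : C4) (j : Fin 4) : coframeAt z j c = coframeMap z c j := by
  rw [coframeMap_apply]
  fin_cases j <;> simp [coframeAt, twist]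
  ring

theorem coframe_eq_invForm (j : Fin 4) : coframe j = invForm (coord j) := by
  funext z
  refine ContinuousAlternatingMap.ext (M := C4) fun v => ?_
  exact coframeAt_apply z (v 0) j

theorem formPullback_mul_right (a : NilG) (j : Fin 4) :
    formPullback (fun z : NilG => z * a) (coframe j) = coframe j := by
  funext z
  obtain ⟨A, hA, hAc⟩ := hasFDerivAt_mulFun_complex a.toVec z
  let D : C4 →L[ℂ] C4 := mfderiv 𝓘(ℂ, C4) 𝓘(ℂ, C4) (fun z : NilG => z * a) z
  have h1 : D = A := hA.hasMFDerivAt.mfderiv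
  refine ContinuousAlternatingMap.ext (M := C4) fun v => ?_
  have h2 := isInvariant_invForm ⊤ (coord j) a (Subgroup.mem_top _) z
  rw [coframe_eq_invForm]
  refine Eq.trans ?_ (DFunLike.congr_fun h2 v)
  change invForm (coord j) (mulFun z a.toVec) (fun i => D (v i)) =
    invForm (coord j) (mulFun z a.toVec) (fun i => frame a.toVec (v i))
  rw [h1]
  simp only [hAc]

theorem formPullback_quotCoframe (j : Fin 4) :
    formPullback ((↑) : NilG → NilG ⧸ Γ) (quotCoframe Γ j) = coframe j := by
  rw [coframe_eq_invForm, ← lift_quotCoframe Γ j]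
  rfl

theorem hasType_quotCoframe (j : Fin 4) (x : NilG ⧸ Γ) : HasType 1 0 (quotCoframe Γ j x) := by
  have h : ∀ (c : ℂ) (u w : C4), coframeMap w (chartDeriv Γ x (c • u)) j
      = c ^ 1 * starRingEnd ℂ c ^ 0 * coframeMap w (chartDeriv Γ x u) j := by
    intro c u w
    rw [ContinuousLinearMap.map_smul, coframeMap_eq_frame_neg, frame_smul]
    simp
  exact fun c v => h c (v 0) _

theorem linearIndependent_quotCoframe (x : NilG ⧸ Γ) :
    LinearIndependent ℂ fun j => quotCoframe Γ j x := by
  obtain ⟨z, rfl⟩ := quotMap_surjective Γ x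
  rw [Fintype.linearIndependent_iff]
  intro g hg i
  let u : Fin 1 → TangentSpace 𝓘(ℂ, C4) (quotMap Γ z) := fun _ => quotDeriv Γ z (frame z (e i))
  have h1 := DFunLike.congr_fun hg u
  have h2 : ∀ j, quotCoframe Γ j (quotMap Γ z) u = e i j := by
    intro j
    have h3 : lift Γ (quotCoframe Γ j) z (fun _ => frame z (e i)) = e i j := by
      rw [lift_quotCoframe, invForm_apply, coord_apply, coframeMap_frame]
    exact h3
  rw [ContinuousAlternatingMap.sum_apply] at h1
  simp only [ContinuousAlternatingMap.smul_apply, h2] at h1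
  simpa [e, Pi.single_apply] using h1

theorem lift_conj (α : Form C4 (NilG ⧸ Γ) k) :
    lift Γ α.conj = fun z => conjForm (lift Γ α z) := rfl

theorem lift_quotCoframe_wedge (i j : Fin 4) :
    lift Γ ((quotCoframe Γ i).wedge (quotCoframe Γ j)) = invForm (wedge (coord i) (coord j)) := by
  rw [lift_wedge, lift_quotCoframe, lift_quotCoframe]
  exact funext fun z => wedge_compContinuousLinearMap _ _ _

theorem lift_quotCoframe_wedge_conj (i j : Fin 4) :
    lift Γ ((quotCoframe Γ i).wedge (quotCoframe Γ j).conj)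
      = invForm (wedge (coord i) (conjForm (coord j))) := by
  rw [lift_wedge, lift_conj, lift_quotCoframe, lift_quotCoframe]
  exact funext fun z => wedge_compContinuousLinearMap _ (conjForm (coord j)) _

theorem isSmoothForm_quotCoframe (j : Fin 4) : IsSmoothForm (quotCoframe Γ j) :=
  isSmoothForm_of_lift_eq Γ (lift_quotCoframe Γ j)

theorem extD_quotCoframe {j : Fin 4} (hj : j = 0 ∨ j = 1) : extD (quotCoframe Γ j) = 0 := by
  refine eq_zero_of_lift Γ ?_
  rw [lift_extD Γ (isSmoothForm_quotCoframe Γ j), lift_quotCoframe, twD_invForm_coord_of_lt _ _ hj]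

theorem del_quotCoframe {j : Fin 4} (hj : j = 2 ∨ j = 3) :
    del (quotCoframe Γ j) = (quotCoframe Γ 0).wedge (quotCoframe Γ 1) := by
  refine lift_injective Γ ?_
  rw [lift_del Γ (isSmoothForm_quotCoframe Γ j), lift_quotCoframe, twD_del_coord hj,
    lift_quotCoframe_wedge]

theorem delbar_quotCoframe_two : delbar (quotCoframe Γ 2) =
    (quotCoframe Γ 0).wedge (quotCoframe Γ 0).conj
      + (quotCoframe Γ 1).wedge (quotCoframe Γ 1).conj := by
  refine lift_injective Γ ?_
  rw [lift_delbar Γ (isSmoothForm_quotCoframe Γ 2), lift_quotCoframe, twD_delbar_coord_two]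
  change _ = lift Γ ((quotCoframe Γ 0).wedge (quotCoframe Γ 0).conj)
    + lift Γ ((quotCoframe Γ 1).wedge (quotCoframe Γ 1).conj)
  rw [lift_quotCoframe_wedge_conj, lift_quotCoframe_wedge_conj]
  rfl

theorem delbar_quotCoframe_three : delbar (quotCoframe Γ 3) = 0 := by
  refine eq_zero_of_lift Γ ?_
  rw [lift_delbar Γ (isSmoothForm_quotCoframe Γ 3), lift_quotCoframe, twD_delbar_coord_three]

theorem isPluriclosedForm_skt : IsPluriclosedForm 1
    fun x => sigmaConst 1 • ∑ j, (quotCoframe Γ j).wedge (quotCoframe Γ j).conj x := by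
  refine isPluriclosedForm_of_lift_eq Γ (l := 3) rfl (B := sktValue) ?_ isTransverseAt_sktValue
    twD_twD_sktValue
  funext z
  ext v
  have h1 : lift Γ
      (fun x => sigmaConst 1 • ∑ j, (quotCoframe Γ j).wedge (quotCoframe Γ j).conj x) z v
      = sigmaConst 1 • ∑ j, lift Γ ((quotCoframe Γ j).wedge (quotCoframe Γ j).conj) z v := by
    refine congrArg (fun r : ℂ => sigmaConst 1 • r) ?_
    exact ContinuousAlternatingMap.sum_apply (M := C4) _ _
  rw [h1]
  simp only [lift_quotCoframe_wedge_conj]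
  refine congrArg (fun r : ℂ => sigmaConst 1 • r) ?_
  exact (ContinuousAlternatingMap.sum_apply _ _).symm

theorem isPPL_one : IsPPL C4 (NilG ⧸ Γ) 1 := ⟨_, isPluriclosedForm_skt Γ⟩

/-! ### Nonexistence results -/

/-- The values of a transverse form on complex planes of the invariant frame are positive, so they
are not divergences. -/
theorem sum_trivialize_notMem_divSpace {p m : ℕ} (hp : p ≤ 4)
    {β : C4 → C4 [⋀^Fin (p + p)]→L[ℝ] ℂ} (hi : IsInvariant Γ β) (h : ∀ z, IsTransverseAt p (β z))
    {T : Fin (m + 1) → Fin p → C4} (hT : ∀ t, LinearIndependent ℂ (T t)) :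
    (fun z => ∑ t, trivialize β z (planeTuple (T t))) ∉ divSpace Γ := by
  intro hmem
  obtain ⟨l, hl⟩ := Nat.exists_eq_add_of_le hp
  have h1 := Submodule.smul_mem _ (transverseConst p l)⁻¹ hmem
  refine not_forall_pos_of_mem_divSpace h1 (fun γ hγ z => ?_) fun z => ?_
  · simp only [Pi.smul_apply]
    congr 1
    exact Finset.sum_congr rfl fun t _ => hi.trivialize_periodic _ γ hγ z
  · choose c hc0 hc using fun t =>
      (isTransverseAt_trivialize hl.symm (h z)).pos_planeTuple (finrank_C4.trans hl) (hT t)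
    refine ⟨∑ t, c t, Finset.sum_pos (fun t _ => hc0 t) Finset.univ_nonempty, ?_⟩
    simp only [Pi.smul_apply, hc, smul_eq_mul]
    rw [← Finset.sum_mul, mul_comm, mul_assoc, mul_inv_cancel₀ (transverseConst_ne_zero p l),
      mul_one]
    push_cast
    rfl

theorem not_isPPL_two : ¬ IsPPL C4 (NilG ⧸ Γ) 2 := by
  rintro ⟨Ω, ⟨hs, ht⟩, hΩ⟩
  have h1 := twD_twD_mem_divSpace (1 / 2) (-Complex.I / 2) (1 / 2) (Complex.I / 2)
    ((isSmoothForm_iff Γ Ω).1 hs) (isInvariant_lift Γ Ω)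
  rw [← lift_del_delbar Γ hs, hΩ] at h1
  refine sum_trivialize_notMem_divSpace Γ (by norm_num) (isInvariant_lift Γ Ω)
    (isTransverseAt_lift Γ (k := 2) rfl ht) (m := 0) (T := ![![e 2, eW]])
    (fun t => by fin_cases t; exact linearIndependent_two) ?_
  refine cast (congrArg (· ∈ divSpace Γ) (funext fun z => ?_))
    (Submodule.smul_mem _ (4 * Complex.I)⁻¹ h1)
  have h2 : (4 * Complex.I) ≠ 0 := by simp
  rw [Fin.sum_univ_one]
  change _ = trivialize (lift Γ Ω) z (planeTuple ![e 2, eW])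
  rw [planeTuple_two]
  refine (inv_mul_eq_iff_eq_mul₀ h2).2 ?_
  change 0 + _ = _
  ring

/-- A closed form does not agree with a transverse form on complex planes. -/
theorem extD_ne_zero_of_transverse {p : ℕ} (h1 : 1 ≤ p) (h3 : p ≤ 3)
    {Ψ Ω : Form C4 (NilG ⧸ Γ) (p + p)} (hs : IsSmoothForm Ψ) (ht : ∀ x, IsTransverseAt p (Ω x))
    (h : ∀ z v, lift Γ Ψ z (planeTuple v) = lift Γ Ω z (planeTuple v)) : extD Ψ ≠ 0 := by
  intro hd
  obtain ⟨m, T, ξ, s, hs0, hT, hi, -⟩ := hasObstruction Γ h1 h3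
  have h4 := hi _ rfl 1 0 _ ((isSmoothForm_iff Γ Ψ).1 hs) (isInvariant_lift Γ Ψ)
  rw [← lift_extD Γ hs, hd] at h4
  refine sum_trivialize_notMem_divSpace Γ (by omega) (isInvariant_lift Γ Ω)
    (isTransverseAt_lift Γ (k := 4 - p) (by omega) ht) hT ?_
  refine cast (congrArg (· ∈ divSpace Γ) (funext fun z => ?_)) (Submodule.smul_mem _ s⁻¹ h4)
  refine (inv_mul_eq_iff_eq_mul₀ hs0).2 ?_
  change 0 + 1 * s * _ = _
  rw [zero_add, one_mul]
  congr 1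
  refine Finset.sum_congr rfl fun t _ => ?_
  have hpl : ∀ v : Fin p → C4,
      (fun i => frame z (planeTuple v i)) = planeTuple fun i => frame z (v i) := by
    intro v
    funext i
    refine Fin.addCases (fun i => ?_) (fun i => ?_) i <;>
      simp [-Fin.natAdd_eq_addNat, frame_smul]
  change lift Γ Ψ z (fun i => frame z (planeTuple (T t) i))
    = lift Γ Ω z (fun i => frame z (planeTuple (T t) i))
  rw [hpl, h]

theorem not_isPK {p : ℕ} (h1 : 1 ≤ p) (h3 : p ≤ 3) : ¬ IsPK C4 (NilG ⧸ Γ) p := by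
  rintro ⟨Ω, ⟨hs, ht⟩, hd⟩
  exact extD_ne_zero_of_transverse Γ h1 h3 hs ht (fun _ _ => rfl) hd

/-- The components of type `(a, b)`, `a ≠ b`, vanish on complex planes. -/
theorem not_isPS {p : ℕ} (h1 : 1 ≤ p) (h3 : p ≤ 3) : ¬ IsPS C4 (NilG ⧸ Γ) p := by
  rintro ⟨Ψ, hs, -, hd, c, hc, hsum, ht⟩
  refine extD_ne_zero_of_transverse Γ h1 h3 hs ht (fun z v => ?_) hd
  have h4 : lift Γ Ψ z (planeTuple v)
      = ∑ a ∈ Finset.range (p + p + 1), lift Γ (c a) z (planeTuple v) := by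
    rw [hsum]
    change ((∑ a ∈ Finset.range (p + p + 1), c a) (quotMap Γ z) : C4 [⋀^Fin (p + p)]→L[ℝ] ℂ) _ = _
    rw [Finset.sum_apply]
    exact ContinuousAlternatingMap.sum_apply (M := C4) _ _
  rw [h4, Finset.sum_eq_single_of_mem p (by simp)]
  intro a ha hap
  rw [Finset.mem_range] at ha
  refine HasType.planeTuple_eq_zero (a := a) (b := p + p - a) (by omega) (fun r u => ?_) v
  have := hc a (by omega) (quotMap Γ z) r fun i => quotDeriv Γ z (u i)
  refine Eq.trans ?_ this
  refine congrArg (c a (quotMap Γ z)) (funext fun i => ?_)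
  exact (quotDeriv Γ z).map_smul r (u i)

/-- The obstruction is applied to `∂Ω` and to `∂(∂̄α)`, and the second part of the obstruction
removes the values of `∂̄α`. -/
theorem not_isPWK {p : ℕ} (h1 : 1 ≤ p) (h3 : p ≤ 3) : ¬ IsPWK C4 (NilG ⧸ Γ) p := by
  rintro ⟨Ω, ⟨hs, ht⟩, j, h, α, hα, hd⟩
  obtain ⟨m, T, ξ, s, hs0, hT, hi, hii⟩ := hasObstruction Γ h1 h3
  have hj : j + 1 = p + p := by omega
  have h4 := hi _ rfl (1 / 2) (-Complex.I / 2) _ ((isSmoothForm_iff Γ Ω).1 hs)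
    (isInvariant_lift Γ Ω)
  have hα' := (isSmoothForm_iff Γ _).1 (isSmoothForm_delbar Γ hα)
  have h5 := hi _ hj (1 / 2) (-Complex.I / 2) _ hα' (isInvariant_lift Γ _)
  have h6 := hii _ hj (1 / 2) (Complex.I / 2) _ ((isSmoothForm_iff Γ α).1 hα) (isInvariant_lift Γ _)
  rw [← lift_del Γ hs] at h4
  rw [← lift_del Γ (isSmoothForm_delbar Γ hα)] at h5
  rw [← lift_delbar Γ hα] at h6
  refine sum_trivialize_notMem_divSpace Γ (by omega) (isInvariant_lift Γ Ω)
    (isTransverseAt_lift Γ (k := 4 - p) (by omega) ht) hT ?_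
  refine cast (congrArg (· ∈ divSpace Γ) (funext fun z => ?_))
    (Submodule.add_mem _ (Submodule.smul_mem _ (2 * s⁻¹) (Submodule.sub_mem _ h4 h5)) h6)
  have h7 : trivialize (lift Γ (del Ω)) z (fun i => ξ i)
      = trivialize (lift Γ (del (delbar α))) z fun i => ξ (Fin.cast (by rw [hj]) i) :=
    hd (quotMap Γ z) fun i => quotDeriv Γ z (frame z (ξ (Fin.cast (by rw [hj]) i)))
  change 2 * s⁻¹ * ((trivialize (lift Γ (del Ω)) z (fun i => ξ i) + 1 / 2 * s *
      ∑ t, trivialize (lift Γ Ω) z (planeTuple (T t)))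
    - (trivialize (lift Γ (del (delbar α))) z (fun i => ξ (Fin.cast (by rw [hj]) i)) + 1 / 2 * s *
      ∑ t, trivialize (lift Γ (delbar α)) z fun i => planeTuple (T t) (Fin.cast hj i)))
    + ∑ t, trivialize (lift Γ (delbar α)) z (fun i => planeTuple (T t) (Fin.cast hj i)) = _
  rw [h7]
  field_simp
  ring

theorem not_exists_index : ¬ ∃ q : ℕ, ∀ s : ℕ, 1 ≤ s → s ≤ 3 →
    (IsPPL C4 (NilG ⧸ Γ) s ↔ q ≤ s) := by
  rintro ⟨q, hq⟩
  have h1 := (hq 1 le_rfl (by norm_num)).1 (isPPL_one Γ)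
  exact not_isPPL_two Γ ((hq 2 (by norm_num) (by norm_num)).2 (by omega))

end NilG

namespace NilG

/-! ### The group -/

theorem contDiff_mulFun : ContDiff ℝ ∞ fun p : C4 × C4 => mulFun p.1 p.2 := by
  have : (fun p : C4 × C4 => mulFun p.1 p.2) = fun p => p.1 + p.2 + twistCLM p.2 p.1 :=
    funext fun p => mulFun_eq p.1 p.2
  rw [this]
  exact (contDiff_fst.add contDiff_snd).add
    ((twistCLM.contDiff.comp contDiff_snd).clm_apply contDiff_fst)

theorem invFun_eq (a : C4) : invFun a = -a + twist a a := by
  funext i; fin_cases i <;> simp [invFun, twist]; all_goals ring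

theorem contDiff_invFun : ContDiff ℝ ∞ fun a : C4 => invFun a := by
  simp only [invFun_eq]
  exact contDiff_neg.add (twistCLM.contDiff.clm_apply contDiff_id)

theorem lieGroup : LieGroup 𝓘(ℝ, C4) ∞ NilG :=
  { (inferInstanceAs (IsManifold 𝓘(ℝ, C4) ∞ C4) : IsManifold 𝓘(ℝ, C4) ∞ NilG) with
    contMDiff_mul := by
      change ContMDiff (𝓘(ℝ, C4).prod 𝓘(ℝ, C4)) 𝓘(ℝ, C4) ∞ fun p : C4 × C4 => mulFun p.1 p.2
      rw [← modelWithCornersSelf_prod, chartedSpaceSelf_prod]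
      exact contDiff_mulFun.contMDiff
    contMDiff_inv := contDiff_invFun.contMDiff }

theorem contractibleSpace : ContractibleSpace NilG :=
  inferInstanceAs (ContractibleSpace C4)

theorem simplyConnectedSpace : SimplyConnectedSpace NilG := by
  have := contractibleSpace
  infer_instance

/-- The projection of the group onto its abelianization. -/
def toAbelian : NilG →* Multiplicative (ℂ × ℂ) where
  toFun z := Multiplicative.ofAdd (z.toVec 0, z.toVec 1)
  map_one' := rfl
  map_mul' _ _ := rfl

theorem isNilpotent : Group.IsNilpotent NilG := by
  refine Subgroup.isNilpotent_of_ker_le_center toAbelian fun z hz => ?_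
  have h1 : (z.toVec 0, z.toVec 1) = ((0, 0) : ℂ × ℂ) := hz
  have hc : IsCentral z.toVec := Prod.mk.inj h1
  refine Subgroup.mem_center_iff.2 fun a => ?_
  change mulFun a.toVec z.toVec = mulFun z.toVec a.toVec
  rw [mulFun_eq, mulFun_eq, hc.twist_left, hc.twist_right, add_comm a.toVec]

/-! ### Lattices -/

/-- The points of the group with Gaussian integer coordinates. -/
def gaussianLattice : Subgroup NilG where
  carrier := {z | ∀ i, z.toVec i ∈ GaussianInt.toComplex.range}
  one_mem' := fun _ => Subring.zero_mem _
  mul_mem' := by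
    intro a b ha hb
    choose x hx using ha
    choose y hy using hb
    have key : ∀ i, mulFun a.toVec b.toVec i ∈ GaussianInt.toComplex.range := by
      refine Fin.forall_fin_succ.2 ⟨⟨x 0 + y 0, ?_⟩, Fin.forall_fin_succ.2 ⟨⟨x 1 + y 1, ?_⟩,
        Fin.forall_fin_succ.2 ⟨⟨x 2 + y 2 - y 0 * x 1 + star (y 0) * x 0 + star (y 1) * x 1, ?_⟩,
        Fin.forall_fin_one.2 ⟨x 3 + y 3 - y 0 * x 1, ?_⟩⟩⟩⟩ <;>
      simp only [map_add, map_sub, map_mul, GaussianInt.toComplex_star, hx, hy] <;> rfl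
    exact key
  inv_mem' := by
    intro a ha
    choose x hx using ha
    have key : ∀ i, invFun a.toVec i ∈ GaussianInt.toComplex.range := by
      refine Fin.forall_fin_succ.2 ⟨⟨-x 0, ?_⟩, Fin.forall_fin_succ.2 ⟨⟨-x 1, ?_⟩,
        Fin.forall_fin_succ.2 ⟨⟨-x 2 - x 0 * x 1 + star (x 0) * x 0 + star (x 1) * x 1, ?_⟩,
        Fin.forall_fin_one.2 ⟨-x 3 - x 0 * x 1, ?_⟩⟩⟩⟩ <;>
      simp only [map_add, map_sub, map_neg, map_mul, GaussianInt.toComplex_star, hx] <;> rfl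
    exact key

theorem exists_gaussianInt_norm_add_le (w : ℂ) :
    ∃ g : GaussianInt, ‖w + GaussianInt.toComplex g‖ ≤ 1 := by
  refine ⟨⟨-round w.re, -round w.im⟩, (Complex.norm_le_abs_re_add_abs_im _).trans ?_⟩
  have h1 := abs_sub_round w.re
  have h2 := abs_sub_round w.im
  rw [Complex.add_re, Complex.add_im, GaussianInt.re_toComplex, GaussianInt.im_toComplex]
  push_cast
  rw [← sub_eq_add_neg, ← sub_eq_add_neg]
  linarith

theorem exists_mul_mem_closedBall (z : C4) :
    ∃ γ : NilG, γ ∈ gaussianLattice ∧ mulFun z γ.toVec ∈ Metric.closedBall (0 : C4) 1 := by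
  obtain ⟨g0, h0⟩ := exists_gaussianInt_norm_add_le (z 0)
  obtain ⟨g1, h1⟩ := exists_gaussianInt_norm_add_le (z 1)
  set u : C4 := ![GaussianInt.toComplex g0, GaussianInt.toComplex g1, 0, 0] with hu
  obtain ⟨g2, h2⟩ := exists_gaussianInt_norm_add_le (mulFun z u 2)
  obtain ⟨g3, h3⟩ := exists_gaussianInt_norm_add_le (mulFun z u 3)
  let γ : C4 := ![GaussianInt.toComplex g0, GaussianInt.toComplex g1, GaussianInt.toComplex g2,
    GaussianInt.toComplex g3]
  have hγ : ∀ i, γ i ∈ GaussianInt.toComplex.range := by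
    intro i
    fin_cases i
    exacts [⟨g0, rfl⟩, ⟨g1, rfl⟩, ⟨g2, rfl⟩, ⟨g3, rfl⟩]
  refine ⟨γ, hγ, ?_⟩
  change mulFun z γ ∈ _
  rw [mem_closedBall_zero_iff, pi_norm_le_iff_of_nonneg zero_le_one]
  intro i
  fin_cases i
  · exact h0
  · exact h1
  · have : mulFun z γ 2 = mulFun z u 2 + GaussianInt.toComplex g2 := by
      simp [mulFun, γ, hu]; ring
    exact this ▸ h2
  · have : mulFun z γ 3 = mulFun z u 3 + GaussianInt.toComplex g3 := by
      simp [mulFun, γ, hu]; ring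
    exact this ▸ h3

theorem isLattice_gaussianLattice : IsLattice gaussianLattice where
  discrete := by
    refine discreteTopology_of_isOpen_singleton_one ?_
    have ho : IsOpen {z : NilG | z.toVec ∈ Metric.ball (0 : C4) 1} :=
      Metric.isOpen_ball (α := C4)
    convert! ho.preimage (continuous_subtype_val (p := (· ∈ gaussianLattice))) using 1
    ext ⟨γ, hγ⟩
    constructor
    · intro h
      obtain rfl : γ = 1 := congrArg Subtype.val h
      exact Metric.mem_ball_self (α := C4) one_pos
    · intro h
      refine Subtype.ext (funext fun i => ?_)
      obtain ⟨g, hg⟩ := hγ i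
      have h1 : ‖γ.toVec i‖ < 1 := (norm_le_pi_norm _ i).trans_lt (mem_ball_zero_iff.1 h)
      -- a Gaussian integer in the open unit disc vanishes
      have h2 : |((g.re : ℤ) : ℝ)| < 1 := by
        rw [GaussianInt.intCast_re, hg]
        exact (Complex.abs_re_le_norm _).trans_lt h1
      have h3 : |((g.im : ℤ) : ℝ)| < 1 := by
        rw [GaussianInt.intCast_im, hg]
        exact (Complex.abs_im_le_norm _).trans_lt h1
      have h4 : g = 0 := by
        refine Zsqrtd.ext (Int.abs_lt_one_iff.1 ?_) (Int.abs_lt_one_iff.1 ?_)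
        · exact_mod_cast h2
        · exact_mod_cast h3
      rw [h4, map_zero] at hg
      exact hg.symm
  cocompact := by
    refine ⟨?_⟩
    have hc : IsCompact (quotMap gaussianLattice '' Metric.closedBall (0 : C4) 1) :=
      (isCompact_closedBall 0 1).image (QuotientGroup.continuous_mk (G := NilG))
    convert! hc
    refine (Set.eq_univ_of_forall fun x => ?_).symm
    obtain ⟨z, rfl⟩ := quotMap_surjective gaussianLattice x
    obtain ⟨γ, hγ, h⟩ := exists_mul_mem_closedBall z
    exact ⟨_, h, congrFun (quotMap_mulFun gaussianLattice hγ) z⟩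

theorem t2Space_quotient (Γ : Subgroup NilG) [hΓ : IsLattice Γ] : T2Space (NilG ⧸ Γ) := by
  have := hΓ.discrete
  have : IsClosed (Γ : Set NilG) := Subgroup.isClosed_of_discrete
  infer_instance

theorem connectedSpace_quotient (Γ : Subgroup NilG) : ConnectedSpace (NilG ⧸ Γ) := by
  have := contractibleSpace
  exact (QuotientGroup.mk_surjective (s := Γ)).connectedSpace QuotientGroup.continuous_mk

end NilG

theorem mainTheorem7 :
    -- `G` is a simply connected nilpotent (real) Lie group with an invariant coframe of `(1,0)`-forms
    LieGroup 𝓘(ℝ, Fin 4 → ℂ) ∞ NilG ∧ SimplyConnectedSpace NilG ∧ Group.IsNilpotent NilG ∧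
    (∀ (a : NilG) (j : Fin 4),
      formPullback (fun z : NilG => z * a) (NilG.coframe j) = NilG.coframe j) ∧
    -- `G` has lattices
    (∃ Γ : Subgroup NilG, NilG.IsLattice Γ) ∧
    -- for every lattice `Γ`, the compact complex manifold `M = G ⧸ Γ` has the stated properties
    ∀ (Γ : Subgroup NilG) [NilG.IsLattice Γ],
      T2Space (NilG ⧸ Γ) ∧ ConnectedSpace (NilG ⧸ Γ) ∧
      IsLocalDiffeomorph 𝓘(ℂ, Fin 4 → ℂ) 𝓘(ℂ, Fin 4 → ℂ) ω ((↑) : NilG → NilG ⧸ Γ) ∧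
      -- the invariant coframe on `M`, its structure equations, and the explicit SKT form
      (∃ φ : Fin 4 → Form (Fin 4 → ℂ) (NilG ⧸ Γ) 1,
        (∀ j, formPullback ((↑) : NilG → NilG ⧸ Γ) (φ j) = NilG.coframe j) ∧
        (∀ j, IsSmoothForm (φ j)) ∧
        (∀ j x, HasType 1 0 (φ j x)) ∧
        (∀ x, LinearIndependent ℂ fun j => φ j x) ∧
        extD (φ 0) = 0 ∧ extD (φ 1) = 0 ∧
        del (φ 2) = (φ 0).wedge (φ 1) ∧
        delbar (φ 2) = (φ 0).wedge (φ 0).conj + (φ 1).wedge (φ 1).conj ∧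
        del (φ 3) = (φ 0).wedge (φ 1) ∧
        delbar (φ 3) = 0 ∧
        IsPluriclosedForm 1 (fun x => sigmaConst 1 • ∑ j, (φ j).wedge (φ j).conj x)) ∧
      -- `M` is 1PL (SKT), not 2PL, and 3PL
      IsPPL (Fin 4 → ℂ) (NilG ⧸ Γ) 1 ∧
      ¬ IsPPL (Fin 4 → ℂ) (NilG ⧸ Γ) 2 ∧
      IsPPL (Fin 4 → ℂ) (NilG ⧸ Γ) 3 ∧
      -- `M` is not pS, not pWK and not pK for all `p = 1, 2, 3`
      (∀ p : ℕ, 1 ≤ p → p ≤ 3 →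
        ¬ IsPS (Fin 4 → ℂ) (NilG ⧸ Γ) p ∧
        ¬ IsPWK (Fin 4 → ℂ) (NilG ⧸ Γ) p ∧
        ¬ IsPK (Fin 4 → ℂ) (NilG ⧸ Γ) p) ∧
      -- the indices `s` for which `M` is sPL are not those from a certain index `q` on
      ¬ ∃ q : ℕ, ∀ s : ℕ, 1 ≤ s → s ≤ 3 → (IsPPL (Fin 4 → ℂ) (NilG ⧸ Γ) s ↔ q ≤ s) := by
  refine ⟨NilG.lieGroup, NilG.simplyConnectedSpace, NilG.isNilpotent, NilG.formPullback_mul_right,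
    ⟨_, NilG.isLattice_gaussianLattice⟩, fun Γ _ => ⟨NilG.t2Space_quotient Γ,
      NilG.connectedSpace_quotient Γ, NilG.isLocalDiffeomorph_quotMap Γ,
      ⟨NilG.quotCoframe Γ, NilG.formPullback_quotCoframe Γ, NilG.isSmoothForm_quotCoframe Γ,
        NilG.hasType_quotCoframe Γ, NilG.linearIndependent_quotCoframe Γ,
        NilG.extD_quotCoframe Γ (Or.inl rfl), NilG.extD_quotCoframe Γ (Or.inr rfl),
        NilG.del_quotCoframe Γ (Or.inl rfl), NilG.delbar_quotCoframe_two Γ,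
        NilG.del_quotCoframe Γ (Or.inr rfl), NilG.delbar_quotCoframe_three Γ,
        NilG.isPluriclosedForm_skt Γ⟩,
      NilG.isPPL_one Γ, NilG.not_isPPL_two Γ, NilG.isPPL_three Γ,
      fun p h1 h3 => ⟨NilG.not_isPS Γ h1 h3, NilG.not_isPWK Γ h1 h3, NilG.not_isPK Γ h1 h3⟩,
      NilG.not_exists_index Γ⟩⟩
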